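/- **Corollary 1 (Regret bound of UCRL-MNL+).** Setting. Let $\mathcal M=(\mathcal S,\mathcal A,H,\{P_h\}_{h=1}^H,r)$ be an episodic MDP with rewards $r(s,a)\in[0,1]$ known to the learner, and let $\varphi:\mathcal S\times\mathcal A\times\mathcal S\to\mathbb R^d$ be a known feature map, $d\ge 1$. For each $(s,a)$ let $\mathcal S_{s,a}$ be the set of states reachable from $s$ by $a$; it is finite, the same at all steps, known to the learner, and $|\mathcal S_{s,a}|\le\mathcal U$ for an integer $\mathcal U\ge 2$. For $\theta\in\mathbb R^d$ and $s'\in\mathcal S_{s,a}$ put $$P_\theta(s'\mid s,a)=\frac{\exp(\varphi(s,a,s')^\top\theta)}{\sum_{\tilde s\in\mathcal S_{s,a}}\exp(\varphi(s,a,\tilde s)^\top\theta)},\qquad \bar\varphi(s,a,s';\theta)=\varphi(s,a,s')-\sum_{\tilde s\in\mathcal S_{s,a}}P_\theta(\tilde s\mid s,a)\,\varphi(s,a,\tilde s).$$ Assume: (1) for each $h\in[H]$ there is an unknown $\theta_h^*\in\mathbb R^d$ with $P_h(s'\mid s,a)=P_{\theta^*_h}(s'\mid s,a)$ for all $(s,a)$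 and $s'\in\mathcal S_{s,a}$; (2) $\|\varphi(s,a,s')\|_2\le L_\varphi$ for $s'\in\mathcal S_{s,a}$ and $\|\theta_h^*\|_2\le L_\theta$ for $h\in[H]$, with $L_\varphi,L_\theta>0$; (3) for every $(s,a)$ some $s'\in\mathcal S_{s,a}$ has $\varphi(s,a,s')=0$; (4) $\kappa>0$ satisfies $P_\theta(s'\mid s,a)P_\theta(\tilde s\mid s,a)\ge\kappa$ for all $(s,a)$, all distinct $s',\tilde s\in\mathcal S_{s,a}$ and all $\theta$ with $\|\theta\|_2\le L_\theta$. Algorithm (UCRL-MNL+, with inputs $\lambda,\eta,\{\beta_k\}$). Start with $\theta^1_h=0$ and $B_{1,h}=\lambda I_d$. In episode $k$, an initial state $s_1^k$ is given (it may depend on the past episodes in an arbitrary, possibly random way). With $\hat V^k_{H+1}=0$, for $h=H,\dots,1$ put $$\hat Q^k_h(s,a)=r(s,a)+\sum_{s'\in\mathcal S_{s,a}}P_{\theta^k_h}(s'\mid s,a)\hat V^k_{h+1}(s')+b_{k,h}(s,a),\qquad \hat V^k_h(s)=\min\{\max_{a}\hat Q^k_h(s,a),H\},$$ $$b_{k,h}(s,a)=H\beta_k\sum_{s'\in\mathcal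 S_{s,a}}P_{\theta^k_h}(s'\mid s,a)\,\|\bar\varphi(s,a,s';\theta^k_h)\|_{B_{k,h}^{-1}}+3H\beta_k^2\max_{s'\in\mathcal S_{s,a}}\|\varphi(s,a,s')\|^2_{B_{k,h}^{-1}},$$ where $\|x\|_M=\sqrt{x^\top Mx}$. Play the greedy policy $\pi^k_h(s)\in\arg\max_a\hat Q^k_h(s,a)$ (ties broken arbitrarily), observe the trajectory, and with $\ell_{k,h}(\theta)=-\log P_\theta(s^k_{h+1}\mid s^k_h,a^k_h)$ update $$\theta^{k+1}_h=\arg\min_{\|\theta\|_2\le L_\theta}\Big\{\tfrac1{2\eta}\|\theta-\theta^k_h\|^2_{\tilde B_{k,h}}+\theta^\top\nabla\ell_{k,h}(\theta^k_h)\Big\},\quad \tilde B_{k,h}=B_{k,h}+\eta\nabla^2\ell_{k,h}(\theta^k_h),\quad B_{k+1,h}=B_{k,h}+\nabla^2\ell_{k,h}(\theta^{k+1}_h).$$ Claim. There is an absolute exponent $q\in\mathbb N$, and for every $L_0>0$ there are constants $c_\lambda,c_\beta,c_\eta,C>0$ depending only on $L_0$, such that the following holds in every setting as above with $L_\varphi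 L_\theta\le L_0$ and for all $K\ge1$ and $\delta\in(0,1)$. If the inputs are $$\lambda=c_\lambda L_\varphi^2\,d\log\mathcal U,\qquad \eta=c_\eta\log\mathcal U,\qquad \beta_k=c_\beta\sqrt d\,\log\mathcal U\,\log(1+kH/\delta),$$ then with probability at least $1-\delta$, with $T=KH$, $$\sum_{k=1}^K\big(V_1^*-V_1^{\pi^k}\big)(s_1^k)\ \le\ C\,\Big(\log\big(1+\mathcal U T/\delta\big)\Big)^{q}\Big(dH^{3/2}\sqrt T+\kappa^{-1}d^2H^2\Big).$$ Here $V_1^{\pi}(s)$ is the expected sum of the rewards of an episode started at $s$ under $\pi$, and $V_1^*(s)=\sup_\pi V_1^\pi(s)$. -/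

import Mathlib

universe u v

noncomputable section

namespace MNL

/-- The parameter space `ℝ^d` with its Euclidean norm. -/
abbrev Vec (d : ℕ) := EuclideanSpace ℝ (Fin d)

/-! ### Weighted norms and Hessians -/

/-- The weighted norm `‖x‖_M = √(xᵀ M x)`. -/
def wnorm {d : ℕ} (M : Matrix (Fin d) (Fin d) ℝ) (x : Vec d) : ℝ :=
  √(x.ofLp ⬝ᵥ M.mulVec x.ofLp)

/-- The Hessian matrix `∇² f (θ)`, i.e. the Jacobian matrix of the gradient. -/
def hessian {d : ℕ} (f : Vec d → ℝ) (θ : Vec d) : Matrix (Fin d) (Fin d) ℝ :=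
  Matrix.of fun i j => (fderiv ℝ (gradient f) θ (EuclideanSpace.single j 1)) i

/-! ### The multinomial logistic model

Here `R` is a finite set of outcomes and `f` assigns to each outcome its feature. -/

/-- The multinomial logistic probability `P_θ(x)` of the outcome `x` among the outcomes `R`. -/
def mnlProb {S : Type*} {d : ℕ} (R : Finset S) (f : S → Vec d) (θ : Vec d) (x : S) : ℝ :=
  Real.exp (inner ℝ (f x) θ) / ∑ y ∈ R, Real.exp (inner ℝ (f y) θ)

/-- The feature of the outcome `x`, centred by its mean under `P_θ`. -/
def centred {S : Type*} {d : ℕ} (R : Finset S) (f : S → Vec d) (θ : Vec d) (x : S) : Vec d :=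
  f x - ∑ y ∈ R, mnlProb R f θ y • f y

open Classical in
/-- The negative log-likelihood of `θ` when the outcome `y` has been observed. -/
def loss {S : Type*} {d : ℕ} (R : Finset S) (f : S → Vec d) (y : S) (θ : Vec d) : ℝ :=
  -∑ x ∈ R, (if y = x then 1 else 0) * Real.log (mnlProb R f θ x)

/-! ### Episodic Markov decision processes -/

/-- An episodic Markov decision process with horizon `H`. The steps of an episode are
`h = 1, …, H`; the kernels `trans h` for other `h` play no role. -/
structure EpisodicMDP (S A : Type*) (H : ℕ) where
  /-- `trans h s a` is the law of the state after step `h`. -/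
  trans : ℕ → S → A → PMF S
  /-- The reward function. -/
  reward : S → A → ℝ
  reward_mem : ∀ s a, reward s a ∈ Set.Icc (0 : ℝ) 1

/-- A deterministic non-stationary policy: `π h s` is the action at step `h` in state `s`. -/
abbrev Policy (S A : Type*) := ℕ → S → A

/-- An episode: the initial state, and the list of the transitions `(s_h, a_h, s_{h+1})`. -/
abbrev Episode (S A : Type*) := S × List (S × A × S)

/-- A history: the list of the past episodes, most recent first. -/
abbrev History (S A : Type*) := List (Episode S A)

namespace EpisodicMDP

variable {S A : Type*} {H : ℕ}

/-- The law of the next `n` transitions when `π` is followed from state `s` at step `h`. -/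
def rollout (M : EpisodicMDP S A H) (π : Policy S A) : ℕ → ℕ → S → PMF (List (S × A × S))
  | 0, _, _ => PMF.pure []
  | n + 1, h, s => (M.trans h s (π h s)).bind fun s' =>
      (M.rollout π n (h + 1) s').map fun τ => (s, π h s, s') :: τ

/-- The value function `V_h^π(s)`: the expected sum of the rewards from step `h` to step `H`
when `π` is followed from state `s` at step `h`. -/
def value (M : EpisodicMDP S A H) (π : Policy S A) (h : ℕ) (s : S) : ℝ :=
  ∑' τ, (M.rollout π (H + 1 - h) h s τ).toReal * (τ.map fun x => M.reward x.1 x.2.1).sum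

/-- The optimal value function `V_h^*(s)`: the highest value over all policies. -/
def optValue (M : EpisodicMDP S A H) (h : ℕ) (s : S) : ℝ :=
  ⨆ π : Policy S A, M.value π h s

/-- The law of the history of the first `k` episodes, when the learner follows in each episode
the policy that `alg` selects on the basis of the past episodes. The initial state of each
episode is drawn from a law that may depend on the past episodes in an arbitrary way. -/
def run (M : EpisodicMDP S A H) (init : History S A → PMF S) (alg : History S A → Policy S A) :
    ℕ → PMF (History S A)
  | 0 => PMF.pure []
  | k + 1 => (M.run init alg k).bind fun past => (init past).bind fun s₁ =>
      (M.rollout (alg past) H 1 s₁).map fun τ => (s₁, τ) :: past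

/-- The cumulative regret `∑_k (V_1^* - V_1^{π^k})(s_1^k)` along a history. -/
def regret (M : EpisodicMDP S A H) (alg : History S A → Policy S A) : History S A → ℝ
  | [] => 0
  | e :: past => M.regret alg past + (M.optValue 1 e.1 - M.value (alg past) 1 e.1)

/-- The set of the states that are reachable from `s` by the action `a`. -/
def reachSet (M : EpisodicMDP S A H) (s : S) (a : A) : Set S :=
  {s' | ∃ h ∈ Finset.Icc 1 H, M.trans h s a s' ≠ 0}

open Classical in
/-- The reachable set as a finset (used only when it is finite). -/
def reach (M : EpisodicMDP S A H) (s : S) (a : A) : Finset S :=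
  if hf : (M.reachSet s a).Finite then hf.toFinset else ∅

/-- The multinomial logistic MDPs with feature map `φ` and transition cores `θs h`: the reachable
sets are finite, do not depend on the step, and on them the transition probabilities are given
by the multinomial logistic model. -/
structure IsMNL {d : ℕ} (M : EpisodicMDP S A H) (φ : S → A → S → Vec d) (θs : ℕ → Vec d) :
    Prop where
  finite : ∀ s a, (M.reachSet s a).Finite
  trans_eq : ∀ h ∈ Finset.Icc 1 H, ∀ s a, ∀ s' ∈ M.reach s a,
    (M.trans h s a s').toReal = mnlProb (M.reach s a) (φ s a) (θs h) s'

end EpisodicMDP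

/-! ### The algorithm -/

/-- The input parameters of the algorithm, together with the radius of the ball of admissible
transition cores. -/
structure Params where
  /-- The regularization parameter `λ`. -/
  reg : ℝ
  /-- The step size `η`. -/
  step : ℝ
  /-- The confidence radii `β_k`. -/
  conf : ℕ → ℝ
  /-- The radius of the ball of parameters over which the estimator is optimized. -/
  radius : ℝ

/-- The online mirror descent update: a minimizer over the ball of radius `L` of
`θ ↦ (2η)⁻¹ ‖θ - θ₀‖²_{B'} + θᵀ g`. -/
def omdStep {d : ℕ} (L η : ℝ) (B' : Matrix (Fin d) (Fin d) ℝ) (θ₀ g : Vec d) : Vec d :=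
  Classical.epsilon fun θ => θ ∈ Metric.closedBall (0 : Vec d) L ∧
    IsMinOn (fun ϑ : Vec d => 1 / (2 * η) * wnorm B' (ϑ - θ₀) ^ 2 + inner ℝ ϑ g)
      (Metric.closedBall (0 : Vec d) L) θ

section Algorithm

variable {S A : Type*} {H d : ℕ}

/-- The estimated transition core and the Gram matrix for step `h` after the given history. -/
def estimate (M : EpisodicMDP S A H) (φ : S → A → S → Vec d) (p : Params) (h : ℕ) :
    History S A → Vec d × Matrix (Fin d) (Fin d) ℝ
  | [] => (0, p.reg • (1 : Matrix (Fin d) (Fin d) ℝ))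
  | e :: past =>
    let θ := (estimate M φ p h past).1
    let B := (estimate M φ p h past).2
    match e.2[h - 1]? with
    | none => (θ, B)
    | some (s, a, s') =>
      let ℓ := loss (M.reach s a) (φ s a) s'
      let θ' := omdStep p.radius p.step (B + p.step • hessian ℓ θ) θ (gradient ℓ θ)
      (θ', B + hessian ℓ θ')

/-- The optimistic bonus of `(s, a)` at step `h` of the episode that follows the given history. -/
def bonus (M : EpisodicMDP S A H) (φ : S → A → S → Vec d) (p : Params) (past : History S A)
    (h : ℕ) (s : S) (a : A) : ℝ :=
  let θ := (estimate M φ p h past).1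
  let B := (estimate M φ p h past).2
  let β := p.conf (past.length + 1)
  (H : ℝ) * β * ∑ s' ∈ M.reach s a, mnlProb (M.reach s a) (φ s a) θ s' *
      wnorm B⁻¹ (centred (M.reach s a) (φ s a) θ s')
    + 3 * (H : ℝ) * β ^ 2 * ⨆ s' : M.reach s a, wnorm B⁻¹ (φ s a s') ^ 2

/-- The optimistic backup of a value function `V` of the next step. -/
def backup (M : EpisodicMDP S A H) (φ : S → A → S → Vec d) (p : Params) (past : History S A)
    (h : ℕ) (V : S → ℝ) (s : S) (a : A) : ℝ :=
  M.reward s a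
    + ∑ s' ∈ M.reach s a,
        mnlProb (M.reach s a) (φ s a) (estimate M φ p h past).1 s' * V s'
    + bonus M φ p past h s a

/-- The optimistic value function when `n` steps remain, i.e. at step `h = H + 1 - n`:
it vanishes for `n = 0`, and otherwise it is `min {max_a Q̂_h(s, a), H}`. -/
def optimisticV (M : EpisodicMDP S A H) (φ : S → A → S → Vec d) (p : Params)
    (past : History S A) : ℕ → S → ℝ
  | 0, _ => 0
  | n + 1, s => min (⨆ a, backup M φ p past (H - n) (optimisticV M φ p past n) s a) H

/-- The optimistic action-value function `Q̂_h(s, a)` for `1 ≤ h ≤ H`. -/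
def optimisticQ (M : EpisodicMDP S A H) (φ : S → A → S → Vec d) (p : Params)
    (past : History S A) (h : ℕ) (s : S) (a : A) : ℝ :=
  backup M φ p past h (optimisticV M φ p past (H - h)) s a

/-- `alg` is a version of UCRL-MNL+ with the parameters `p`: in each episode it plays a greedy
action with respect to the optimistic action-value function, ties being broken arbitrarily. -/
def IsUCRLMNLPlus (M : EpisodicMDP S A H) (φ : S → A → S → Vec d) (p : Params)
    (alg : History S A → Policy S A) : Prop :=
  ∀ past, ∀ h ∈ Finset.Icc 1 H, ∀ s a,
    optimisticQ M φ p past h s a ≤ optimisticQ M φ p past h s (alg past h s)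

end Algorithm

end MNL

end

/-! Optimism reduces the regret to a sum of bonuses, and an elliptical potential argument sums the
bonuses. Put Γ = exp(4 L₀). On the ball of radius Lθ all exponents ⟨φ, θ⟩ lie in [-L₀, L₀], so any
two admissible parameters give probabilities, variances and feature fluctuations that agree up to
the factor Γ (`mnlProb_le_mul`, `cov_self_le_mul`, `fluct_le_mul`). This comparison does most of the
work for which κ might seem necessary.

Confidence. The mirror descent step combines the gradient and the Hessian at the old iterate, which
by Taylor's formula is nearly the gradient at the new one; the error is absorbed by the
regularization. Comparison with the true parameter (`quad_omdStep_le`) shows that its squared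
distance in the Gram norm grows per episode by at most a centred noise, minus a multiple of the
conditional variance of that noise, plus η² times a squared dual norm. After compensation these have
exponential moment at most one at a scale of order 1/η (`mean_exp_stepNoise_le`), so their sum stays
logarithmic; the compensator is a sum of feature fluctuations, of order d log k. Hence the distance
is at most β_k for all k and h at once. Uniformity in k comes from a weighted sum over the prefixes
of the history and one use of Markov's inequality.

Optimism (`abs_mean_sub_mean_le_bonus`). Expand the mean of V under P_θ to second order at the
estimate. The first order term is the covariance of V with ⟨φ, θ* - θ⟩, bounded by the first summand
of the bonus; the remainder is bounded by the second. So the optimistic values dominate the optimal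
ones, and the regret of an episode is at most twice the expected total bonus of the played policy.
Expected bonuses are at most twice the realized ones plus a logarithmic multiple of H²
(`pexp_exp_bonus_le`), so no deviation of order √T is paid.

Summation. The fluctuation E‖φ̄‖² in the inverse Gram matrix is the trace of B⁻¹ times the
covariance matrix added to B, so the growth of log det bounds its sum by d log K
(`histSum_fluctOf_le`). With Cauchy-Schwarz the first summand of the bonus contributes d H² √K = d
H^(3/2) √T up to logarithms, free of κ. For the second summand, an outcome with zero feature lets
the fluctuation dominate κ‖φ‖² (`mul_quad_le_fluct`). Only here does κ enter, and it multiplies a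
term that is logarithmic in T. -/

noncomputable section

namespace MNL

open scoped ENNReal

/-! ### Expectations with respect to probability mass functions -/

section Expectation

variable {α β : Type*}

/-- The expectation of a nonnegative extended real function. -/
def pexp (p : PMF α) (f : α → ℝ≥0∞) : ℝ≥0∞ := ∑' a, p a * f a

theorem pexp_pure (a : α) (f : α → ℝ≥0∞) : pexp (PMF.pure a) f = f a := by
  classical
  unfold pexp
  rw [tsum_eq_single a]
  · simp
  · intro b hb
    simp [PMF.pure_apply, hb]

theorem pexp_bind (p : PMF α) (q : α → PMF β) (f : β → ℝ≥0∞) :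
    pexp (p.bind q) f = pexp p fun a => pexp (q a) f := by
  unfold pexp
  simp only [PMF.bind_apply, ← ENNReal.tsum_mul_right, ← ENNReal.tsum_mul_left]
  rw [ENNReal.tsum_comm]
  simp only [mul_assoc]

theorem pexp_map (p : PMF α) (g : α → β) (f : β → ℝ≥0∞) :
    pexp (p.map g) f = pexp p fun a => f (g a) := by
  rw [← PMF.bind_pure_comp, pexp_bind]
  simp only [Function.comp_apply, pexp_pure]

theorem pexp_mono_support {p : PMF α} {f g : α → ℝ≥0∞} (h : ∀ a ∈ p.support, f a ≤ g a) :
    pexp p f ≤ pexp p g := by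
  refine ENNReal.tsum_le_tsum fun a => ?_
  by_cases ha : p a = 0
  · simp [ha]
  · gcongr
    exact h a ((p.mem_support_iff a).2 ha)

theorem pexp_mono {p : PMF α} {f g : α → ℝ≥0∞} (h : ∀ a, f a ≤ g a) : pexp p f ≤ pexp p g :=
  pexp_mono_support fun a _ => h a

theorem pexp_const (p : PMF α) (c : ℝ≥0∞) : pexp p (fun _ => c) = c := by
  unfold pexp
  rw [ENNReal.tsum_mul_right, p.tsum_coe, one_mul]

theorem pexp_add (p : PMF α) (f g : α → ℝ≥0∞) :
    pexp p (fun a => f a + g a) = pexp p f + pexp p g := by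
  unfold pexp
  simp only [mul_add]
  exact ENNReal.tsum_add

theorem pexp_const_mul (p : PMF α) (c : ℝ≥0∞) (f : α → ℝ≥0∞) :
    pexp p (fun a => c * f a) = c * pexp p f := by
  unfold pexp
  rw [← ENNReal.tsum_mul_left]
  simp only [mul_left_comm]

theorem pexp_finset_sum {ι : Type*} (p : PMF α) (s : Finset ι) (f : ι → α → ℝ≥0∞) :
    pexp p (fun a => ∑ i ∈ s, f i a) = ∑ i ∈ s, pexp p (f i) := by
  classical
  induction s using Finset.induction_on with
  | empty => simpa using pexp_const p 0
  | insert i s hi ih =>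
    simp only [Finset.sum_insert hi]
    rw [pexp_add, ih]

/-- Markov's inequality for events that contain `{F < 1}`. -/
theorem ofReal_one_sub_le_of_pexp_le {p : PMF α} {F : α → ℝ≥0∞} {δ : ℝ} (hδ : 0 ≤ δ)
    (hF : pexp p F ≤ ENNReal.ofReal δ) {s : Set α} (hs : ∀ a ∈ p.support, F a < 1 → a ∈ s) :
    ENNReal.ofReal (1 - δ) ≤ p.toOuterMeasure s := by
  rw [ENNReal.ofReal_sub _ hδ, ENNReal.ofReal_one, tsub_le_iff_right, PMF.toOuterMeasure_apply]
  calc (1 : ℝ≥0∞) = ∑' a, p a := p.tsum_coe.symm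
    _ ≤ ∑' a, (s.indicator p a + p a * F a) := by
        refine ENNReal.tsum_le_tsum fun a => ?_
        by_cases has : a ∈ s
        · simp [has]
        · by_cases ha : p a = 0
          · simp [ha]
          · have h1 : 1 ≤ F a := by
              by_contra hlt
              exact has (hs a ((p.mem_support_iff a).2 ha) (not_le.1 hlt))
            calc p a = p a * 1 := (mul_one _).symm
              _ ≤ p a * F a := by gcongr
              _ ≤ _ := le_add_self
    _ = ∑' a, s.indicator p a + pexp p F := ENNReal.tsum_add
    _ ≤ _ := by gcongr

end Expectation

/-! ### Rollouts and runs -/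

section Rollout

variable {S A : Type*} {H : ℕ}

/-- The sum of a function of the recorded transitions of the past episodes. -/
def histSum (w : History S A → Episode S A → ℝ) : History S A → ℝ
  | [] => 0
  | e :: past => histSum w past + w past e

theorem histSum_mono {w w' : History S A → Episode S A → ℝ} {Q : History S A → Prop}
    (hQ : ∀ e past, Q (e :: past) → Q past)
    (h : ∀ past e, Q (e :: past) → w past e ≤ w' past e) :
    ∀ hist, Q hist → histSum w hist ≤ histSum w' hist
  | [], _ => le_rfl
  | e :: past, hq => add_le_add (histSum_mono hQ h past (hQ e past hq)) (h past e hq)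

theorem histSum_const_mul (c : ℝ) (w : History S A → Episode S A → ℝ) :
    ∀ hist, histSum (fun past e => c * w past e) hist = c * histSum w hist
  | [] => by simp [histSum]
  | e :: past => by
    simp only [histSum, histSum_const_mul c w past, mul_add]

theorem histSum_add (w w' : History S A → Episode S A → ℝ) :
    ∀ hist, histSum (fun past e => w past e + w' past e) hist = histSum w hist + histSum w' hist
  | [] => by simp [histSum]
  | e :: past => by
    simp only [histSum, histSum_add w w' past]
    ring

theorem histSum_finset_sum {ι : Type*} (s : Finset ι) (w : ι → History S A → Episode S A → ℝ) :
    ∀ hist, histSum (fun past e => ∑ i ∈ s, w i past e) hist = ∑ i ∈ s, histSum (w i) hist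
  | [] => by simp [histSum]
  | e :: past => by
    simp only [histSum, histSum_finset_sum s w past, Finset.sum_add_distrib]

/-- The Cauchy-Schwarz inequality for sums over a history. -/
theorem histSum_sq_le (w : History S A → Episode S A → ℝ) :
    ∀ hist, histSum w hist ^ 2 ≤ hist.length * histSum (fun past e => w past e ^ 2) hist
  | [] => by simp [histSum]
  | e :: past => by
    have ih := histSum_sq_le w past
    have h0 : ∀ l : History S A, 0 ≤ histSum (fun past e => w past e ^ 2) l := by
      intro l
      induction l with
      | nil => simp [histSum]
      | cons e l ih => exact add_nonneg ih (sq_nonneg _)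
    simp only [histSum, List.length_cons]
    push_cast
    generalize hn : (past.length : ℝ) = n at *
    have hn0 : 0 ≤ n := by rw [← hn]; positivity
    have hb := h0 past
    generalize histSum (fun past e => w past e ^ 2) past = b at *
    generalize histSum w past = a at *
    generalize w past e = x at *
    -- The cross term comes from a² ≤ n b by completing the square of n x - a, after multiplication
    -- by n; for n = 0 the hypothesis forces a = 0.
    have key : 2 * a * x ≤ n * x ^ 2 + b := by
      rcases hn0.eq_or_lt with rfl | hpos
      · have : a = 0 := by
          have : a ^ 2 ≤ 0 := by simpa using ih
          exact pow_eq_zero_iff (two_ne_zero) |>.1 (le_antisymm this (sq_nonneg a))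
        subst this
        simpa using hb
      · have h1 : n * (2 * a * x) ≤ n * (n * x ^ 2 + b) := by
          nlinarith [sq_nonneg (n * x - a)]
        exact le_of_mul_le_mul_left h1 hpos
    nlinarith

/-- The sum of `b h s a` along a list of transitions starting at step `h`. -/
def trajSum (b : ℕ → S → A → ℝ) : ℕ → List (S × A × S) → ℝ
  | _, [] => 0
  | h, x :: τ => b h x.1 x.2.1 + trajSum b (h + 1) τ

theorem trajSum_nonneg {b : ℕ → S → A → ℝ} (hb : ∀ h s a, 0 ≤ b h s a) :
    ∀ h τ, 0 ≤ trajSum b h τ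
  | _, [] => le_rfl
  | h, _ :: τ => add_nonneg (hb _ _ _) (trajSum_nonneg hb (h + 1) τ)

theorem trajSum_le {b : ℕ → S → A → ℝ} {c : ℝ} (hb : ∀ h s a, b h s a ≤ c) :
    ∀ h τ, trajSum b h τ ≤ τ.length * c
  | _, [] => by simp [trajSum]
  | h, x :: τ => by
    have := trajSum_le hb (h + 1) τ
    have := hb h x.1 x.2.1
    simp only [trajSum, List.length_cons]
    push_cast
    linarith

/-- The value of a function of a recorded transition, and zero if there is none. -/
def optVal (g : S × A × S → ℝ) : Option (S × A × S) → ℝ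
  | none => 0
  | some x => g x

theorem trajSum_eq_sum (b : ℕ → S → A → ℝ) :
    ∀ h τ, trajSum b h τ =
      ∑ i ∈ Finset.range τ.length, optVal (fun x => b (h + i) x.1 x.2.1) τ[i]?
  | _, [] => by simp [trajSum]
  | h, x :: τ => by
    rw [List.length_cons, Finset.sum_range_succ', trajSum, trajSum_eq_sum b (h + 1) τ, add_comm]
    congr 1
    refine Finset.sum_congr rfl fun i _ => ?_
    simp only [List.getElem?_cons_succ]
    rw [show h + 1 + i = h + (i + 1) by ring]

variable (M : EpisodicMDP S A H)

theorem pexp_rollout_succ (π : Policy S A) (n h : ℕ) (s : S) (f : List (S × A × S) → ℝ≥0∞) :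
    pexp (M.rollout π (n + 1) h s) f = pexp (M.trans h s (π h s)) fun s' =>
      pexp (M.rollout π n (h + 1) s') fun τ => f ((s, π h s, s') :: τ) := by
  rw [EpisodicMDP.rollout, pexp_bind]
  simp only [pexp_map]

/-- A bound of the conditional expectation of a function of one transition carries over to the
whole rollout. -/
theorem pexp_rollout_getElem?_le (π : Policy S A) {c : ℝ≥0∞} (g : Option (S × A × S) → ℝ≥0∞) :
    ∀ (i n h : ℕ) (s : S), i < n →
      (∀ s, pexp (M.trans (h + i) s (π (h + i) s))
        (fun s' => g (some (s, π (h + i) s, s'))) ≤ c) →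
      pexp (M.rollout π n h s) (fun τ => g τ[i]?) ≤ c
  | 0, n + 1, h, s, _, hg => by
    rw [pexp_rollout_succ]
    simpa [pexp_const] using hg s
  | i + 1, n + 1, h, s, hi, hg => by
    rw [pexp_rollout_succ]
    refine le_trans (pexp_mono fun s' => ?_) (pexp_const _ c).le
    simp only [List.getElem?_cons_succ]
    refine pexp_rollout_getElem?_le π g i n (h + 1) s' (by omega) ?_
    rw [show h + 1 + i = h + (i + 1) by ring]
    exact hg

theorem rollout_support (π : Policy S A) :
    ∀ (n h : ℕ) (s : S), ∀ τ ∈ (M.rollout π n h s).support,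
      τ.length = n ∧ ∀ i < n, ∃ s a s', τ[i]? = some (s, a, s') ∧ M.trans (h + i) s a s' ≠ 0
  | 0, h, s, τ, hτ => by
    rw [EpisodicMDP.rollout, PMF.mem_support_pure_iff] at hτ
    subst hτ
    simp
  | n + 1, h, s, τ, hτ => by
    rw [EpisodicMDP.rollout, PMF.mem_support_bind_iff] at hτ
    obtain ⟨s', hs', hτ⟩ := hτ
    rw [PMF.mem_support_map_iff] at hτ
    obtain ⟨τ', hτ', rfl⟩ := hτ
    obtain ⟨hlen, hval⟩ := rollout_support π n (h + 1) s' τ' hτ'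
    refine ⟨by simp [hlen], fun i hi => ?_⟩
    rcases i with _ | i
    · exact ⟨s, π h s, s', by simp, by simpa using (PMF.mem_support_iff _ _).1 hs'⟩
    · obtain ⟨t, a, t', h1, h2⟩ := hval i (by omega)
      refine ⟨t, a, t', by simpa using h1, ?_⟩
      rwa [show h + (i + 1) = h + 1 + i by ring]

/-- The episodes that record `H` transitions to reachable states. -/
def ValidEpisode (e : Episode S A) : Prop :=
  e.2.length = H ∧
    ∀ h ∈ Finset.Icc 1 H, ∃ s a s', e.2[h - 1]? = some (s, a, s') ∧ s' ∈ M.reachSet s a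

theorem validEpisode_of_mem_support {π : Policy S A} {s : S} {τ : List (S × A × S)}
    (hτ : τ ∈ (M.rollout π H 1 s).support) : ValidEpisode M (s, τ) := by
  obtain ⟨hlen, hval⟩ := rollout_support M π H 1 s τ hτ
  refine ⟨hlen, fun h hh => ?_⟩
  rw [Finset.mem_Icc] at hh
  obtain ⟨t, a, t', h1, h2⟩ := hval (h - 1) (by omega)
  refine ⟨t, a, t', h1, h, Finset.mem_Icc.2 hh, ?_⟩
  rwa [show 1 + (h - 1) = h by omega] at h2

variable (init : History S A → PMF S) (alg : History S A → Policy S A)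

theorem pexp_run_succ (k : ℕ) (f : History S A → ℝ≥0∞) :
    pexp (M.run init alg (k + 1)) f = pexp (M.run init alg k) fun past =>
      pexp (init past) fun s₁ => pexp (M.rollout (alg past) H 1 s₁) fun τ =>
        f ((s₁, τ) :: past) := by
  rw [EpisodicMDP.run, pexp_bind]
  simp only [pexp_bind, pexp_map]

theorem run_support : ∀ k, ∀ hist ∈ (M.run init alg k).support,
    hist.length = k ∧ ∀ e ∈ hist, ValidEpisode M e
  | 0, hist, hh => by
    rw [EpisodicMDP.run, PMF.mem_support_pure_iff] at hh
    subst hh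
    simp
  | k + 1, hist, hh => by
    rw [EpisodicMDP.run, PMF.mem_support_bind_iff] at hh
    obtain ⟨past, hpast, hh⟩ := hh
    rw [PMF.mem_support_bind_iff] at hh
    obtain ⟨s, -, hh⟩ := hh
    rw [PMF.mem_support_map_iff] at hh
    obtain ⟨τ, hτ, rfl⟩ := hh
    obtain ⟨h1, h2⟩ := run_support k past hpast
    refine ⟨by simp [h1], fun e he => ?_⟩
    rcases List.mem_cons.1 he with rfl | he
    · exact validEpisode_of_mem_support M hτ
    · exact h2 e he

/-- Exponentials of sums over a history whose increments have conditional exponential moments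
at most one. -/
theorem pexp_run_exp_histSum_le (w : History S A → Episode S A → ℝ) (K : ℕ)
    (hw : ∀ past : History S A, past.length < K → ∀ s₁,
      pexp (M.rollout (alg past) H 1 s₁)
        (fun τ => ENNReal.ofReal (Real.exp (w past (s₁, τ)))) ≤ 1) :
    ∀ k ≤ K, pexp (M.run init alg k) (fun hist => ENNReal.ofReal (Real.exp (histSum w hist))) ≤ 1
  | 0, _ => by
    rw [EpisodicMDP.run, pexp_pure]
    simp [histSum]
  | k + 1, hk => by
    rw [pexp_run_succ]
    refine le_trans (pexp_mono_support fun past hpast => ?_)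
      (pexp_run_exp_histSum_le w K hw k (by omega))
    have hlen := (run_support M init alg k past hpast).1
    -- The exponential of the earlier sum is constant given the past, so it factors out and the
    -- conditional bound applies to the new increment: the exponential process is a supermartingale.
    simp only [histSum, Real.exp_add, ENNReal.ofReal_mul (Real.exp_pos _).le, pexp_const_mul]
    calc ENNReal.ofReal (Real.exp (histSum w past)) * pexp (init past) (fun s₁ =>
          pexp (M.rollout (alg past) H 1 s₁)
            fun τ => ENNReal.ofReal (Real.exp (w past (s₁, τ))))
        ≤ ENNReal.ofReal (Real.exp (histSum w past)) * pexp (init past) (fun _ => 1) := by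
          gcongr
          exact pexp_mono fun s₁ => hw past (by omega) s₁
      _ = _ := by rw [pexp_const, mul_one]

/-- A weighted sum of a functional over the nonempty prefixes of a history. -/
def prefixSum (c : ℕ → ℝ≥0∞) (f : History S A → ℝ≥0∞) : History S A → ℝ≥0∞
  | [] => 0
  | e :: past => prefixSum c f past + c past.length * f (e :: past)

/-- This is a substitute for a maximal inequality: once the weighted sum is small, `f` is controlled
at every prefix simultaneously, at the price of the weight `c` of that prefix. -/
theorem pexp_run_prefixSum_le (c : ℕ → ℝ≥0∞) (f : History S A → ℝ≥0∞) (K : ℕ)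
    (hf : ∀ k ≤ K, pexp (M.run init alg k) f ≤ 1) :
    ∀ k ≤ K, pexp (M.run init alg k) (prefixSum c f) ≤ ∑ i ∈ Finset.range k, c i
  | 0, _ => by
    rw [EpisodicMDP.run, pexp_pure]
    simp [prefixSum]
  | k + 1, hk => by
    rw [Finset.sum_range_succ]
    have h1 : pexp (M.run init alg (k + 1)) (prefixSum c f) =
        pexp (M.run init alg k) (prefixSum c f) +
          pexp (M.run init alg k) (fun past => c past.length * pexp (init past) fun s₁ =>
            pexp (M.rollout (alg past) H 1 s₁) fun τ => f ((s₁, τ) :: past)) := by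
      rw [pexp_run_succ]
      simp only [prefixSum, pexp_add, pexp_const, pexp_const_mul]
    rw [h1]
    refine add_le_add (pexp_run_prefixSum_le c f K hf k (by omega)) ?_
    calc _ ≤ pexp (M.run init alg k) (fun past => c k * pexp (init past) fun s₁ =>
            pexp (M.rollout (alg past) H 1 s₁) fun τ => f ((s₁, τ) :: past)) :=
          pexp_mono_support fun past hpast => by
            rw [(run_support M init alg k past hpast).1]
      _ = c k * pexp (M.run init alg (k + 1)) f := by
          rw [pexp_const_mul, pexp_run_succ]
      _ ≤ c k * 1 := by gcongr; exact hf _ hk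
      _ = c k := mul_one _

theorem le_prefixSum_of_suffix (c : ℕ → ℝ≥0∞) (f : History S A → ℝ≥0∞) :
    ∀ (hist : History S A) (e : Episode S A) (past : History S A), (e :: past) <:+ hist →
      c past.length * f (e :: past) ≤ prefixSum c f hist
  | [], e, past, h => by simp at h
  | e' :: hist, e, past, h => by
    rw [List.suffix_cons_iff] at h
    rcases h with h | h
    · rw [List.cons.injEq] at h
      obtain ⟨rfl, rfl⟩ := h
      exact le_add_self
    · exact (le_prefixSum_of_suffix c f hist e past h).trans le_self_add

end Rollout

/-! ### Policy evaluation in multinomial logistic MDPs -/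

section Evaluation

variable {S A : Type*} {H d : ℕ} {M : EpisodicMDP S A H} {φ : S → A → S → Vec d}
  {θs : ℕ → Vec d}

theorem mem_reach (hM : M.IsMNL φ θs) {s : S} {a : A} {s' : S} :
    s' ∈ M.reach s a ↔ s' ∈ M.reachSet s a := by
  rw [EpisodicMDP.reach, dif_pos (hM.finite s a), Set.Finite.mem_toFinset]

theorem mnlProb_nonneg {S : Type*} {d : ℕ} (R : Finset S) (f : S → Vec d) (θ : Vec d) (x : S) :
    0 ≤ mnlProb R f θ x :=
  div_nonneg (Real.exp_pos _).le (Finset.sum_nonneg fun _ _ => (Real.exp_pos _).le)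

/-- The reachable set carries all the mass of the transition law, because a state of positive
probability at a step in `[1, H]` is reachable by definition. -/
theorem pexp_trans (hM : M.IsMNL φ θs) {h : ℕ} (hh : h ∈ Finset.Icc 1 H) (s : S) (a : A)
    (g : S → ℝ≥0∞) : pexp (M.trans h s a) g =
      ∑ s' ∈ M.reach s a, ENNReal.ofReal (mnlProb (M.reach s a) (φ s a) (θs h) s') * g s' := by
  unfold pexp
  rw [tsum_eq_sum (s := M.reach s a)]
  · refine Finset.sum_congr rfl fun s' hs' => ?_
    rw [← hM.trans_eq h hh s a s' hs', ENNReal.ofReal_toReal (PMF.apply_ne_top _ _)]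
  · intro s' hs'
    have : M.trans h s a s' = 0 := by
      by_contra hne
      exact hs' ((mem_reach hM).2 ⟨h, hh, hne⟩)
    rw [this, zero_mul]

/-- The expected sum of `b h s a` over the `n` steps from step `h` on. -/
def evalPolicy (M : EpisodicMDP S A H) (φ : S → A → S → Vec d) (θs : ℕ → Vec d)
    (π : Policy S A) (b : ℕ → S → A → ℝ) : ℕ → ℕ → S → ℝ
  | 0, _, _ => 0
  | n + 1, h, s => b h s (π h s) + ∑ s' ∈ M.reach s (π h s),
      mnlProb (M.reach s (π h s)) (φ s (π h s)) (θs h) s' * evalPolicy M φ θs π b n (h + 1) s'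

theorem evalPolicy_nonneg {π : Policy S A} {b : ℕ → S → A → ℝ} (hb : ∀ h s a, 0 ≤ b h s a) :
    ∀ n h s, 0 ≤ evalPolicy M φ θs π b n h s
  | 0, _, _ => le_rfl
  | n + 1, h, _ => add_nonneg (hb _ _ _) (Finset.sum_nonneg fun s' _ =>
      mul_nonneg (mnlProb_nonneg _ _ _ _) (evalPolicy_nonneg hb n (h + 1) s'))

theorem evalPolicy_add (π : Policy S A) (b b' : ℕ → S → A → ℝ) :
    ∀ n h s, evalPolicy M φ θs π (fun h s a => b h s a + b' h s a) n h s =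
      evalPolicy M φ θs π b n h s + evalPolicy M φ θs π b' n h s
  | 0, _, _ => by simp [evalPolicy]
  | n + 1, h, s => by
    simp only [evalPolicy, evalPolicy_add π b b' n, mul_add, Finset.sum_add_distrib]
    ring

theorem pexp_rollout_trajSum (hM : M.IsMNL φ θs) (π : Policy S A) {b : ℕ → S → A → ℝ}
    (hb : ∀ h s a, 0 ≤ b h s a) : ∀ n h s, 1 ≤ h → h + n ≤ H + 1 →
      pexp (M.rollout π n h s) (fun τ => ENNReal.ofReal (trajSum b h τ)) =
        ENNReal.ofReal (evalPolicy M φ θs π b n h s)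
  | 0, _, _, _, _ => by
    rw [EpisodicMDP.rollout, pexp_pure]
    simp [trajSum, evalPolicy]
  | n + 1, h, s, h1, hn => by
    have hh : h ∈ Finset.Icc 1 H := Finset.mem_Icc.2 ⟨h1, by omega⟩
    rw [pexp_rollout_succ]
    simp only [trajSum, evalPolicy]
    have e1 : ∀ s', pexp (M.rollout π n (h + 1) s')
        (fun τ => ENNReal.ofReal (b h s (π h s) + trajSum b (h + 1) τ)) =
        ENNReal.ofReal (b h s (π h s)) +
          ENNReal.ofReal (evalPolicy M φ θs π b n (h + 1) s') := by
      intro s'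
      simp only [ENNReal.ofReal_add (hb _ _ _) (trajSum_nonneg hb _ _), pexp_add, pexp_const]
      rw [pexp_rollout_trajSum hM π hb n (h + 1) s' (by omega) (by omega)]
    simp only [e1, pexp_add, pexp_const]
    rw [pexp_trans hM hh, ENNReal.ofReal_add (hb _ _ _) (Finset.sum_nonneg fun s' _ =>
      mul_nonneg (mnlProb_nonneg _ _ _ _) (evalPolicy_nonneg hb n (h + 1) s')),
      ENNReal.ofReal_sum_of_nonneg fun s' _ =>
        mul_nonneg (mnlProb_nonneg _ _ _ _) (evalPolicy_nonneg hb n (h + 1) s')]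
    simp only [ENNReal.ofReal_mul (mnlProb_nonneg _ _ _ _)]

theorem sum_reward_eq_trajSum (r : S → A → ℝ) : ∀ h (τ : List (S × A × S)),
    (τ.map fun x => r x.1 x.2.1).sum = trajSum (fun _ => r) h τ
  | _, [] => rfl
  | h, x :: τ => by simp [trajSum, sum_reward_eq_trajSum r (h + 1) τ]

/-- Nonnegativity of the rewards lets the expectation over whole trajectories be computed in `ℝ≥0∞`,
where the Bellman recursion needs no summability argument. -/
theorem value_eq_evalPolicy (hM : M.IsMNL φ θs) (π : Policy S A) {h : ℕ} (h1 : 1 ≤ h)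
    (hh : h ≤ H + 1) (s : S) :
    M.value π h s = evalPolicy M φ θs π (fun _ => M.reward) (H + 1 - h) h s := by
  have hr : ∀ (h : ℕ) s a, 0 ≤ M.reward s a := fun _ s a => (M.reward_mem s a).1
  have key := pexp_rollout_trajSum hM π (b := fun _ => M.reward) hr (H + 1 - h) h s h1 (by omega)
  rw [← ENNReal.toReal_ofReal (evalPolicy_nonneg hr _ _ _), ← key, pexp, ENNReal.tsum_toReal_eq
    fun τ => ENNReal.mul_ne_top (PMF.apply_ne_top _ _) ENNReal.ofReal_ne_top]
  unfold EpisodicMDP.value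
  refine tsum_congr fun τ => ?_
  rw [ENNReal.toReal_mul, ENNReal.toReal_ofReal (trajSum_nonneg hr _ _),
    sum_reward_eq_trajSum M.reward h τ]

end Evaluation

/-! ### The multinomial logistic model -/

section Model

variable {S : Type*} {d : ℕ} {R : Finset S} {f : S → Vec d}

/-- The mean of `W` under `P_θ`. -/
def mean (R : Finset S) (f : S → Vec d) (θ : Vec d) (W : S → ℝ) : ℝ :=
  ∑ x ∈ R, mnlProb R f θ x * W x

/-- The covariance of `V` and `W` under `P_θ`. -/
def cov (R : Finset S) (f : S → Vec d) (θ : Vec d) (V W : S → ℝ) : ℝ :=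
  mean R f θ (fun x => V x * W x) - mean R f θ V * mean R f θ W

/-- The logarithm of the partition function. -/
def logPartition (R : Finset S) (f : S → Vec d) (θ : Vec d) : ℝ :=
  Real.log (∑ y ∈ R, Real.exp (inner ℝ (f y) θ))

/-- The mean feature under `P_θ`. -/
def meanVec (R : Finset S) (f : S → Vec d) (θ : Vec d) : Vec d :=
  ∑ x ∈ R, mnlProb R f θ x • f x

theorem partition_pos (hR : R.Nonempty) (θ : Vec d) :
    0 < ∑ y ∈ R, Real.exp (inner ℝ (f y) θ) :=
  Finset.sum_pos (fun _ _ => Real.exp_pos _) hR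

theorem sum_mnlProb (hR : R.Nonempty) (θ : Vec d) : ∑ x ∈ R, mnlProb R f θ x = 1 := by
  unfold mnlProb
  rw [← Finset.sum_div, div_self (partition_pos hR θ).ne']

theorem mnlProb_eq_exp (hR : R.Nonempty) (θ : Vec d) (x : S) :
    mnlProb R f θ x = Real.exp (inner ℝ (f x) θ - logPartition R f θ) := by
  rw [Real.exp_sub, logPartition, Real.exp_log (partition_pos hR θ), mnlProb]

theorem mean_const (hR : R.Nonempty) (θ : Vec d) (c : ℝ) : mean R f θ (fun _ => c) = c := by
  rw [mean, ← Finset.sum_mul, sum_mnlProb hR, one_mul]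

theorem mean_add (θ : Vec d) (V W : S → ℝ) :
    mean R f θ (fun x => V x + W x) = mean R f θ V + mean R f θ W := by
  simp only [mean, mul_add, Finset.sum_add_distrib]

theorem mean_sub (θ : Vec d) (V W : S → ℝ) :
    mean R f θ (fun x => V x - W x) = mean R f θ V - mean R f θ W := by
  simp only [mean, mul_sub, Finset.sum_sub_distrib]

theorem mean_const_mul (θ : Vec d) (c : ℝ) (W : S → ℝ) :
    mean R f θ (fun x => c * W x) = c * mean R f θ W := by
  rw [mean, mean, Finset.mul_sum]
  exact Finset.sum_congr rfl fun _ _ => mul_left_comm _ _ _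

theorem mean_mono (θ : Vec d) {V W : S → ℝ} (h : ∀ x ∈ R, V x ≤ W x) :
    mean R f θ V ≤ mean R f θ W :=
  Finset.sum_le_sum fun x hx => mul_le_mul_of_nonneg_left (h x hx) (mnlProb_nonneg _ _ _ _)

theorem mean_congr (θ : Vec d) {V W : S → ℝ} (h : ∀ x ∈ R, V x = W x) :
    mean R f θ V = mean R f θ W :=
  Finset.sum_congr rfl fun x hx => by rw [h x hx]

theorem mean_nonneg (θ : Vec d) {V : S → ℝ} (h : ∀ x ∈ R, 0 ≤ V x) : 0 ≤ mean R f θ V :=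
  Finset.sum_nonneg fun x hx => mul_nonneg (mnlProb_nonneg _ _ _ _) (h x hx)

theorem mean_le (hR : R.Nonempty) (θ : Vec d) {V : S → ℝ} {c : ℝ} (h : ∀ x ∈ R, V x ≤ c) :
    mean R f θ V ≤ c :=
  (mean_mono θ h).trans (mean_const hR θ c).le

theorem le_mean (hR : R.Nonempty) (θ : Vec d) {V : S → ℝ} {c : ℝ} (h : ∀ x ∈ R, c ≤ V x) :
    c ≤ mean R f θ V :=
  (mean_const hR θ c).ge.trans (mean_mono θ h)

theorem abs_mean_le (hR : R.Nonempty) (θ : Vec d) {V : S → ℝ} {c : ℝ} (h : ∀ x ∈ R, |V x| ≤ c) :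
    |mean R f θ V| ≤ c :=
  abs_le.2 ⟨le_mean hR θ fun x hx => (abs_le.1 (h x hx)).1,
    mean_le hR θ fun x hx => (abs_le.1 (h x hx)).2⟩

theorem mean_inner (θ u : Vec d) :
    mean R f θ (fun x => inner ℝ (f x) u) = inner ℝ (meanVec R f θ) u := by
  simp only [mean, meanVec, sum_inner, real_inner_smul_left]

theorem inner_centred (θ u : Vec d) (x : S) :
    inner ℝ (centred R f θ x) u = inner ℝ (f x) u - mean R f θ (fun x => inner ℝ (f x) u) := by
  rw [mean_inner, ← inner_sub_left]
  rfl

/-- The second moment about any point dominates the variance. -/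
theorem mean_sub_sq (hR : R.Nonempty) (θ : Vec d) (W : S → ℝ) (c : ℝ) :
    mean R f θ (fun x => (W x - c) ^ 2) = cov R f θ W W + (mean R f θ W - c) ^ 2 := by
  have h : mean R f θ (fun x => (W x - c) ^ 2) =
      mean R f θ (fun x => (W x * W x + (-2 * c) * W x) + c ^ 2) :=
    mean_congr θ fun x _ => by ring
  rw [h, mean_add, mean_add, mean_const hR, mean_const_mul, cov]
  ring

theorem cov_self_nonneg (hR : R.Nonempty) (θ : Vec d) (W : S → ℝ) : 0 ≤ cov R f θ W W := by
  have h := mean_sub_sq hR (f := f) θ W (mean R f θ W)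
  rw [sub_self] at h
  have h2 : 0 ≤ mean R f θ (fun x => (W x - mean R f θ W) ^ 2) :=
    mean_nonneg θ fun x _ => sq_nonneg _
  linarith

theorem cov_self_le_mean_sq (θ : Vec d) (W : S → ℝ) :
    cov R f θ W W ≤ mean R f θ (fun x => W x ^ 2) := by
  have h : mean R f θ (fun x => W x * W x) = mean R f θ (fun x => W x ^ 2) :=
    mean_congr θ fun x _ => (sq _).symm
  rw [cov, h]
  nlinarith [sq_nonneg (mean R f θ W)]

theorem cov_eq_mean_centred (θ : Vec d) (V W : S → ℝ) :
    cov R f θ V W = mean R f θ (fun x => V x * (W x - mean R f θ W)) := by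
  have h : mean R f θ (fun x => V x * (W x - mean R f θ W)) =
      mean R f θ (fun x => V x * W x - mean R f θ W * V x) :=
    mean_congr θ fun x _ => by ring
  rw [h, mean_sub, mean_const_mul, cov, mul_comm (mean R f θ W)]

/-- The difference of the two sides is the variance of `V - W`. -/
theorem cov_add_self_le (hR : R.Nonempty) (θ : Vec d) (V W : S → ℝ) :
    cov R f θ (fun x => V x + W x) (fun x => V x + W x) ≤
      2 * cov R f θ V V + 2 * cov R f θ W W := by
  have h1 := cov_self_nonneg hR (f := f) θ (fun x => V x - W x)
  have e1 : mean R f θ (fun x => (V x + W x) * (V x + W x)) =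
      mean R f θ (fun x => V x * V x) + 2 * mean R f θ (fun x => V x * W x) +
        mean R f θ (fun x => W x * W x) := by
    rw [← mean_const_mul, ← mean_add, ← mean_add]
    exact mean_congr θ fun x _ => by ring
  have e2 : mean R f θ (fun x => (V x - W x) * (V x - W x)) =
      mean R f θ (fun x => V x * V x) - 2 * mean R f θ (fun x => V x * W x) +
        mean R f θ (fun x => W x * W x) := by
    rw [← mean_const_mul, ← mean_sub, ← mean_add]
    exact mean_congr θ fun x _ => by ring
  unfold cov at h1 ⊢
  rw [e2, mean_sub] at h1
  rw [e1, mean_add]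
  nlinarith

/-! #### Comparison of the models with two parameters -/

/-- Numerator and partition function each change by a factor of at most `exp (2 * L)` between the
two parameters. -/
theorem mnlProb_le_mul (hR : R.Nonempty) {a b : Vec d} {L : ℝ}
    (ha : ∀ x ∈ R, |inner ℝ (f x) a| ≤ L) (hb : ∀ x ∈ R, |inner ℝ (f x) b| ≤ L) {x : S}
    (hx : x ∈ R) : mnlProb R f a x ≤ Real.exp (4 * L) * mnlProb R f b x := by
  have hx1 := abs_le.1 (ha x hx)
  have hx2 := abs_le.1 (hb x hx)
  have hZ : ∑ y ∈ R, Real.exp (inner ℝ (f y) b) ≤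
      Real.exp (2 * L) * ∑ y ∈ R, Real.exp (inner ℝ (f y) a) := by
    rw [Finset.mul_sum]
    refine Finset.sum_le_sum fun y hy => ?_
    rw [← Real.exp_add]
    have := abs_le.1 (ha y hy)
    have := abs_le.1 (hb y hy)
    exact Real.exp_le_exp.2 (by linarith)
  have hN : Real.exp (inner ℝ (f x) a) ≤ Real.exp (2 * L) * Real.exp (inner ℝ (f x) b) := by
    rw [← Real.exp_add]
    exact Real.exp_le_exp.2 (by linarith)
  unfold mnlProb
  rw [div_le_iff₀ (partition_pos hR a), mul_assoc, div_mul_eq_mul_div, mul_div_assoc',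
    le_div_iff₀ (partition_pos hR b)]
  calc _ ≤ Real.exp (2 * L) * Real.exp (inner ℝ (f x) b) *
        (Real.exp (2 * L) * ∑ y ∈ R, Real.exp (inner ℝ (f y) a)) :=
        mul_le_mul hN hZ (partition_pos hR b).le (by positivity)
    _ = _ := by
      rw [show (4 : ℝ) * L = 2 * L + 2 * L by ring, Real.exp_add]
      ring

theorem mean_le_mul_mean (hR : R.Nonempty) {a b : Vec d} {L : ℝ}
    (ha : ∀ x ∈ R, |inner ℝ (f x) a| ≤ L) (hb : ∀ x ∈ R, |inner ℝ (f x) b| ≤ L) {W : S → ℝ}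
    (hW : ∀ x ∈ R, 0 ≤ W x) : mean R f a W ≤ Real.exp (4 * L) * mean R f b W := by
  unfold mean
  rw [Finset.mul_sum]
  refine Finset.sum_le_sum fun x hx => ?_
  rw [← mul_assoc]
  exact mul_le_mul_of_nonneg_right (mnlProb_le_mul hR ha hb hx) (hW x hx)

/-- A variance is the least second moment about a point: take the mean under `b` as the common
centre and compare second moments. -/
theorem cov_self_le_mul (hR : R.Nonempty) {a b : Vec d} {L : ℝ}
    (ha : ∀ x ∈ R, |inner ℝ (f x) a| ≤ L) (hb : ∀ x ∈ R, |inner ℝ (f x) b| ≤ L) (W : S → ℝ) :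
    cov R f a W W ≤ Real.exp (4 * L) * cov R f b W W := by
  have h1 := mean_sub_sq hR (f := f) a W (mean R f b W)
  have h2 := mean_sub_sq hR (f := f) b W (mean R f b W)
  have h3 := mean_le_mul_mean hR ha hb (W := fun x => (W x - mean R f b W) ^ 2)
    fun x _ => sq_nonneg _
  rw [sub_self] at h2
  rw [h2] at h3
  have := sq_nonneg (mean R f a W - mean R f b W)
  norm_num at h3
  linarith

/-! #### Derivatives -/

theorem hasFDerivAt_logPartition (hR : R.Nonempty) (θ : Vec d) :
    HasFDerivAt (logPartition R f) (innerSL ℝ (meanVec R f θ)) θ := by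
  have h1 : ∀ y ∈ R, HasFDerivAt (fun θ : Vec d => Real.exp (inner ℝ (f y) θ))
      (Real.exp (inner ℝ (f y) θ) • innerSL ℝ (f y)) θ := fun y _ =>
    ((innerSL ℝ (f y)).hasFDerivAt (x := θ)).exp
  have h2 := (HasFDerivAt.fun_sum h1).log (partition_pos hR θ).ne'
  refine h2.congr_fderiv ?_
  ext v
  simp only [meanVec, mnlProb, _root_.smul_apply, _root_.sum_apply,
    innerSL_apply_apply, sum_inner, real_inner_smul_left, smul_eq_mul, Finset.mul_sum]
  exact Finset.sum_congr rfl fun y _ => by ring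

theorem hasFDerivAt_mnlProb (hR : R.Nonempty) (θ : Vec d) (x : S) :
    HasFDerivAt (fun θ => mnlProb R f θ x) (mnlProb R f θ x • innerSL ℝ (centred R f θ x)) θ := by
  have h1 : (fun θ => mnlProb R f θ x) =
      fun θ => Real.exp (inner ℝ (f x) θ - logPartition R f θ) :=
    funext fun θ => mnlProb_eq_exp hR θ x
  have h2 := (((innerSL ℝ (f x)).hasFDerivAt (x := θ)).sub
    (hasFDerivAt_logPartition (f := f) hR θ)).exp
  rw [h1]
  refine h2.congr_fderiv ?_
  ext v
  simp only [_root_.smul_apply, _root_.sub_apply, innerSL_apply_apply,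
    smul_eq_mul, mnlProb_eq_exp hR, Pi.sub_apply]
  rw [← inner_sub_left]
  rfl

theorem hasDerivAt_mean (hR : R.Nonempty) (θ u : Vec d) (W : S → ℝ) (t : ℝ) :
    HasDerivAt (fun t : ℝ => mean R f (θ + t • u) W)
      (cov R f (θ + t • u) W (fun x => inner ℝ (f x) u)) t := by
  have hl : HasDerivAt (fun t : ℝ => θ + t • u) u t := by
    simpa using ((hasDerivAt_id t).smul_const u).const_add θ
  have h1 : ∀ x ∈ R, HasDerivAt (fun t : ℝ => mnlProb R f (θ + t • u) x * W x)
      (mnlProb R f (θ + t • u) x * inner ℝ (centred R f (θ + t • u) x) u * W x) t := fun x _ =>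
    ((hasFDerivAt_mnlProb hR (θ + t • u) x).comp_hasDerivAt t hl).mul_const (W x)
  refine (HasDerivAt.fun_sum h1).congr_deriv ?_
  rw [cov_eq_mean_centred]
  refine Finset.sum_congr rfl fun x _ => ?_
  rw [inner_centred]
  ring

theorem mean_mul_sub_sq (θ : Vec d) (V z : S → ℝ) (c : ℝ) :
    mean R f θ (fun x => V x * (z x - c) ^ 2) = mean R f θ (fun x => V x * z x * z x) -
      2 * c * mean R f θ (fun x => V x * z x) + c ^ 2 * mean R f θ V := by
  rw [← mean_const_mul, ← mean_const_mul, ← mean_sub, ← mean_add]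
  exact mean_congr θ fun x _ => by ring

/-- The derivative is a mixed third cumulant. Written with a centred square, it is visibly at most
twice sup |V| times the variance of the direction, which is what the Taylor bound uses. -/
theorem hasDerivAt_cov (hR : R.Nonempty) (θ u : Vec d) (V : S → ℝ) (t : ℝ) :
    HasDerivAt (fun t : ℝ => cov R f (θ + t • u) V (fun x => inner ℝ (f x) u))
      (mean R f (θ + t • u) (fun x => V x *
          (inner ℝ (f x) u - mean R f (θ + t • u) (fun x => inner ℝ (f x) u)) ^ 2) -
        mean R f (θ + t • u) V *
          cov R f (θ + t • u) (fun x => inner ℝ (f x) u) (fun x => inner ℝ (f x) u)) t := by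
  have h := (hasDerivAt_mean (f := f) hR θ u (fun x => V x * inner ℝ (f x) u) t).sub
    ((hasDerivAt_mean (f := f) hR θ u V t).mul
      (hasDerivAt_mean (f := f) hR θ u (fun x => inner ℝ (f x) u) t))
  refine h.congr_deriv ?_
  rw [mean_mul_sub_sq]
  simp only [cov]
  ring

/-- The second order Taylor expansion of the mean along a line. -/
theorem abs_mean_sub_sub_cov_le (hR : R.Nonempty) (θ θ' : Vec d) {V : S → ℝ} {m c : ℝ}
    (hm : 0 ≤ m) (hV : ∀ x ∈ R, |V x| ≤ m) (hc : ∀ x ∈ R, inner ℝ (f x) (θ' - θ) ^ 2 ≤ c) :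
    |mean R f θ' V - mean R f θ V - cov R f θ V (fun x => inner ℝ (f x) (θ' - θ))| ≤ m * c := by
  set u := θ' - θ with hu
  set z : S → ℝ := fun x => inner ℝ (f x) u with hz
  set g : ℝ → ℝ := fun t => mean R f (θ + t • u) V
  set g' : ℝ → ℝ := fun t => cov R f (θ + t • u) V z
  set g'' : ℝ → ℝ := fun t => mean R f (θ + t • u) (fun x => V x *
    (z x - mean R f (θ + t • u) z) ^ 2) - mean R f (θ + t • u) V * cov R f (θ + t • u) z z
  have hg : ∀ t, HasDerivAt g (g' t) t := fun t => hasDerivAt_mean hR θ u V t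
  have hg' : ∀ t, HasDerivAt g' (g'' t) t := fun t => hasDerivAt_cov hR θ u V t
  have hbound : ∀ t, |g'' t| ≤ 2 * m * c := by
    intro t
    have hv0 := cov_self_nonneg hR (f := f) (θ + t • u) z
    have hvc : cov R f (θ + t • u) z z ≤ c :=
      (cov_self_le_mean_sq _ _).trans (mean_le hR _ hc)
    have h1 := mean_sub_sq hR (f := f) (θ + t • u) z (mean R f (θ + t • u) z)
    rw [sub_self] at h1
    have h2 : |mean R f (θ + t • u) (fun x => V x * (z x - mean R f (θ + t • u) z) ^ 2)| ≤
        m * cov R f (θ + t • u) z z := by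
      have e : m * cov R f (θ + t • u) z z =
          mean R f (θ + t • u) (fun x => m * (z x - mean R f (θ + t • u) z) ^ 2) := by
        rw [mean_const_mul, h1]
        ring
      rw [e, abs_le, ← neg_one_mul, ← mean_const_mul]
      constructor
      · refine mean_mono _ fun x hx => ?_
        have := (abs_le.1 (hV x hx)).1
        nlinarith [sq_nonneg (z x - mean R f (θ + t • u) z)]
      · refine mean_mono _ fun x hx => ?_
        have := (abs_le.1 (hV x hx)).2
        nlinarith [sq_nonneg (z x - mean R f (θ + t • u) z)]
    have h3 : |mean R f (θ + t • u) V * cov R f (θ + t • u) z z| ≤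
        m * cov R f (θ + t • u) z z := by
      rw [abs_mul, abs_of_nonneg hv0]
      exact mul_le_mul_of_nonneg_right (abs_mean_le hR _ hV) hv0
    calc |g'' t| ≤ _ := abs_sub _ _
      _ ≤ m * cov R f (θ + t • u) z z + m * cov R f (θ + t • u) z z := add_le_add h2 h3
      _ ≤ 2 * m * c := by nlinarith
  have hg'bound : ∀ t, 0 ≤ t → |g' t - g' 0| ≤ 2 * m * c * t := by
    intro t ht
    have := Convex.norm_image_sub_le_of_norm_hasDerivWithin_le (f := g') (f' := g'')
      (s := Set.univ) (C := 2 * m * c) (x := 0) (y := t)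
      (fun x _ => (hg' x).hasDerivWithinAt) (fun x _ => hbound x) convex_univ
      (Set.mem_univ _) (Set.mem_univ _)
    simpa [abs_of_nonneg ht] using this
  -- Subtracting the parabola `m * c * t ^ 2` makes the derivative nonpositive, since `g'` moves by
  -- at most `2 * m * c * t`. The opposite sign gives the lower bound, and both are read off at t =
  -- 1.
  have hup : AntitoneOn (fun t => g t - t * g' 0 - m * c * t ^ 2) (Set.Ici 0) := by
    refine antitoneOn_of_hasDerivWithinAt_nonpos (convex_Ici 0)
      (f' := fun t => g' t - g' 0 - m * c * (2 * t)) ?_ ?_ ?_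
    · exact fun t _ => (((hg t).continuousAt.sub (by fun_prop)).sub
        (by fun_prop)).continuousWithinAt
    · intro t _
      have h1 : HasDerivAt (fun t : ℝ => t * g' 0) (g' 0) t := by
        simpa using (hasDerivAt_id t).mul_const (g' 0)
      have h2 : HasDerivAt (fun t : ℝ => m * c * t ^ 2) (m * c * (2 * t)) t := by
        simpa using (hasDerivAt_pow 2 t).const_mul (m * c)
      exact (((hg t).sub h1).sub h2).hasDerivWithinAt
    · intro t ht
      rw [interior_Ici] at ht
      have := (abs_le.1 (hg'bound t (le_of_lt ht))).2
      linarith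
  have hlow : MonotoneOn (fun t => g t - t * g' 0 + m * c * t ^ 2) (Set.Ici 0) := by
    refine monotoneOn_of_hasDerivWithinAt_nonneg (convex_Ici 0)
      (f' := fun t => g' t - g' 0 + m * c * (2 * t)) ?_ ?_ ?_
    · exact fun t _ => (((hg t).continuousAt.sub (by fun_prop)).add
        (by fun_prop)).continuousWithinAt
    · intro t _
      have h1 : HasDerivAt (fun t : ℝ => t * g' 0) (g' 0) t := by
        simpa using (hasDerivAt_id t).mul_const (g' 0)
      have h2 : HasDerivAt (fun t : ℝ => m * c * t ^ 2) (m * c * (2 * t)) t := by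
        simpa using (hasDerivAt_pow 2 t).const_mul (m * c)
      exact (((hg t).sub h1).add h2).hasDerivWithinAt
    · intro t ht
      rw [interior_Ici] at ht
      have := (abs_le.1 (hg'bound t (le_of_lt ht))).1
      linarith
  have i1 := hup (Set.mem_Ici.2 le_rfl) (Set.mem_Ici.2 zero_le_one) zero_le_one
  have i2 := hlow (Set.mem_Ici.2 le_rfl) (Set.mem_Ici.2 zero_le_one) zero_le_one
  have hθ' : θ + (1 : ℝ) • u = θ' := by rw [hu]; simp
  have hθ : θ + (0 : ℝ) • u = θ := by simp
  have hg1 : g 1 = mean R f θ' V := by simp only [g, hθ']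
  have hg0 : g 0 = mean R f θ V := by simp only [g, hθ]
  have hg'0 : g' 0 = cov R f θ V z := by simp only [g', hθ]
  norm_num at i1 i2
  rw [hg1, hg0, hg'0] at i1 i2
  rw [abs_le]
  constructor <;> linarith

/-- The strong monotonicity of the mean feature. -/
theorem cov_self_le_mean_sub_mean (hR : R.Nonempty) {θ θ' ϑ : Vec d} {L : ℝ}
    (hθ : ∀ x ∈ R, |inner ℝ (f x) θ| ≤ L) (hθ' : ∀ x ∈ R, |inner ℝ (f x) θ'| ≤ L)
    (hϑ : ∀ x ∈ R, |inner ℝ (f x) ϑ| ≤ L) :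
    cov R f ϑ (fun x => inner ℝ (f x) (θ' - θ)) (fun x => inner ℝ (f x) (θ' - θ)) ≤
      Real.exp (4 * L) * (mean R f θ' (fun x => inner ℝ (f x) (θ' - θ)) -
        mean R f θ (fun x => inner ℝ (f x) (θ' - θ))) := by
  set u := θ' - θ with hu
  set z : S → ℝ := fun x => inner ℝ (f x) u with hz
  -- By the mean value theorem the difference of the means is the variance at an intermediate point
  -- of the segment, which is comparable with the variance at `ϑ`.
  obtain ⟨t, ht, htd⟩ := exists_hasDerivAt_eq_slope (fun t : ℝ => mean R f (θ + t • u) z)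
    (fun t => cov R f (θ + t • u) z z) zero_lt_one
    (fun t _ => (hasDerivAt_mean hR θ u z t).continuousAt.continuousWithinAt)
    (fun t _ => hasDerivAt_mean hR θ u z t)
  have h1 : θ + (1 : ℝ) • u = θ' := by rw [hu]; simp
  have h0 : θ + (0 : ℝ) • u = θ := by simp
  rw [h1, h0, sub_zero, div_one] at htd
  rw [← htd]
  refine cov_self_le_mul hR hϑ (fun x hx => ?_) z
  have e : inner ℝ (f x) (θ + t • u) = (1 - t) * inner ℝ (f x) θ + t * inner ℝ (f x) θ' := by
    rw [hu, inner_add_right, real_inner_smul_right, inner_sub_right]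
    ring
  rw [e]
  have a1 := abs_le.1 (hθ x hx)
  have a2 := abs_le.1 (hθ' x hx)
  have t0 := ht.1
  have t1 := ht.2
  rw [abs_le]
  constructor <;> nlinarith

/-! #### The gradient and the Hessian of the loss -/

/-- The loss is linear up to the log-partition function, so its Hessian does not depend on the
observed outcome. -/
theorem loss_eq (hR : R.Nonempty) {y : S} (hy : y ∈ R) :
    loss R f y = fun θ => logPartition R f θ - inner ℝ (f y) θ := by
  classical
  funext θ
  rw [loss, Finset.sum_eq_single y]
  · rw [if_pos rfl, one_mul, mnlProb_eq_exp hR, Real.log_exp]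
    ring
  · intro x _ hx
    rw [if_neg (Ne.symm hx), zero_mul]
  · exact fun h => absurd hy h

theorem loss_eq_zero {y : S} (hy : y ∉ R) : loss R f y = fun _ => 0 := by
  classical
  funext θ
  rw [loss, Finset.sum_eq_zero, neg_zero]
  intro x hx
  rw [if_neg, zero_mul]
  rintro rfl
  exact hy hx

theorem gradient_loss (hR : R.Nonempty) {y : S} (hy : y ∈ R) :
    gradient (loss R f y) = fun θ => meanVec R f θ - f y := by
  funext θ
  rw [loss_eq hR hy]
  refine HasGradientAt.gradient ?_
  rw [hasGradientAt_iff_hasFDerivAt]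
  have := (hasFDerivAt_logPartition hR (f := f) θ).sub ((innerSL ℝ (f y)).hasFDerivAt (x := θ))
  refine this.congr_fderiv ?_
  ext v
  simp

theorem hasFDerivAt_meanVec (hR : R.Nonempty) (θ : Vec d) :
    HasFDerivAt (meanVec R f) (∑ x ∈ R,
      (mnlProb R f θ x • innerSL ℝ (centred R f θ x)).smulRight (f x)) θ :=
  HasFDerivAt.fun_sum fun x _ => (hasFDerivAt_mnlProb hR θ x).smul_const (f x)

theorem sum_mnlProb_smul_centred (hR : R.Nonempty) (θ : Vec d) :
    ∑ x ∈ R, mnlProb R f θ x • centred R f θ x = 0 := by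
  simp only [centred, smul_sub, Finset.sum_sub_distrib]
  rw [← Finset.sum_smul, sum_mnlProb hR, one_smul, sub_self]

theorem hessian_loss (hR : R.Nonempty) {y : S} (hy : y ∈ R) (θ : Vec d) :
    hessian (loss R f y) θ = ∑ x ∈ R, mnlProb R f θ x •
      Matrix.vecMulVec (centred R f θ x).ofLp (centred R f θ x).ofLp := by
  ext i j
  rw [hessian, Matrix.of_apply, gradient_loss hR hy,
    ((hasFDerivAt_meanVec hR θ).sub_const (f y)).fderiv]
  -- Differentiating the mean feature yields the products of `f x` with the centred feature.
  -- Centring the first factor as well changes nothing, because centred features have mean zero.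
  have hz : ∑ x ∈ R, mnlProb R f θ x * (centred R f θ x) j * (meanVec R f θ) i = 0 := by
    have := congrArg (fun v : Vec d => v j) (sum_mnlProb_smul_centred hR (f := f) θ)
    simp only [WithLp.ofLp_sum, Finset.sum_apply, PiLp.smul_apply, smul_eq_mul,
      PiLp.zero_apply] at this
    rw [← Finset.sum_mul, this, zero_mul]
  simp only [_root_.sum_apply, ContinuousLinearMap.smulRight_apply,
    _root_.smul_apply, innerSL_apply_apply, EuclideanSpace.inner_single_right,
    WithLp.ofLp_sum, Finset.sum_apply, PiLp.smul_apply, smul_eq_mul, Matrix.sum_apply,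
    Matrix.smul_apply, Matrix.vecMulVec_apply]
  rw [← sub_eq_zero, ← hz, ← Finset.sum_sub_distrib]
  refine Finset.sum_congr rfl fun x _ => ?_
  have : (centred R f θ x) i = (f x) i - (meanVec R f θ) i := rfl
  rw [this]
  simp
  ring

/-- The algorithm is defined on all histories, including those that record an unreachable outcome;
such an observation leaves the Gram matrix unchanged. -/
theorem hessian_loss_eq_zero {y : S} (hy : y ∉ R) (θ : Vec d) :
    hessian (loss R f y) θ = 0 := by
  have hg : gradient (loss R f y) = fun _ => (0 : Vec d) := by
    funext θ
    rw [loss_eq_zero hy]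
    exact (hasGradientAt_const θ (0 : ℝ)).gradient
  ext i j
  rw [hessian, Matrix.of_apply, hg]
  simp

end Model

/-! ### Quadratic forms -/

section Quadratic

open Matrix

variable {d : ℕ}

/-- The bilinear form `xᵀ M y`. -/
def bil (M : Matrix (Fin d) (Fin d) ℝ) (x y : Vec d) : ℝ := x.ofLp ⬝ᵥ M *ᵥ y.ofLp

/-- The quadratic form `xᵀ M x`. -/
def quad (M : Matrix (Fin d) (Fin d) ℝ) (x : Vec d) : ℝ := bil M x x

variable {M B : Matrix (Fin d) (Fin d) ℝ}

theorem bil_add_left (M : Matrix (Fin d) (Fin d) ℝ) (x y z : Vec d) :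
    bil M (x + y) z = bil M x z + bil M y z := by
  simp [bil, add_dotProduct]

theorem bil_add_right (M : Matrix (Fin d) (Fin d) ℝ) (x y z : Vec d) :
    bil M x (y + z) = bil M x y + bil M x z := by
  simp [bil, mulVec_add, dotProduct_add]

theorem bil_smul_left (M : Matrix (Fin d) (Fin d) ℝ) (c : ℝ) (x y : Vec d) :
    bil M (c • x) y = c * bil M x y := by
  simp [bil, smul_dotProduct]

theorem bil_smul_right (M : Matrix (Fin d) (Fin d) ℝ) (c : ℝ) (x y : Vec d) :
    bil M x (c • y) = c * bil M x y := by
  simp [bil, mulVec_smul, dotProduct_smul]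

theorem bil_add_matrix (M N : Matrix (Fin d) (Fin d) ℝ) (x y : Vec d) :
    bil (M + N) x y = bil M x y + bil N x y := by
  simp [bil, add_mulVec, dotProduct_add]

theorem bil_smul_matrix (c : ℝ) (M : Matrix (Fin d) (Fin d) ℝ) (x y : Vec d) :
    bil (c • M) x y = c * bil M x y := by
  simp [bil, smul_mulVec, dotProduct_smul]

theorem bil_sum_matrix {ι : Type*} (s : Finset ι) (M : ι → Matrix (Fin d) (Fin d) ℝ)
    (x y : Vec d) : bil (∑ i ∈ s, M i) x y = ∑ i ∈ s, bil (M i) x y := by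
  simp [bil, sum_mulVec, dotProduct_sum]

theorem dotProduct_eq_inner (x y : Vec d) : x.ofLp ⬝ᵥ y.ofLp = inner ℝ x y := by
  simp [EuclideanSpace.inner_eq_star_dotProduct, dotProduct_comm]

theorem bil_vecMulVec (c x y : Vec d) :
    bil (vecMulVec c.ofLp c.ofLp) x y = inner ℝ c x * inner ℝ c y := by
  rw [bil, vecMulVec_mulVec, ← dotProduct_eq_inner, ← dotProduct_eq_inner,
    dotProduct_comm c.ofLp x.ofLp]
  simp [dotProduct_smul, mul_comm]

theorem bil_comm (hM : M.IsHermitian) (x y : Vec d) : bil M x y = bil M y x := by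
  have h : Mᵀ = M := by simpa [conjTranspose_eq_transpose_of_trivial] using hM.eq
  rw [bil, bil, dotProduct_mulVec, ← mulVec_transpose, h, dotProduct_comm]

theorem quad_add (hM : M.IsHermitian) (x y : Vec d) :
    quad M (x + y) = quad M x + 2 * bil M x y + quad M y := by
  simp only [quad, bil_add_left, bil_add_right, bil_comm hM y x]
  ring

theorem quad_smul (M : Matrix (Fin d) (Fin d) ℝ) (c : ℝ) (x : Vec d) :
    quad M (c • x) = c ^ 2 * quad M x := by
  simp only [quad, bil_smul_left, bil_smul_right]
  ring

theorem quad_neg (M : Matrix (Fin d) (Fin d) ℝ) (x : Vec d) : quad M (-x) = quad M x := by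
  rw [← neg_one_smul ℝ x, quad_smul]
  norm_num

theorem quad_zero (M : Matrix (Fin d) (Fin d) ℝ) : quad M (0 : Vec d) = 0 := by
  simp [quad, bil]

theorem quad_smul_one (c : ℝ) (x : Vec d) :
    quad (c • (1 : Matrix (Fin d) (Fin d) ℝ)) x = c * ‖x‖ ^ 2 := by
  rw [quad, bil_smul_matrix, bil, one_mulVec, dotProduct_eq_inner, real_inner_self_eq_norm_sq]

theorem quad_nonneg (hM : M.PosSemidef) (x : Vec d) : 0 ≤ quad M x := by
  simpa [quad, bil] using hM.dotProduct_mulVec_nonneg x.ofLp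

theorem wnorm_eq_sqrt_quad (M : Matrix (Fin d) (Fin d) ℝ) (x : Vec d) : wnorm M x = √(quad M x) :=
  rfl

theorem wnorm_nonneg (M : Matrix (Fin d) (Fin d) ℝ) (x : Vec d) : 0 ≤ wnorm M x :=
  Real.sqrt_nonneg _

theorem wnorm_sq (hM : M.PosSemidef) (x : Vec d) : wnorm M x ^ 2 = quad M x :=
  Real.sq_sqrt (quad_nonneg hM x)

theorem mulVec_inv_mulVec (hB : B.PosDef) (x : Fin d → ℝ) : B *ᵥ (B⁻¹ *ᵥ x) = x := by
  rw [mulVec_mulVec, mul_nonsing_inv _ (isUnit_iff_ne_zero.2 hB.det_pos.ne'), one_mulVec]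

theorem bil_inv_left (hB : B.PosDef) (x v : Vec d) :
    bil B (WithLp.toLp 2 (B⁻¹ *ᵥ x.ofLp)) v = inner ℝ x v := by
  rw [bil_comm hB.isHermitian, bil]
  simp only [mulVec_inv_mulVec hB]
  rw [dotProduct_eq_inner, real_inner_comm]

theorem quad_inv_eq (hB : B.PosDef) (x : Vec d) :
    quad B (WithLp.toLp 2 (B⁻¹ *ᵥ x.ofLp)) = quad B⁻¹ x := by
  rw [quad, bil_inv_left hB, ← dotProduct_eq_inner]
  rfl

/-- This expands the nonnegative form of `B` at v - c B⁻¹ x. The free constant `c` distributes the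
weight in Young's inequality. -/
theorem two_mul_inner_le (hB : B.PosDef) (c : ℝ) (x v : Vec d) :
    2 * c * inner ℝ x v ≤ c ^ 2 * quad B⁻¹ x + quad B v := by
  have h := quad_nonneg hB.posSemidef ((-c) • WithLp.toLp 2 (B⁻¹ *ᵥ x.ofLp) + v)
  rw [quad_add hB.isHermitian, quad_smul, quad_inv_eq hB, bil_smul_left, bil_inv_left hB] at h
  linarith

theorem inner_sq_le (hB : B.PosDef) (x v : Vec d) :
    inner ℝ x v ^ 2 ≤ quad B⁻¹ x * quad B v := by
  have h : ∀ c : ℝ, 0 ≤ quad B⁻¹ x * (c * c) + (-2 * inner ℝ x v) * c + quad B v := fun c => by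
    linarith [two_mul_inner_le hB c x v]
  have := discrim_le_zero h
  rw [discrim] at this
  linarith

theorem abs_inner_le (hB : B.PosDef) (x v : Vec d) :
    |inner ℝ x v| ≤ wnorm B⁻¹ x * wnorm B v := by
  rw [wnorm_eq_sqrt_quad, wnorm_eq_sqrt_quad, ← Real.sqrt_mul (quad_nonneg hB.posSemidef.inv x)]
  exact Real.abs_le_sqrt (inner_sq_le hB x v)

/-- With y = B⁻¹ x, the quantity q = xᵀ B⁻¹ x equals both ⟨x, y⟩ and yᵀ B y, so l q² ≤ l ‖x‖² ‖y‖² ≤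
‖x‖² q. -/
theorem quad_inv_le (hB : B.PosDef) {l : ℝ} (hl : 0 < l) (h : ∀ v, l * ‖v‖ ^ 2 ≤ quad B v)
    (x : Vec d) : quad B⁻¹ x ≤ ‖x‖ ^ 2 / l := by
  set y : Vec d := WithLp.toLp 2 (B⁻¹ *ᵥ x.ofLp)
  have h1 : quad B y = quad B⁻¹ x := quad_inv_eq hB x
  have h2 : quad B⁻¹ x = inner ℝ x y := (dotProduct_eq_inner x y)
  have h3 := h y
  have h4 := real_inner_le_norm x y
  rw [h1] at h3
  rw [← h2] at h4
  have h5 := quad_nonneg hB.posSemidef.inv x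
  rw [le_div_iff₀ hl]
  rcases h5.eq_or_lt with h6 | h6
  · rw [← h6, zero_mul]
    positivity
  · refine le_of_mul_le_mul_right ?_ h6
    have h7 : quad B⁻¹ x * quad B⁻¹ x ≤ (‖x‖ * ‖y‖) * (‖x‖ * ‖y‖) :=
      mul_self_le_mul_self h5 h4
    nlinarith [sq_nonneg ‖x‖]

/-! #### Determinants -/

theorem one_add_sum_le_prod {ι : Type*} (s : Finset ι) (a : ι → ℝ) (ha : ∀ i ∈ s, 1 ≤ a i) :
    1 + ∑ i ∈ s, (a i - 1) ≤ ∏ i ∈ s, a i := by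
  classical
  induction s using Finset.induction_on with
  | empty => simp
  | insert i s hi ih =>
    rw [Finset.sum_insert hi, Finset.prod_insert hi]
    have h1 := ih fun j hj => ha j (Finset.mem_insert_of_mem hj)
    have h2 := ha i (Finset.mem_insert_self i s)
    have h3 : 0 ≤ ∑ i ∈ s, (a i - 1) := Finset.sum_nonneg fun j hj =>
      sub_nonneg.2 (ha j (Finset.mem_insert_of_mem hj))
    nlinarith

theorem eigenvalues_eq_quad (hM : M.IsHermitian) (i : Fin d) :
    hM.eigenvalues i = quad M (hM.eigenvectorBasis i) := by
  rw [hM.eigenvalues_eq]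
  simp [quad, bil]

/-- The eigenvalues of `1 + M` are at least one, and a product of such numbers exceeds one plus the
sum of their excesses. -/
theorem one_add_trace_le_det (hM : M.PosSemidef) : 1 + M.trace ≤ (1 + M).det := by
  have hH : (1 + M).IsHermitian := isHermitian_one.add hM.isHermitian
  have h1 : ∀ i, 1 ≤ hH.eigenvalues i := fun i => by
    have h2 := quad_nonneg hM (hH.eigenvectorBasis i)
    have h3 := quad_smul_one 1 (hH.eigenvectorBasis i)
    rw [hH.eigenvectorBasis.norm_eq_one, one_smul] at h3
    rw [eigenvalues_eq_quad, quad, bil_add_matrix]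
    simp only [quad] at h2 h3
    linarith
  have h4 := hH.det_eq_prod_eigenvalues
  have h5 := hH.trace_eq_sum_eigenvalues
  simp only [RCLike.ofReal_real_eq_id, id_eq] at h4 h5
  have h6 := one_add_sum_le_prod Finset.univ hH.eigenvalues fun i _ => h1 i
  rw [h4]
  refine le_trans (le_of_eq ?_) h6
  rw [Finset.sum_sub_distrib, ← h5, trace_add, trace_one]
  simp

-- Conjugation by the inverse square root of `B` reduces to `B = 1`. A covariance matrix has higher
-- rank, so the trace takes the place of the single squared norm of the rank one determinant lemma.
open scoped MatrixOrder in
theorem det_mul_one_add_trace_le (hB : B.PosDef) (hM : M.PosSemidef) :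
    B.det * (1 + (B⁻¹ * M).trace) ≤ (B + M).det := by
  set C := CFC.sqrt B
  have hCC : C * C = B := CFC.sqrt_mul_sqrt_self B (nonneg_iff_posSemidef.2 hB.posSemidef)
  have hC : C.PosSemidef := nonneg_iff_posSemidef.1 (CFC.sqrt_nonneg B)
  have hdet : C.det * C.det = B.det := by rw [← det_mul, hCC]
  have hunit : IsUnit C.det := by
    refine isUnit_iff_ne_zero.2 fun h0 => hB.det_pos.ne' ?_
    rw [← hdet, h0, zero_mul]
  have hinv : C⁻¹ * C⁻¹ = B⁻¹ := by rw [← Matrix.mul_inv_rev, hCC]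
  have hN : (C⁻¹ * M * C⁻¹).PosSemidef := by
    have := hM.mul_mul_conjTranspose_same C⁻¹
    rwa [hC.inv.isHermitian.eq] at this
  have h1 : B + M = C * (1 + C⁻¹ * M * C⁻¹) * C := by
    rw [mul_add, add_mul, mul_one, hCC]
    congr 1
    rw [← mul_assoc, ← mul_assoc, mul_nonsing_inv _ hunit, one_mul, mul_assoc,
      nonsing_inv_mul _ hunit, mul_one]
  have h2 := one_add_trace_le_det hN
  have h3 : (C⁻¹ * M * C⁻¹).trace = (B⁻¹ * M).trace := by
    rw [trace_mul_comm, ← mul_assoc, hinv]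
  rw [h1, det_mul, det_mul, ← h3, mul_right_comm, hdet]
  exact mul_le_mul_of_nonneg_left h2 hB.det_pos.le

theorem det_le_pow (hB : B.PosDef) {c : ℝ} (h : ∀ v, quad B v ≤ c * ‖v‖ ^ 2) :
    B.det ≤ c ^ d := by
  have h4 := hB.isHermitian.det_eq_prod_eigenvalues
  simp only [RCLike.ofReal_real_eq_id, id_eq] at h4
  rw [h4]
  calc ∏ i, hB.isHermitian.eigenvalues i ≤ ∏ _i : Fin d, c := by
        refine Finset.prod_le_prod (fun i _ => (hB.eigenvalues_pos i).le) fun i _ => ?_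
        rw [eigenvalues_eq_quad]
        refine (h _).trans (le_of_eq ?_)
        rw [hB.isHermitian.eigenvectorBasis.norm_eq_one]
        ring
    _ = c ^ d := by simp

end Quadratic

/-! ### Fluctuations of the features in a quadratic form -/

section Fluctuation

open Matrix

variable {S : Type*} {d : ℕ} {R : Finset S} {f : S → Vec d} {M : Matrix (Fin d) (Fin d) ℝ}

/-- The mean of `‖f x - E f‖²_M` under `P_θ`. -/
def fluct (R : Finset S) (f : S → Vec d) (M : Matrix (Fin d) (Fin d) ℝ) (θ : Vec d) : ℝ :=
  mean R f θ fun x => quad M (centred R f θ x)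

theorem fluct_nonneg (hM : M.PosSemidef) (θ : Vec d) : 0 ≤ fluct R f M θ :=
  mean_nonneg θ fun _ _ => quad_nonneg hM _

/-- The covariance matrix of the features under `P_θ`. -/
def covMatrix (R : Finset S) (f : S → Vec d) (θ : Vec d) : Matrix (Fin d) (Fin d) ℝ :=
  ∑ x ∈ R, mnlProb R f θ x • vecMulVec (centred R f θ x).ofLp (centred R f θ x).ofLp

theorem posSemidef_covMatrix (R : Finset S) (f : S → Vec d) (θ : Vec d) :
    (covMatrix R f θ).PosSemidef := by
  refine posSemidef_sum _ fun x _ => PosSemidef.smul ?_ (mnlProb_nonneg _ _ _ _)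
  simpa using posSemidef_vecMulVec_self_star (centred R f θ x).ofLp

/-- This links the bonuses to the potential: the fluctuation is exactly the trace by which the
determinant grows when the covariance matrix is added. -/
theorem trace_mul_covMatrix (M : Matrix (Fin d) (Fin d) ℝ) (θ : Vec d) :
    (M * covMatrix R f θ).trace = fluct R f M θ := by
  rw [covMatrix, Matrix.mul_sum, trace_sum, fluct, mean]
  refine Finset.sum_congr rfl fun x _ => ?_
  rw [Matrix.mul_smul, trace_smul, mul_vecMulVec, trace_vecMulVec, smul_eq_mul, quad, bil,
    dotProduct_comm]

theorem bil_covMatrix (hR : R.Nonempty) (θ u v : Vec d) :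
    bil (covMatrix R f θ) u v =
      cov R f θ (fun x => inner ℝ (f x) u) (fun x => inner ℝ (f x) v) := by
  have h : bil (covMatrix R f θ) u v =
      mean R f θ (fun x => inner ℝ (centred R f θ x) u * inner ℝ (centred R f θ x) v) := by
    rw [covMatrix, bil_sum_matrix, mean]
    refine Finset.sum_congr rfl fun x _ => ?_
    rw [bil_smul_matrix, bil_vecMulVec]
  rw [h]
  simp only [inner_centred]
  rw [cov_eq_mean_centred]
  have h0 : mean R f θ (fun x => mean R f θ (fun x => inner ℝ (f x) u) *
      (inner ℝ (f x) v - mean R f θ (fun x => inner ℝ (f x) v))) = 0 := by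
    rw [mean_const_mul, mean_sub, mean_const hR, sub_self, mul_zero]
  rw [← sub_eq_zero, ← mean_sub, ← neg_eq_zero, ← h0, ← neg_one_mul, ← mean_const_mul]
  exact mean_congr θ fun x _ => by ring

theorem quad_covMatrix_le (hR : R.Nonempty) {L : ℝ} (hL : ∀ x ∈ R, ‖f x‖ ≤ L) (θ v : Vec d) :
    quad (covMatrix R f θ) v ≤ L ^ 2 * ‖v‖ ^ 2 := by
  rw [quad, bil_covMatrix hR]
  refine (cov_self_le_mean_sq _ _).trans (mean_le hR θ fun x hx => ?_)
  rw [← mul_pow, ← sq_abs]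
  exact pow_le_pow_left₀ (abs_nonneg _) ((abs_real_inner_le_norm _ _).trans
    (mul_le_mul_of_nonneg_right (hL x hx) (norm_nonneg _))) 2

theorem mean_quad_sub (hR : R.Nonempty) (hM : M.IsHermitian) (θ c : Vec d) :
    mean R f θ (fun x => quad M (f x - c)) = fluct R f M θ + quad M (meanVec R f θ - c) := by
  have h0 : mean R f θ (fun x => bil M (centred R f θ x) (meanVec R f θ - c)) = 0 := by
    have h1 : mean R f θ (fun x => bil M (centred R f θ x) (meanVec R f θ - c)) =
        bil M (∑ x ∈ R, mnlProb R f θ x • centred R f θ x) (meanVec R f θ - c) := by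
      simp only [mean, bil, WithLp.ofLp_sum, WithLp.ofLp_smul, sum_dotProduct, smul_dotProduct,
        smul_eq_mul]
    rw [h1, sum_mnlProb_smul_centred hR]
    simp [bil]
  have h2 : mean R f θ (fun x => quad M (f x - c)) = mean R f θ (fun x =>
      (quad M (centred R f θ x) + 2 * bil M (centred R f θ x) (meanVec R f θ - c)) +
        quad M (meanVec R f θ - c)) := by
    refine mean_congr θ fun x _ => ?_
    rw [← quad_add hM]
    congr 1
    simp [centred, meanVec]
  rw [h2, mean_add, mean_add, mean_const_mul, h0, mean_const hR, fluct]
  ring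

theorem fluct_le_mean_quad (hR : R.Nonempty) (hM : M.PosSemidef) (θ : Vec d) :
    fluct R f M θ ≤ mean R f θ (fun x => quad M (f x)) := by
  have h := mean_quad_sub hR (f := f) hM.isHermitian θ 0
  simp only [sub_zero] at h
  linarith [quad_nonneg hM (meanVec R f θ)]

/-- As for variances, the mean feature minimizes the second moment in the form of `M`, so both
parameters may be compared about the mean under `b`. -/
theorem fluct_le_mul (hR : R.Nonempty) (hM : M.PosSemidef) {a b : Vec d} {L : ℝ}
    (ha : ∀ x ∈ R, |inner ℝ (f x) a| ≤ L) (hb : ∀ x ∈ R, |inner ℝ (f x) b| ≤ L) :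
    fluct R f M a ≤ Real.exp (4 * L) * fluct R f M b := by
  have h1 := mean_quad_sub hR (f := f) hM.isHermitian a (meanVec R f b)
  have h2 := mean_le_mul_mean hR ha hb (W := fun x => quad M (f x - meanVec R f b))
    fun x _ => quad_nonneg hM _
  have h3 := quad_nonneg hM (meanVec R f a - meanVec R f b)
  calc _ ≤ mean R f a (fun x => quad M (f x - meanVec R f b)) := by linarith
    _ ≤ _ := h2

/-- If one of the outcomes has zero feature, the fluctuation controls the features of all the
outcomes. -/
theorem mul_quad_le_fluct (hR : R.Nonempty) (hM : M.PosSemidef) (θ : Vec d) {x x₀ : S}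
    (hx : x ∈ R) (hx₀ : x₀ ∈ R) (h0 : f x₀ = 0) {κ : ℝ}
    (hκ : x ≠ x₀ → κ ≤ mnlProb R f θ x * mnlProb R f θ x₀) :
    κ * quad M (f x) ≤ fluct R f M θ := by
  classical
  by_cases hne : x = x₀
  · rw [hne, h0, quad_zero, mul_zero]
    exact fluct_nonneg hM θ
  set p := mnlProb R f θ x
  set p₀ := mnlProb R f θ x₀
  set c := centred R f θ x
  set c₀ := centred R f θ x₀
  have hp : 0 ≤ p := mnlProb_nonneg _ _ _ _
  have hp₀ : 0 ≤ p₀ := mnlProb_nonneg _ _ _ _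
  have hsub : ({x, x₀} : Finset S) ⊆ R := by
    intro y hy
    rcases Finset.mem_insert.1 hy with rfl | hy
    · exact hx
    · rwa [Finset.mem_singleton.1 hy]
  have hsum : p + p₀ ≤ 1 := by
    rw [← sum_mnlProb hR (f := f) θ, ← Finset.sum_pair hne]
    exact Finset.sum_le_sum_of_subset_of_nonneg hsub fun _ _ _ => mnlProb_nonneg _ _ _ _
  have hfl : p * quad M c + p₀ * quad M c₀ ≤ fluct R f M θ := by
    rw [fluct, mean,
      ← Finset.sum_pair (f := fun y => mnlProb R f θ y * quad M (centred R f θ y)) hne]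
    exact Finset.sum_le_sum_of_subset_of_nonneg hsub fun _ _ _ =>
      mul_nonneg (mnlProb_nonneg _ _ _ _) (quad_nonneg hM _)
  have hc := quad_nonneg hM c
  have hc₀ := quad_nonneg hM c₀
  -- Since `f x₀ = 0`, the centred feature of `x₀` is minus the mean feature, which cancels in the
  -- difference.
  have hfx : f x = c + (-1 : ℝ) • c₀ := by
    simp [c, c₀, centred, h0]
  have e1 : quad M (f x) = quad M c - 2 * bil M c c₀ + quad M c₀ := by
    rw [hfx, quad_add hM.isHermitian, quad_smul, bil_smul_right]
    ring
  have e2 := quad_nonneg hM (p • c + p₀ • c₀)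
  rw [quad_add hM.isHermitian, quad_smul, quad_smul, bil_smul_left, bil_smul_right] at e2
  have hq := quad_nonneg hM (f x)
  have e3 : (p + p₀) * (p * quad M c + p₀ * quad M c₀) ≤ p * quad M c + p₀ * quad M c₀ :=
    mul_le_of_le_one_left (by positivity) hsum
  -- The second inequality is an identity up to the nonnegative term of `e2`: the two sides differ
  -- by ‖p c + p₀ c₀‖² in the form of `M`.
  calc κ * quad M (f x) ≤ p * p₀ * quad M (f x) := mul_le_mul_of_nonneg_right (hκ hne) hq
    _ ≤ (p + p₀) * (p * quad M c + p₀ * quad M c₀) := by rw [e1]; nlinarith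
    _ ≤ _ := e3.trans hfl

end Fluctuation

/-! ### The online mirror descent step -/

section MirrorDescent

open Matrix

variable {S : Type*} {d : ℕ} {R : Finset S} {f : S → Vec d} {B : Matrix (Fin d) (Fin d) ℝ}

/-- Continuity on the compact ball provides a minimizer, so the choice in the definition is not a
junk value. -/
theorem omdStep_spec {L : ℝ} (hL : 0 ≤ L) (η : ℝ) (B' : Matrix (Fin d) (Fin d) ℝ)
    (θ₀ g : Vec d) : omdStep L η B' θ₀ g ∈ Metric.closedBall (0 : Vec d) L ∧
      IsMinOn (fun ϑ : Vec d => 1 / (2 * η) * wnorm B' (ϑ - θ₀) ^ 2 + inner ℝ ϑ g)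
        (Metric.closedBall (0 : Vec d) L) (omdStep L η B' θ₀ g) := by
  unfold omdStep
  refine Classical.epsilon_spec (p := fun θ => θ ∈ Metric.closedBall (0 : Vec d) L ∧
    IsMinOn (fun ϑ : Vec d => 1 / (2 * η) * wnorm B' (ϑ - θ₀) ^ 2 + inner ℝ ϑ g)
      (Metric.closedBall (0 : Vec d) L) θ) ?_
  have hc : Continuous (fun ϑ : Vec d =>
      1 / (2 * η) * wnorm B' (ϑ - θ₀) ^ 2 + inner ℝ ϑ g) := by
    have h1 : Continuous (fun ϑ : Vec d => (ϑ - θ₀).ofLp) := by fun_prop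
    have h2 : Continuous (fun ϑ : Vec d => wnorm B' (ϑ - θ₀)) :=
      Real.continuous_sqrt.comp (h1.dotProduct (continuous_const.matrix_mulVec h1))
    fun_prop
  obtain ⟨θ, hθ, hmin⟩ := (isCompact_closedBall (0 : Vec d) L).exists_isMinOn
    ⟨0, Metric.mem_closedBall_self hL⟩ hc.continuousOn
  exact ⟨θ, hθ, hmin⟩

theorem norm_omdStep_le {L : ℝ} (hL : 0 ≤ L) (η : ℝ) (B' : Matrix (Fin d) (Fin d) ℝ)
    (θ₀ g : Vec d) : ‖omdStep L η B' θ₀ g‖ ≤ L := by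
  simpa using (omdStep_spec hL η _ θ₀ g).1

/-- The first order optimality condition of the mirror descent step. -/
theorem omdStep_optimality {L η : ℝ} (hη : 0 < η)
    {B' : Matrix (Fin d) (Fin d) ℝ} (hB' : B'.PosSemidef) (θ₀ g : Vec d) {ϑ : Vec d}
    (hϑ : ‖ϑ‖ ≤ L) :
    0 ≤ bil B' (omdStep L η B' θ₀ g - θ₀) (ϑ - omdStep L η B' θ₀ g) +
      η * inner ℝ g (ϑ - omdStep L η B' θ₀ g) := by
  have hL : 0 ≤ L := (norm_nonneg _).trans hϑ
  obtain ⟨hmem, hmin⟩ := omdStep_spec hL η B' θ₀ g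
  set θ := omdStep L η B' θ₀ g
  set a := bil B' (θ - θ₀) (ϑ - θ)
  set b := quad B' (ϑ - θ)
  set c := inner ℝ g (ϑ - θ)
  have hb : 0 ≤ b := quad_nonneg hB' _
  have key : ∀ t : ℝ, 0 < t → t ≤ 1 → 0 ≤ (a + η * c) + t * (b / 2) := by
    intro t ht0 ht1
    have hball : θ + t • (ϑ - θ) ∈ Metric.closedBall (0 : Vec d) L := by
      have := (convex_closedBall (0 : Vec d) L) hmem (by simpa using hϑ : ϑ ∈ _)
        (sub_nonneg.2 ht1) ht0.le (by ring)
      convert this using 1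
      module
    have h := isMinOn_iff.1 hmin _ hball
    simp only [wnorm_sq hB'] at h
    have e1 : θ + t • (ϑ - θ) - θ₀ = (θ - θ₀) + t • (ϑ - θ) := by abel
    rw [e1, quad_add hB'.isHermitian, quad_smul, bil_smul_right, inner_add_left,
      real_inner_smul_left, real_inner_comm g (ϑ - θ)] at h
    have h2 : 0 ≤ 1 / (2 * η) * (2 * (t * a) + t ^ 2 * b) + t * c := by
      linarith
    have h3 : 1 / (2 * η) * (2 * (t * a) + t ^ 2 * b) + t * c =
        (t / η) * ((a + η * c) + t * (b / 2)) := by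
      field_simp
      ring
    rw [h3] at h2
    exact nonneg_of_mul_nonneg_right h2 (div_pos ht0 hη)
  by_contra hneg
  push Not at hneg
  -- This t is small enough that t b / 2 stays below -(a + η c), and it remains positive when `b =
  -- 0`.
  have h1 := key (min 1 (-(a + η * c) / (b + 1)))
    (lt_min one_pos (div_pos (by linarith) (by linarith))) (min_le_left _ _)
  have h2 : min 1 (-(a + η * c) / (b + 1)) * (b / 2) ≤ -(a + η * c) / (b + 1) * (b / 2) :=
    mul_le_mul_of_nonneg_right (min_le_right _ _) (by linarith)
  have h3 : -(a + η * c) / (b + 1) * (b / 2) < -(a + η * c) := by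
    rw [div_mul_eq_mul_div, div_lt_iff₀ (by linarith)]
    nlinarith
  linarith

theorem abs_inner_le_of_norm_le {Lφ Lθ L₀ : ℝ} (hLφ : 0 ≤ Lφ) (h₀ : Lφ * Lθ ≤ L₀)
    (hf : ∀ x ∈ R, ‖f x‖ ≤ Lφ) {θ : Vec d} (hθ : ‖θ‖ ≤ Lθ) :
    ∀ x ∈ R, |inner ℝ (f x) θ| ≤ L₀ := fun x hx =>
  ((abs_real_inner_le_norm _ _).trans (mul_le_mul (hf x hx) hθ (norm_nonneg _) hLφ)).trans h₀

/-- One step of the mirror descent recursion for the distance to the true parameter `θs`. -/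
theorem quad_omdStep_le (hR : R.Nonempty) {Lφ Lθ L₀ η l : ℝ} (hLφ : 0 ≤ Lφ)
    (h₀ : Lφ * Lθ ≤ L₀) (hL₀ : 0 ≤ L₀) (hf : ∀ x ∈ R, ‖f x‖ ≤ Lφ) (hη : Real.exp (4 * L₀) ≤ η)
    (hl : (8 * L₀ + 2) * η * Lφ ^ 2 ≤ l) (hB : B.PosDef) (hBl : ∀ v, l * ‖v‖ ^ 2 ≤ quad B v)
    {θ θs θ' : Vec d} (hθ : ‖θ‖ ≤ Lθ) (hθs : ‖θs‖ ≤ Lθ) (y : S)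
    (hθ' : θ' = omdStep Lθ η (B + η • covMatrix R f θ) θ (meanVec R f θ - f y)) :
    quad (B + covMatrix R f θ') (θs - θ') ≤ quad B (θs - θ) +
      (2 * η * inner ℝ (meanVec R f θs - f y) (θs - θ) -
        η / (2 * Real.exp (4 * L₀)) *
          cov R f θs (fun x => inner ℝ (f x) (θs - θ)) (fun x => inner ℝ (f x) (θs - θ)) +
        2 * η ^ 2 * quad B⁻¹ (meanVec R f θs - f y)) := by
  set Γ := Real.exp (4 * L₀)
  have hΓ1 : 1 ≤ Γ := Real.one_le_exp (by linarith)
  have hη0 : 0 < η := by linarith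
  have hLθ : 0 ≤ Lθ := (norm_nonneg _).trans hθ
  have hnorm' : ‖θ'‖ ≤ Lθ := hθ' ▸ norm_omdStep_le hLθ _ _ _ _
  have hopt := omdStep_optimality hη0 (hB.posSemidef.add
    ((posSemidef_covMatrix R f θ).smul hη0.le)) θ (meanVec R f θ - f y) hθs
  rw [← hθ'] at hopt
  set u := θs - θ' with hu
  set v := θs - θ with hv
  set w := θ' - θ with hw
  have hvuw : v = u + w := by rw [hu, hv, hw]; abel
  rw [bil_add_matrix, bil_smul_matrix, bil_covMatrix hR] at hopt
  set zu : S → ℝ := fun x => inner ℝ (f x) u with hzu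
  set zw : S → ℝ := fun x => inner ℝ (f x) w with hzw
  set zv : S → ℝ := fun x => inner ℝ (f x) v with hzv
  have bθ := abs_inner_le_of_norm_le hLφ h₀ hf hθ
  have bθs := abs_inner_le_of_norm_le hLφ h₀ hf hθs
  have bθ' := abs_inner_le_of_norm_le hLφ h₀ hf hnorm'
  have hzw2 : ∀ x ∈ R, zw x ^ 2 ≤ Lφ ^ 2 * ‖w‖ ^ 2 := fun x hx => by
    rw [← mul_pow, ← sq_abs]
    exact pow_le_pow_left₀ (abs_nonneg _) ((abs_real_inner_le_norm _ _).trans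
      (mul_le_mul_of_nonneg_right (hf x hx) (norm_nonneg _))) 2
  have hzub : ∀ x ∈ R, |zu x| ≤ 2 * L₀ := fun x hx => by
    rw [hzu]
    simp only [hu, inner_sub_right]
    have h1 := abs_le.1 (bθs x hx)
    have h2 := abs_le.1 (bθ' x hx)
    rw [abs_le]
    constructor <;> linarith
  have htaylor := (abs_le.1 (abs_mean_sub_sub_cov_le hR θ θ' (by linarith) hzub hzw2)).1
  have hcomm : cov R f θ zw zu = cov R f θ zu zw := by
    rw [← bil_covMatrix hR, ← bil_covMatrix hR, bil_comm (posSemidef_covMatrix R f θ).isHermitian]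
  rw [hcomm] at hopt
  have hg : inner ℝ (meanVec R f θ - f y) u = mean R f θ zu - zu y := by
    rw [inner_sub_left, ← mean_inner]
  have hε : inner ℝ (meanVec R f θs - f y) u = mean R f θs zu - zu y := by
    rw [inner_sub_left, ← mean_inner]
  have hεuw : inner ℝ (meanVec R f θs - f y) u =
      inner ℝ (meanVec R f θs - f y) v - inner ℝ (meanVec R f θs - f y) w := by
    rw [hvuw, inner_add_right]
    ring
  have hmono := cov_self_le_mean_sub_mean hR (ϑ := θ') bθ' bθs bθ'
  have hmono' := cov_self_le_mean_sub_mean hR (ϑ := θs) bθ' bθs bθs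
  have hqv : quad B v = quad B u + 2 * bil B w u + quad B w := by
    rw [hvuw, quad_add hB.isHermitian, bil_comm hB.isHermitian]
  have hq' : quad (B + covMatrix R f θ') u = quad B u + cov R f θ' zu zu := by
    rw [quad, bil_add_matrix, bil_covMatrix hR]
    rfl
  have hcovv : cov R f θs zv zv ≤ 2 * cov R f θs zu zu + 2 * cov R f θs zw zw := by
    have h := cov_add_self_le hR (f := f) θs zu zw
    have e : (fun x => zu x + zw x) = zv := by
      funext x
      simp only [hzu, hzw, hzv, hvuw, inner_add_right]
    rwa [e] at h
  have hcovw : cov R f θs zw zw ≤ Lφ ^ 2 * ‖w‖ ^ 2 :=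
    (cov_self_le_mean_sq _ _).trans (mean_le hR _ hzw2)
  -- The noise is correlated with the displacement `w`. With c = -2 η, half of the form `B` at `w`
  -- pays for this correlation; the other half pays for the errors in ‖w‖².
  have hnoise := two_mul_inner_le hB (-(2 * η)) (meanVec R f θs - f y) w
  have hBw := hBl w
  have hvar0 := cov_self_nonneg hR (f := f) θs zv
  have hu0 := cov_self_nonneg hR (f := f) θ' zu
  rw [hq']
  set m' := mean R f θ' zu
  set ms := mean R f θs zu
  set mθ := mean R f θ zu
  set n2 := ‖w‖ ^ 2
  have hn2 : 0 ≤ n2 := sq_nonneg _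
  -- Strong monotonicity yields 2 η (ms - m') in total. One half pays for the covariance matrix
  -- newly added to the Gram matrix, which requires η ≥ Γ; the other half, in `d2`, pays for the
  -- negative variance term at `v = u + w`.
  have d1 : cov R f θ' zu zu ≤ η * (ms - m') := by
    have hpos : 0 ≤ ms - m' := by
      by_contra hneg
      push Not at hneg
      have : Γ * (ms - m') < 0 := mul_neg_of_pos_of_neg (by linarith) hneg
      linarith
    exact hmono.trans (mul_le_mul_of_nonneg_right hη hpos)
  have d2 : η / (2 * Γ) * cov R f θs zv zv ≤ η * (ms - m') + η * (Lφ ^ 2 * n2) := by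
    have h1 : cov R f θs zv zv ≤ 2 * Γ * ((ms - m') + Lφ ^ 2 * n2) := by
      have : 0 ≤ Lφ ^ 2 * n2 := by positivity
      nlinarith
    calc η / (2 * Γ) * cov R f θs zv zv ≤ η / (2 * Γ) * (2 * Γ * ((ms - m') + Lφ ^ 2 * n2)) :=
          mul_le_mul_of_nonneg_left h1 (by positivity)
      _ = _ := by
          field_simp
  -- The coefficient collects 4 L₀ from the Taylor error and 1 from replacing `u` by `v`, doubled
  -- because only half of the form `B` at `w` is available.
  have d3 : (8 * L₀ + 2) * η * Lφ ^ 2 * n2 ≤ quad B w :=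
    (mul_le_mul_of_nonneg_right hl hn2).trans hBw
  have d4 : η * (mθ - zu y + cov R f θ zu zw) ≤
      η * (m' - zu y + 2 * L₀ * (Lφ ^ 2 * n2)) :=
    mul_le_mul_of_nonneg_left (by linarith) hη0.le
  rw [hg] at hopt
  rw [hεuw] at hε
  have d5 : η * (ms - zu y) = η * (inner ℝ (meanVec R f θs - f y) v -
      inner ℝ (meanVec R f θs - f y) w) := by rw [hε]
  linarith

end MirrorDescent

/-! ### Exponential moments of the noise -/

section Noise

open Matrix

variable {S : Type*} {d : ℕ} {R : Finset S} {f : S → Vec d} {B : Matrix (Fin d) (Fin d) ℝ}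

theorem norm_meanVec_le (hR : R.Nonempty) {L : ℝ} (hf : ∀ x ∈ R, ‖f x‖ ≤ L) (θ : Vec d) :
    ‖meanVec R f θ‖ ≤ L := by
  refine (norm_sum_le _ _).trans (le_trans (le_of_eq ?_) (mean_le (f := f) hR θ hf))
  refine Finset.sum_congr rfl fun x _ => ?_
  rw [norm_smul, Real.norm_of_nonneg (mnlProb_nonneg _ _ _ _)]

theorem exp_le_one_add_add_sq {x : ℝ} (hx : |x| ≤ 1) : Real.exp x ≤ 1 + x + x ^ 2 := by
  have := (abs_le.1 (Real.abs_exp_sub_one_sub_id_le hx)).2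
  linarith

/-- A Bernstein type bound of the exponential moment of a bounded centred variable. -/
theorem mean_exp_centred_le (hR : R.Nonempty) (θ : Vec d) (W : S → ℝ) {c r : ℝ}
    (hc : ∀ x ∈ R, |c * (mean R f θ W - W x)| ≤ 1) (hr : c ^ 2 ≤ r) :
    mean R f θ (fun x => Real.exp (c * (mean R f θ W - W x) - r * cov R f θ W W)) ≤ 1 := by
  have hv := cov_self_nonneg hR (f := f) θ W
  have h2 : mean R f θ (fun x => (W x - mean R f θ W) ^ 2) = cov R f θ W W := by
    rw [mean_sub_sq hR, sub_self]
    ring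
  have h1 : mean R f θ (fun x => Real.exp (c * (mean R f θ W - W x))) ≤
      1 + c ^ 2 * cov R f θ W W := by
    calc _ ≤ mean R f θ (fun x => (1 + c * (mean R f θ W - W x)) +
            c ^ 2 * (W x - mean R f θ W) ^ 2) :=
          mean_mono θ fun x hx => (exp_le_one_add_add_sq (hc x hx)).trans (le_of_eq (by ring))
      _ = _ := by
          rw [mean_add, mean_add, mean_const_mul, mean_sub, mean_const hR, mean_const hR,
            mean_const_mul, h2]
          ring
  have h3 : mean R f θ (fun x => Real.exp (c * (mean R f θ W - W x) - r * cov R f θ W W)) =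
      Real.exp (-(r * cov R f θ W W)) *
        mean R f θ (fun x => Real.exp (c * (mean R f θ W - W x))) := by
    rw [← mean_const_mul]
    refine mean_congr θ fun x _ => ?_
    rw [← Real.exp_add]
    ring_nf
  rw [h3]
  calc _ ≤ Real.exp (-(r * cov R f θ W W)) * Real.exp (r * cov R f θ W W) := by
        refine mul_le_mul_of_nonneg_left (h1.trans ?_) (Real.exp_pos _).le
        have := Real.add_one_le_exp (r * cov R f θ W W)
        nlinarith
    _ = 1 := by rw [← Real.exp_add]; simp

/-- A bound of the exponential moment of a bounded nonnegative variable. -/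
theorem mean_exp_sub_le (hR : R.Nonempty) (θ : Vec d) (W : S → ℝ) {c : ℝ}
    (h0 : ∀ x ∈ R, 0 ≤ c * W x) (hc : ∀ x ∈ R, c * W x ≤ 1) :
    mean R f θ (fun x => Real.exp (c * (W x - 2 * mean R f θ W))) ≤ 1 := by
  have h1 : mean R f θ (fun x => Real.exp (c * W x)) ≤ 1 + 2 * (c * mean R f θ W) := by
    calc _ ≤ mean R f θ (fun x => 1 + 2 * (c * W x)) := mean_mono θ fun x hx => by
          have h2 := exp_le_one_add_add_sq (abs_le.2 ⟨by linarith [h0 x hx], hc x hx⟩)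
          nlinarith [h0 x hx, hc x hx]
      _ = _ := by rw [mean_add, mean_const hR, mean_const_mul, mean_const_mul]
  have h3 : mean R f θ (fun x => Real.exp (c * (W x - 2 * mean R f θ W))) =
      Real.exp (-(2 * (c * mean R f θ W))) * mean R f θ (fun x => Real.exp (c * W x)) := by
    rw [← mean_const_mul θ (Real.exp _)]
    refine mean_congr θ fun x _ => ?_
    rw [← Real.exp_add]
    ring_nf
  rw [h3]
  calc _ ≤ Real.exp (-(2 * (c * mean R f θ W))) * Real.exp (2 * (c * mean R f θ W)) := by
        refine mul_le_mul_of_nonneg_left (h1.trans ?_) (Real.exp_pos _).le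
        have := Real.add_one_le_exp (2 * (c * mean R f θ W))
        linarith
    _ = 1 := by rw [← Real.exp_add]; simp

/-- The noise of one mirror descent step when the outcome `y` is observed. -/
def stepNoise (R : Finset S) (f : S → Vec d) (B : Matrix (Fin d) (Fin d) ℝ) (L₀ η : ℝ)
    (θ θs : Vec d) (y : S) : ℝ :=
  (2 * η * inner ℝ (meanVec R f θs - f y) (θs - θ) -
    η / (2 * Real.exp (4 * L₀)) *
      cov R f θs (fun x => inner ℝ (f x) (θs - θ)) (fun x => inner ℝ (f x) (θs - θ))) +
    2 * η ^ 2 * (quad B⁻¹ (meanVec R f θs - f y) - 2 * fluct R f B⁻¹ θs)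

/-- The scale at which the noise has bounded exponential moments. -/
def noiseScale (L₀ η : ℝ) : ℝ := 1 / (8 * η * (Real.exp (4 * L₀) + L₀))

theorem mean_exp_stepNoise_le (hR : R.Nonempty) {Lφ Lθ L₀ η l : ℝ} (hLφ : 0 ≤ Lφ)
    (h₀ : Lφ * Lθ ≤ L₀) (hL₀ : 0 ≤ L₀) (hf : ∀ x ∈ R, ‖f x‖ ≤ Lφ) (hη : Real.exp (4 * L₀) ≤ η)
    (hl0 : 0 < l) (hl : (8 * L₀ + 2) * η * Lφ ^ 2 ≤ l) (hB : B.PosDef)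
    (hBl : ∀ v, l * ‖v‖ ^ 2 ≤ quad B v) {θ θs : Vec d} (hθ : ‖θ‖ ≤ Lθ) (hθs : ‖θs‖ ≤ Lθ) :
    mean R f θs (fun y => Real.exp (noiseScale L₀ η / 2 * stepNoise R f B L₀ η θ θs y)) ≤ 1 := by
  set Γ := Real.exp (4 * L₀) with hΓ
  have hΓ1 : 1 ≤ Γ := Real.one_le_exp (by linarith)
  have hη0 : 0 < η := by linarith
  set s := noiseScale L₀ η with hs
  have hs0 : 0 < s := by
    rw [hs, noiseScale]
    positivity
  have hsη : s * (8 * η * (Γ + L₀)) = 1 := by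
    rw [hs, noiseScale]
    exact one_div_mul_cancel (by positivity)
  have hsη0 : 0 < s * η := mul_pos hs0 hη0
  set z : S → ℝ := fun x => inner ℝ (f x) (θs - θ) with hz
  have bθ := abs_inner_le_of_norm_le hLφ h₀ hf hθ
  have bθs := abs_inner_le_of_norm_le hLφ h₀ hf hθs
  have hzb : ∀ x ∈ R, |z x| ≤ 2 * L₀ := fun x hx => by
    simp only [hz, inner_sub_right]
    have h1 := abs_le.1 (bθs x hx)
    have h2 := abs_le.1 (bθ x hx)
    rw [abs_le]
    constructor <;> linarith
  have hmz := abs_le.1 (abs_mean_le (f := f) hR θs hzb)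
  have m1 : mean R f θs (fun x => Real.exp (2 * (s * η) * (mean R f θs z - z x) -
      s * η / (2 * Γ) * cov R f θs z z)) ≤ 1 := by
    -- The two parts of the scale are used here: L₀ bounds the increment by one, and Γ makes the
    -- squared coefficient at most the coefficient of the variance.
    refine mean_exp_centred_le hR θs z (fun x hx => ?_) ?_
    · have h1 := abs_le.1 (hzb x hx)
      rw [abs_mul, abs_of_pos (by positivity : 0 < 2 * (s * η))]
      have h2 : |mean R f θs z - z x| ≤ 4 * L₀ := abs_le.2 ⟨by linarith, by linarith⟩
      calc _ ≤ 2 * (s * η) * (4 * L₀) := mul_le_mul_of_nonneg_left h2 (by positivity)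
        _ ≤ 1 := by nlinarith
    · rw [le_div_iff₀ (by positivity)]
      have : 8 * (s * η) * Γ ≤ 1 := by nlinarith
      nlinarith
  set W : S → ℝ := fun y => quad B⁻¹ (meanVec R f θs - f y) with hW
  have hWm : mean R f θs W = fluct R f B⁻¹ θs := by
    refine mean_congr θs fun x _ => ?_
    rw [hW, ← quad_neg B⁻¹ (centred R f θs x)]
    simp only [centred, neg_sub, meanVec]
  have m2 : mean R f θs (fun x => Real.exp (s * (2 * η ^ 2) * (W x - 2 * mean R f θs W))) ≤ 1 := by
    refine mean_exp_sub_le hR θs W (fun x _ => ?_) (fun x hx => ?_)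
    · exact mul_nonneg (by positivity) (quad_nonneg hB.posSemidef.inv _)
    · have h1 : W x ≤ (2 * Lφ) ^ 2 / l := by
        refine (quad_inv_le hB hl0 hBl _).trans ?_
        refine div_le_div_of_nonneg_right (pow_le_pow_left₀ (norm_nonneg _) ?_ 2) hl0.le
        exact (norm_sub_le _ _).trans (by linarith [norm_meanVec_le hR hf θs, hf x hx])
      have h2 : 2 * η * ((2 * Lφ) ^ 2 / l) ≤ 4 := by
        rw [← mul_div_assoc, div_le_iff₀ hl0]
        have : 0 ≤ L₀ * η * Lφ ^ 2 := by positivity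
        nlinarith
      calc s * (2 * η ^ 2) * W x ≤ s * (2 * η ^ 2) * ((2 * Lφ) ^ 2 / l) :=
            mul_le_mul_of_nonneg_left h1 (by positivity)
        _ = (s * η) * (2 * η * ((2 * Lφ) ^ 2 / l)) := by ring
        _ ≤ (s * η) * 4 := mul_le_mul_of_nonneg_left h2 hsη0.le
        _ ≤ 1 := by nlinarith
  -- The martingale part and the squared norm part depend on the same outcome. Averaging their
  -- exponentials costs the factor 1/2 in the scale.
  have hconv : ∀ a b : ℝ, Real.exp ((a + b) / 2) ≤ (Real.exp a + Real.exp b) / 2 := fun a b => by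
    have e1 : ∀ x : ℝ, Real.exp x = Real.exp (x / 2) ^ 2 := fun x => by
      rw [← Real.exp_nat_mul]
      congr 1
      push_cast
      ring
    rw [e1 a, e1 b, add_div, Real.exp_add]
    nlinarith [sq_nonneg (Real.exp (a / 2) - Real.exp (b / 2))]
  calc _ ≤ mean R f θs (fun x => 1 / 2 * Real.exp (2 * (s * η) * (mean R f θs z - z x) -
          s * η / (2 * Γ) * cov R f θs z z) +
          1 / 2 * Real.exp (s * (2 * η ^ 2) * (W x - 2 * mean R f θs W))) := by
        refine mean_mono θs fun x _ => ?_
        rw [← mul_add, one_div_mul_eq_div]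
        refine le_trans (le_of_eq ?_) (hconv _ _)
        congr 1
        rw [stepNoise, inner_sub_left, ← mean_inner, hWm]
        simp only [hW, hz]
        ring
    _ ≤ 1 := by
        rw [mean_add, mean_const_mul, mean_const_mul]
        linarith

end Noise

/-! ### The estimates along a history -/

section Estimate

open Matrix
open scoped ENNReal

variable {S A : Type*} {H d : ℕ}

/-- The standing assumptions on the decision process, the features and the parameters. -/
structure Regular (M : EpisodicMDP S A H) (φ : S → A → S → Vec d) (θs : ℕ → Vec d)
    (p : Params) (Lφ L₀ : ℝ) : Prop where
  mnl : M.IsMNL φ θs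
  Lφ_pos : 0 < Lφ
  radius_pos : 0 < p.radius
  mul_radius_le : Lφ * p.radius ≤ L₀
  norm_feature_le : ∀ s a, ∀ s' ∈ M.reach s a, ‖φ s a s'‖ ≤ Lφ
  norm_core_le : ∀ h ∈ Finset.Icc 1 H, ‖θs h‖ ≤ p.radius
  exists_feature_eq_zero : ∀ s a, ∃ s' ∈ M.reach s a, φ s a s' = 0
  le_step : Real.exp (4 * L₀) ≤ p.step
  le_reg : (8 * L₀ + 2) * p.step * Lφ ^ 2 ≤ p.reg

namespace Regular

variable {M : EpisodicMDP S A H} {φ : S → A → S → Vec d} {θs : ℕ → Vec d} {p : Params}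
  {Lφ L₀ : ℝ}

theorem L₀_pos (hr : Regular M φ θs p Lφ L₀) : 0 < L₀ :=
  (mul_pos hr.Lφ_pos hr.radius_pos).trans_le hr.mul_radius_le

theorem one_le_step (hr : Regular M φ θs p Lφ L₀) : 1 ≤ p.step :=
  (Real.one_le_exp (by linarith [hr.L₀_pos])).trans hr.le_step

theorem sq_le_reg (hr : Regular M φ θs p Lφ L₀) : 2 * Lφ ^ 2 ≤ p.reg := by
  refine le_trans ?_ hr.le_reg
  have h1 := hr.one_le_step
  have h2 := hr.L₀_pos
  have : 2 * 1 ≤ (8 * L₀ + 2) * p.step := mul_le_mul (by linarith) h1 zero_le_one (by linarith)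
  nlinarith [sq_nonneg Lφ]

theorem reg_pos (hr : Regular M φ θs p Lφ L₀) : 0 < p.reg := by
  have := hr.sq_le_reg
  have := pow_pos hr.Lφ_pos 2
  linarith

theorem reach_nonempty (hr : Regular M φ θs p Lφ L₀) (s : S) (a : A) : (M.reach s a).Nonempty :=
  let ⟨s', hs', _⟩ := hr.exists_feature_eq_zero s a
  ⟨s', hs'⟩

theorem abs_inner_feature_le (hr : Regular M φ θs p Lφ L₀) {θ : Vec d} (hθ : ‖θ‖ ≤ p.radius)
    (s : S) (a : A) :
    ∀ x ∈ M.reach s a, |inner ℝ (φ s a x) θ| ≤ L₀ :=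
  abs_inner_le_of_norm_le hr.Lφ_pos.le hr.mul_radius_le (hr.norm_feature_le s a) hθ

/-- For a reachable outcome the gradient and the Hessian of the loss become a mean feature and a
covariance matrix, the form in which the analysis of one step applies. -/
theorem estimate_cons (hr : Regular M φ θs p Lφ L₀) {h : ℕ} {past : History S A}
    {e : Episode S A} {s : S} {a : A} {s' : S}
    (he : e.2[h - 1]? = some (s, a, s')) (hs' : s' ∈ M.reach s a) :
    ∃ θ', θ' = omdStep p.radius p.step
        ((estimate M φ p h past).2 +
          p.step • covMatrix (M.reach s a) (φ s a) (estimate M φ p h past).1)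
        (estimate M φ p h past).1
        (meanVec (M.reach s a) (φ s a) (estimate M φ p h past).1 - φ s a s') ∧
      estimate M φ p h (e :: past) =
        (θ', (estimate M φ p h past).2 + covMatrix (M.reach s a) (φ s a) θ') := by
  refine ⟨_, rfl, ?_⟩
  have hR := hr.reach_nonempty s a
  rw [estimate, he]
  simp only [hessian_loss hR hs', gradient_loss hR hs']
  rfl

theorem posSemidef_hessian (hr : Regular M φ θs p Lφ L₀) (s : S) (a : A) (s' : S) (θ : Vec d) :
    (hessian (loss (M.reach s a) (φ s a) s') θ).PosSemidef := by
  by_cases hs' : s' ∈ M.reach s a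
  · rw [hessian_loss (hr.reach_nonempty s a) hs']
    exact posSemidef_covMatrix _ _ _
  · rw [hessian_loss_eq_zero hs']
    exact PosSemidef.zero

theorem norm_estimate_le (hr : Regular M φ θs p Lφ L₀) (h : ℕ) :
    ∀ past, ‖(estimate M φ p h past).1‖ ≤ p.radius
  | [] => by simpa [estimate] using hr.radius_pos.le
  | e :: past => by
    rw [estimate]
    rcases e.2[h - 1]? with _ | ⟨s, a, s'⟩
    · exact hr.norm_estimate_le h past
    · exact norm_omdStep_le hr.radius_pos.le _ _ _ _

theorem posDef_gram (hr : Regular M φ θs p Lφ L₀) (h : ℕ) : ∀ past, (estimate M φ p h past).2.PosDef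
  | [] => PosDef.one.smul hr.reg_pos
  | e :: past => by
    rw [estimate]
    rcases e.2[h - 1]? with _ | ⟨s, a, s'⟩
    · exact hr.posDef_gram h past
    · exact (hr.posDef_gram h past).add_posSemidef (hr.posSemidef_hessian s a s' _)

theorem reg_mul_le_quad_gram (hr : Regular M φ θs p Lφ L₀) (h : ℕ) (v : Vec d) :
    ∀ past, p.reg * ‖v‖ ^ 2 ≤ quad (estimate M φ p h past).2 v
  | [] => (quad_smul_one p.reg v).ge
  | e :: past => by
    rw [estimate]
    rcases e.2[h - 1]? with _ | ⟨s, a, s'⟩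
    · exact hr.reg_mul_le_quad_gram h v past
    · refine (hr.reg_mul_le_quad_gram h v past).trans ?_
      simp only [quad, bil_add_matrix]
      exact le_add_of_nonneg_right (quad_nonneg (hr.posSemidef_hessian s a s' _) v)

theorem quad_gram_le (hr : Regular M φ θs p Lφ L₀) (h : ℕ) (v : Vec d) :
    ∀ past, quad (estimate M φ p h past).2 v ≤ (p.reg + past.length * Lφ ^ 2) * ‖v‖ ^ 2
  | [] => by simp [estimate, quad_smul_one]
  | e :: past => by
    have ih := hr.quad_gram_le h v past
    have h0 : 0 ≤ Lφ ^ 2 * ‖v‖ ^ 2 := by positivity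
    rw [estimate]
    simp only [List.length_cons]
    push_cast
    rcases e.2[h - 1]? with _ | ⟨s, a, s'⟩
    · simp only
      nlinarith
    · simp only [quad, bil_add_matrix]
      have h1 : ∀ θ, quad (hessian (loss (M.reach s a) (φ s a) s') θ) v ≤ Lφ ^ 2 * ‖v‖ ^ 2 := by
        intro θ
        by_cases hs' : s' ∈ M.reach s a
        · rw [hessian_loss (hr.reach_nonempty s a) hs']
          exact quad_covMatrix_le (hr.reach_nonempty s a) (hr.norm_feature_le s a) θ v
        · rw [hessian_loss_eq_zero hs']
          simpa [quad, bil] using h0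
      have h2 := h1 (omdStep p.radius p.step ((estimate M φ p h past).2 + p.step •
        hessian (loss (M.reach s a) (φ s a) s') (estimate M φ p h past).1)
        (estimate M φ p h past).1
        (gradient (loss (M.reach s a) (φ s a) s') (estimate M φ p h past).1))
      simp only [quad] at h2 ih
      nlinarith

theorem quad_inv_gram_le (hr : Regular M φ θs p Lφ L₀) (h : ℕ) (past : History S A) (x : Vec d) :
    quad (estimate M φ p h past).2⁻¹ x ≤ ‖x‖ ^ 2 / p.reg :=
  quad_inv_le (hr.posDef_gram h past) hr.reg_pos
    (fun v => hr.reg_mul_le_quad_gram h v past) x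

theorem fluct_gram_le (hr : Regular M φ θs p Lφ L₀) (h : ℕ) (past : History S A) (s : S) (a : A)
    (θ : Vec d) :
    fluct (M.reach s a) (φ s a) (estimate M φ p h past).2⁻¹ θ ≤ Lφ ^ 2 / p.reg := by
  have hR := hr.reach_nonempty s a
  refine (fluct_le_mean_quad hR (hr.posDef_gram h past).posSemidef.inv θ).trans
    (mean_le hR θ fun x hx => (hr.quad_inv_gram_le h past _).trans ?_)
  exact div_le_div_of_nonneg_right
    (pow_le_pow_left₀ (norm_nonneg _) (hr.norm_feature_le s a x hx) 2) hr.reg_pos.le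

end Regular

/-! ### Elliptical potential and error recursion along a history -/

/-- The fluctuation of the features, in the inverse Gram matrix of step `h`, under the parameter
`ϑ past`, at the transition of step `h`. -/
def fluctOf (M : EpisodicMDP S A H) (φ : S → A → S → Vec d) (p : Params) (h : ℕ)
    (ϑ : History S A → Vec d) (past : History S A) (e : Episode S A) : ℝ :=
  optVal (fun x => fluct (M.reach x.1 x.2.1) (φ x.1 x.2.1) (estimate M φ p h past).2⁻¹ (ϑ past))
    e.2[h - 1]?

/-- The noise of the estimator at step `h` in an episode. -/
def noiseOf (M : EpisodicMDP S A H) (φ : S → A → S → Vec d) (θs : ℕ → Vec d) (p : Params)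
    (L₀ : ℝ) (h : ℕ) (past : History S A) (e : Episode S A) : ℝ :=
  optVal (fun x => stepNoise (M.reach x.1 x.2.1) (φ x.1 x.2.1) (estimate M φ p h past).2 L₀
    p.step (estimate M φ p h past).1 (θs h) x.2.2) e.2[h - 1]?

namespace Regular

variable {M : EpisodicMDP S A H} {φ : S → A → S → Vec d} {θs : ℕ → Vec d} {p : Params}
  {Lφ L₀ : ℝ}

theorem exists_transition (hr : Regular M φ θs p Lφ L₀) {h : ℕ} (hh : h ∈ Finset.Icc 1 H)
    {e : Episode S A} (he : ValidEpisode M e) :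
    ∃ s a s', e.2[h - 1]? = some (s, a, s') ∧ s' ∈ M.reach s a := by
  obtain ⟨s, a, s', h1, h2⟩ := he.2 h hh
  exact ⟨s, a, s', h1, (mem_reach hr.mnl).2 h2⟩

theorem fluctOf_nonneg (hr : Regular M φ θs p Lφ L₀) (h : ℕ) (ϑ : History S A → Vec d)
    (past : History S A) (e : Episode S A) : 0 ≤ fluctOf M φ p h ϑ past e := by
  unfold fluctOf
  rcases e.2[h - 1]? with _ | ⟨s, a, s'⟩
  · exact le_rfl
  · exact fluct_nonneg (hr.posDef_gram h past).posSemidef.inv _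

/-- The Gram matrix grows by the covariance matrix at the new iterate, whereas the fluctuation is
taken under `ϑ past`; the comparison of parameters costs Γ. The factor 2 is the price of replacing
log(1 + x) by x / 2 for x ≤ 1, which the regularization ensures. -/
theorem fluctOf_le_log_det (hr : Regular M φ θs p Lφ L₀) {h : ℕ} (hh : h ∈ Finset.Icc 1 H)
    {ϑ : History S A → Vec d} {past : History S A} (hϑ : ‖ϑ past‖ ≤ p.radius) {e : Episode S A}
    (he : ValidEpisode M e) :
    fluctOf M φ p h ϑ past e ≤ 2 * Real.exp (4 * L₀) *
      (Real.log (estimate M φ p h (e :: past)).2.det -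
        Real.log (estimate M φ p h past).2.det) := by
  obtain ⟨s, a, s', h1, hs'⟩ := hr.exists_transition hh he
  obtain ⟨θ', hθ', hest⟩ := hr.estimate_cons (past := past) h1 hs'
  have hR := hr.reach_nonempty s a
  have hB := hr.posDef_gram h past
  have hnorm' : ‖θ'‖ ≤ p.radius := hθ' ▸ norm_omdStep_le hr.radius_pos.le _ _ _ _
  rw [hest]
  set B := (estimate M φ p h past).2
  have hfl : fluctOf M φ p h ϑ past e = fluct (M.reach s a) (φ s a) B⁻¹ (ϑ past) := by
    rw [fluctOf, h1]
    rfl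
  set x := fluct (M.reach s a) (φ s a) B⁻¹ θ' with hx
  have h2 : fluctOf M φ p h ϑ past e ≤ Real.exp (4 * L₀) * x := by
    rw [hfl]
    exact fluct_le_mul hR hB.posSemidef.inv (hr.abs_inner_feature_le hϑ s a)
      (hr.abs_inner_feature_le hnorm' s a)
  have hx0 : 0 ≤ x := fluct_nonneg hB.posSemidef.inv _
  have hx1 : x ≤ 1 := by
    refine (hr.fluct_gram_le h past s a θ').trans ?_
    rw [div_le_one hr.reg_pos]
    have := hr.sq_le_reg
    nlinarith [sq_nonneg Lφ]
  have h3 := det_mul_one_add_trace_le hB (posSemidef_covMatrix (M.reach s a) (φ s a) θ')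
  rw [trace_mul_covMatrix, ← hx] at h3
  have h4 : Real.log B.det + Real.log (1 + x) ≤
      Real.log (B + covMatrix (M.reach s a) (φ s a) θ').det := by
    rw [← Real.log_mul hB.det_pos.ne' (by linarith)]
    exact Real.log_le_log (mul_pos hB.det_pos (by linarith)) h3
  have h5 : x / 2 ≤ Real.log (1 + x) := by
    have := Real.one_sub_inv_le_log_of_pos (by linarith : 0 < 1 + x)
    refine le_trans ?_ this
    rw [inv_eq_one_div, le_sub_iff_add_le, ← le_sub_iff_add_le', div_le_iff₀ (by linarith)]
    nlinarith
  have hΓ := Real.exp_pos (4 * L₀)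
  refine h2.trans ?_
  have : x ≤ 2 * (Real.log (B + covMatrix (M.reach s a) (φ s a) θ').det - Real.log B.det) := by
    linarith
  nlinarith

/-- The elliptical potential bound. -/
theorem histSum_fluctOf_le (hr : Regular M φ θs p Lφ L₀) {h : ℕ} (hh : h ∈ Finset.Icc 1 H)
    {ϑ : History S A → Vec d} (hϑ : ∀ past, ‖ϑ past‖ ≤ p.radius) (hist : History S A)
    (hv : ∀ e ∈ hist, ValidEpisode M e) :
    histSum (fluctOf M φ p h ϑ) hist ≤
      2 * Real.exp (4 * L₀) * (d * Real.log (1 + hist.length)) := by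
  have key : ∀ hist : History S A, (∀ e ∈ hist, ValidEpisode M e) →
      histSum (fluctOf M φ p h ϑ) hist ≤ 2 * Real.exp (4 * L₀) *
        (Real.log (estimate M φ p h hist).2.det - Real.log (estimate M φ p h []).2.det) := by
    intro hist
    induction hist with
    | nil => intro _; simp [histSum]
    | cons e past ih =>
      intro hv
      have h1 := ih fun e' he' => hv e' (List.mem_cons_of_mem _ he')
      have h2 := hr.fluctOf_le_log_det hh (hϑ past) (hv e List.mem_cons_self)
      simp only [histSum]
      linarith
  refine (key hist hv).trans ?_
  refine mul_le_mul_of_nonneg_left ?_ (by positivity)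
  have hreg := hr.reg_pos
  have h1 : (estimate M φ p h ([] : History S A)).2.det = p.reg ^ d := by
    simp [estimate]
  have h2 : (estimate M φ p h hist).2.det ≤ (p.reg * (1 + hist.length)) ^ d := by
    refine det_le_pow (hr.posDef_gram h hist) fun v => (hr.quad_gram_le h v hist).trans ?_
    refine mul_le_mul_of_nonneg_right ?_ (sq_nonneg _)
    have := hr.sq_le_reg
    have h3 : Lφ ^ 2 ≤ p.reg := by nlinarith [sq_nonneg Lφ]
    have : (hist.length : ℝ) * Lφ ^ 2 ≤ hist.length * p.reg :=
      mul_le_mul_of_nonneg_left h3 (Nat.cast_nonneg _)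
    linarith
  have h3 := Real.log_le_log (hr.posDef_gram h hist).det_pos h2
  rw [Real.log_pow, Real.log_mul hreg.ne' (by positivity)] at h3
  rw [h1, Real.log_pow]
  linarith

/-- The distance of the estimate to the true parameter is controlled by the noise. -/
theorem quad_estimate_le (hr : Regular M φ θs p Lφ L₀) {h : ℕ} (hh : h ∈ Finset.Icc 1 H) :
    ∀ hist : History S A,
    (∀ e ∈ hist, ValidEpisode M e) →
    quad (estimate M φ p h hist).2 (θs h - (estimate M φ p h hist).1) ≤
      p.reg * p.radius ^ 2 + histSum (noiseOf M φ θs p L₀ h) hist +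
        4 * p.step ^ 2 * histSum (fluctOf M φ p h fun _ => θs h) hist
  | [], _ => by
    simp only [estimate, histSum, quad_smul_one, sub_zero, add_zero, mul_zero]
    exact mul_le_mul_of_nonneg_left
      (pow_le_pow_left₀ (norm_nonneg _) (hr.norm_core_le h hh) 2) hr.reg_pos.le
  | e :: past, hv => by
    have ih := hr.quad_estimate_le hh past fun e' he' => hv e' (List.mem_cons_of_mem _ he')
    obtain ⟨s, a, s', h1, hs'⟩ := hr.exists_transition hh (hv e List.mem_cons_self)
    obtain ⟨θ', hθ', hest⟩ := hr.estimate_cons (past := past) h1 hs'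
    have hstep := quad_omdStep_le (hr.reach_nonempty s a) hr.Lφ_pos.le hr.mul_radius_le
      hr.L₀_pos.le (hr.norm_feature_le s a) hr.le_step hr.le_reg (hr.posDef_gram h past)
      (fun v => hr.reg_mul_le_quad_gram h v past) (hr.norm_estimate_le h past)
      (hr.norm_core_le h hh) s' hθ'
    rw [hest]
    simp only [histSum]
    have e1 : noiseOf M φ θs p L₀ h past e = stepNoise (M.reach s a) (φ s a)
        (estimate M φ p h past).2 L₀ p.step (estimate M φ p h past).1 (θs h) s' := by
      rw [noiseOf, h1]
      rfl
    have e2 : fluctOf M φ p h (fun _ => θs h) past e =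
        fluct (M.reach s a) (φ s a) (estimate M φ p h past).2⁻¹ (θs h) := by
      rw [fluctOf, h1]
      rfl
    -- The squared norm in the one step bound is split into its deviation from twice its conditional
    -- mean, contained in the noise, and that compensator, which is the 4 η² multiple of the
    -- fluctuation.
    rw [e1, e2, stepNoise]
    linarith

/-- The exponential moments of the noise. -/
theorem pexp_exp_noiseOf_le (hr : Regular M φ θs p Lφ L₀) {h : ℕ} (hh : h ∈ Finset.Icc 1 H)
    (π : Policy S A) (past : History S A) (s₁ : S) :
    pexp (M.rollout π H 1 s₁) (fun τ => ENNReal.ofReal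
      (Real.exp (noiseScale L₀ p.step / 2 * noiseOf M φ θs p L₀ h past (s₁, τ)))) ≤ 1 := by
  have hh' := Finset.mem_Icc.1 hh
  refine pexp_rollout_getElem?_le M π (c := 1) (fun o => ENNReal.ofReal (Real.exp
    (noiseScale L₀ p.step / 2 * optVal (fun x => stepNoise (M.reach x.1 x.2.1) (φ x.1 x.2.1)
      (estimate M φ p h past).2 L₀ p.step (estimate M φ p h past).1 (θs h) x.2.2) o)))
    (h - 1) H 1 s₁ (by omega) fun s => ?_
  rw [show 1 + (h - 1) = h by omega, pexp_trans hr.mnl hh]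
  have key := mean_exp_stepNoise_le (hr.reach_nonempty s (π h s)) hr.Lφ_pos.le hr.mul_radius_le
    hr.L₀_pos.le (hr.norm_feature_le s (π h s)) hr.le_step hr.reg_pos hr.le_reg
    (hr.posDef_gram h past) (fun v => hr.reg_mul_le_quad_gram h v past)
    (hr.norm_estimate_le h past) (hr.norm_core_le h hh)
  rw [← ENNReal.ofReal_one]
  refine le_trans (le_of_eq ?_) (ENNReal.ofReal_le_ofReal key)
  rw [mean, ENNReal.ofReal_sum_of_nonneg fun x _ =>
    mul_nonneg (mnlProb_nonneg _ _ _ _) (Real.exp_pos _).le]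
  refine Finset.sum_congr rfl fun x _ => ?_
  rw [ENNReal.ofReal_mul (mnlProb_nonneg _ _ _ _)]
  rfl

end Regular

end Estimate

/-! ### Optimism -/

section Optimism

open Matrix
open scoped ENNReal

variable {S A : Type*} {H d : ℕ} {M : EpisodicMDP S A H} {φ : S → A → S → Vec d}
  {θs : ℕ → Vec d} {p : Params} {Lφ L₀ : ℝ}

/-- The confidence event: all the estimates are within the confidence radius. -/
def Confident (M : EpisodicMDP S A H) (φ : S → A → S → Vec d) (θs : ℕ → Vec d) (p : Params)
    (past : History S A) : Prop :=
  ∀ h ∈ Finset.Icc 1 H, quad (estimate M φ p h past).2 (θs h - (estimate M φ p h past).1) ≤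
    p.conf (past.length + 1) ^ 2

/-- The maximum of `‖φ(s, a, s')‖²` in the inverse Gram matrix. -/
def maxSq (M : EpisodicMDP S A H) (φ : S → A → S → Vec d) (p : Params) (past : History S A)
    (h : ℕ) (s : S) (a : A) : ℝ :=
  ⨆ s' : M.reach s a, wnorm (estimate M φ p h past).2⁻¹ (φ s a s') ^ 2

theorem maxSq_nonneg (past : History S A) (h : ℕ) (s : S) (a : A) :
    0 ≤ maxSq M φ p past h s a :=
  Real.iSup_nonneg fun _ => sq_nonneg _

/-- The mean norm of the centred features in the inverse Gram matrix. -/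
def meanNorm (M : EpisodicMDP S A H) (φ : S → A → S → Vec d) (p : Params) (past : History S A)
    (h : ℕ) (s : S) (a : A) : ℝ :=
  mean (M.reach s a) (φ s a) (estimate M φ p h past).1 fun s' =>
    wnorm (estimate M φ p h past).2⁻¹ (centred (M.reach s a) (φ s a) (estimate M φ p h past).1 s')

theorem meanNorm_nonneg (past : History S A) (h : ℕ) (s : S) (a : A) :
    0 ≤ meanNorm M φ p past h s a :=
  mean_nonneg _ fun _ _ => wnorm_nonneg _ _

theorem bonus_eq (past : History S A) (h : ℕ) (s : S) (a : A) : bonus M φ p past h s a =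
    H * p.conf (past.length + 1) * meanNorm M φ p past h s a +
      3 * H * p.conf (past.length + 1) ^ 2 * maxSq M φ p past h s a :=
  rfl

theorem bonus_nonneg (hp : ∀ k, 0 ≤ p.conf k) (past : History S A) (h : ℕ) (s : S) (a : A) :
    0 ≤ bonus M φ p past h s a := by
  rw [bonus_eq]
  have h1 := hp (past.length + 1)
  have h2 := meanNorm_nonneg (M := M) (φ := φ) (p := p) past h s a
  have h3 := maxSq_nonneg (M := M) (φ := φ) (p := p) past h s a
  positivity

theorem backup_eq (past : History S A) (h : ℕ) (V : S → ℝ) (s : S) (a : A) :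
    backup M φ p past h V s a = M.reward s a +
      mean (M.reach s a) (φ s a) (estimate M φ p h past).1 V + bonus M φ p past h s a :=
  rfl

namespace Regular

theorem quad_feature_le_maxSq (hr : Regular M φ θs p Lφ L₀) (past : History S A) (h : ℕ) (s : S)
    (a : A) {s' : S} (hs' : s' ∈ M.reach s a) :
    quad (estimate M φ p h past).2⁻¹ (φ s a s') ≤ maxSq M φ p past h s a := by
  rw [← wnorm_sq (hr.posDef_gram h past).posSemidef.inv]
  exact le_ciSup (f := fun s' : M.reach s a =>
    wnorm (estimate M φ p h past).2⁻¹ (φ s a s') ^ 2) (Set.finite_range _).bddAbove ⟨s', hs'⟩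

theorem maxSq_le (hr : Regular M φ θs p Lφ L₀) (past : History S A) (h : ℕ) (s : S) (a : A)
    {c : ℝ} (hc : ∀ s' ∈ M.reach s a, quad (estimate M φ p h past).2⁻¹ (φ s a s') ≤ c) :
    maxSq M φ p past h s a ≤ c := by
  have : Nonempty (M.reach s a) := (hr.reach_nonempty s a).to_subtype
  refine ciSup_le fun s' => ?_
  rw [wnorm_sq (hr.posDef_gram h past).posSemidef.inv]
  exact hc s' s'.2

theorem meanNorm_sq_le (hr : Regular M φ θs p Lφ L₀) (past : History S A) (h : ℕ) (s : S)
    (a : A) : meanNorm M φ p past h s a ^ 2 ≤ fluct (M.reach s a) (φ s a)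
      (estimate M φ p h past).2⁻¹ (estimate M φ p h past).1 := by
  have h1 := cov_self_nonneg (hr.reach_nonempty s a) (f := φ s a) (estimate M φ p h past).1
    fun s' => wnorm (estimate M φ p h past).2⁻¹
      (centred (M.reach s a) (φ s a) (estimate M φ p h past).1 s')
  have h2 : fluct (M.reach s a) (φ s a) (estimate M φ p h past).2⁻¹ (estimate M φ p h past).1 =
      mean (M.reach s a) (φ s a) (estimate M φ p h past).1 fun s' =>
        wnorm (estimate M φ p h past).2⁻¹
          (centred (M.reach s a) (φ s a) (estimate M φ p h past).1 s') *
        wnorm (estimate M φ p h past).2⁻¹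
          (centred (M.reach s a) (φ s a) (estimate M φ p h past).1 s') :=
    mean_congr _ fun s' _ => by rw [← sq, wnorm_sq (hr.posDef_gram h past).posSemidef.inv]
  rw [h2, meanNorm]
  rw [cov] at h1
  linarith

/-- The bonus dominates the error of the estimated transition probabilities. -/
theorem abs_mean_sub_mean_le_bonus (hr : Regular M φ θs p Lφ L₀) (hp : ∀ k, 0 ≤ p.conf k)
    {past : History S A} (hc : Confident M φ θs p past) {h : ℕ} (hh : h ∈ Finset.Icc 1 H)
    (s : S) (a : A) {V : S → ℝ} (hV : ∀ x, 0 ≤ V x ∧ V x ≤ H) :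
    |mean (M.reach s a) (φ s a) (θs h) V -
      mean (M.reach s a) (φ s a) (estimate M φ p h past).1 V| ≤ bonus M φ p past h s a := by
  have hR := hr.reach_nonempty s a
  have hB := hr.posDef_gram h past
  have hquad := hc h hh
  rw [bonus_eq]
  have hβ := hp (past.length + 1)
  have hX := maxSq_nonneg (M := M) (φ := φ) (p := p) past h s a
  have hfeat := fun s' hs' => hr.quad_feature_le_maxSq past h s a (s' := s') hs'
  have hmean : meanNorm M φ p past h s a = mean (M.reach s a) (φ s a) (estimate M φ p h past).1
    fun s' => wnorm (estimate M φ p h past).2⁻¹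
      (centred (M.reach s a) (φ s a) (estimate M φ p h past).1 s') := rfl
  generalize maxSq M φ p past h s a = X at *
  generalize meanNorm M φ p past h s a = m at *
  generalize p.conf (past.length + 1) = β at *
  generalize (estimate M φ p h past).2 = B at *
  generalize (estimate M φ p h past).1 = θ at *
  generalize M.reach s a = R at *
  generalize φ s a = f at *
  have hVabs : ∀ x ∈ R, |V x| ≤ H := fun x _ => by
    rw [abs_of_nonneg (hV x).1]
    exact (hV x).2
  have h1 := abs_mean_sub_sub_cov_le hR θ (θs h) (V := V) (m := H) (c := β ^ 2 * X)
    (Nat.cast_nonneg H) hVabs fun x hx => by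
      refine (inner_sq_le hB _ _).trans ?_
      rw [mul_comm (β ^ 2)]
      exact mul_le_mul (hfeat x hx) hquad (quad_nonneg hB.posSemidef _) hX
  -- Centring moves to the direction factor, so each outcome contributes at most H times the dual
  -- norm of its centred feature times the confidence radius.
  have h2 : |cov R f θ V (fun x => inner ℝ (f x) (θs h - θ))| ≤ H * β * m := by
    rw [cov_eq_mean_centred]
    have hb : ∀ x ∈ R, |V x * (inner ℝ (f x) (θs h - θ) -
        mean R f θ fun x => inner ℝ (f x) (θs h - θ))| ≤
        H * β * wnorm B⁻¹ (centred R f θ x) := fun x hx => by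
      rw [← inner_centred, abs_mul, mul_assoc, mul_comm β]
      refine mul_le_mul (hVabs x hx) ((abs_inner_le hB _ _).trans ?_) (abs_nonneg _)
        (Nat.cast_nonneg H)
      refine mul_le_mul_of_nonneg_left ?_ (wnorm_nonneg _ _)
      exact Real.sqrt_le_iff.2 ⟨hβ, hquad⟩
    rw [hmean, ← mean_const_mul]
    refine abs_le.2 ⟨?_, mean_mono _ fun x hx => (abs_le.1 (hb x hx)).2⟩
    rw [← neg_one_mul, ← mean_const_mul]
    refine mean_mono _ fun x hx => ?_
    rw [neg_one_mul]
    exact (abs_le.1 (hb x hx)).1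
  have h3 := abs_le.1 h1
  have h4 := abs_le.1 h2
  have h5 : (H : ℝ) * (β ^ 2 * X) ≤ 3 * H * β ^ 2 * X := by
    have : 0 ≤ (H : ℝ) * (β ^ 2 * X) := by positivity
    linarith
  rw [abs_le]
  constructor <;> linarith

end Regular

/-- The action set may be infinite. The greedy action attains the supremum, which makes the supremum
in the optimistic value a genuine one. -/
theorem bddAbove_backup {alg : History S A → Policy S A} (halg : IsUCRLMNLPlus M φ p alg)
    (past : History S A) {n : ℕ} (hn : n < H) (s : S) (a : A) :
    backup M φ p past (H - n) (optimisticV M φ p past n) s a ≤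
      backup M φ p past (H - n) (optimisticV M φ p past n) s (alg past (H - n) s) := by
  have h := halg past (H - n) (Finset.mem_Icc.2 ⟨by omega, by omega⟩) s a
  simp only [optimisticQ] at h
  rwa [show H - (H - n) = n by omega] at h

theorem evalPolicy_reward_le (π : Policy S A) (hR : ∀ s a, (M.reach s a).Nonempty) :
    ∀ n h s, evalPolicy M φ θs π (fun _ => M.reward) n h s ≤ n
  | 0, _, _ => by simp [evalPolicy]
  | n + 1, h, s => by
    have h1 := mean_le (hR s (π h s)) (f := φ s (π h s)) (θs h)
      (V := evalPolicy M φ θs π (fun _ => M.reward) n (h + 1))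
      fun x _ => evalPolicy_reward_le π hR n (h + 1) x
    have h2 := (M.reward_mem s (π h s)).2
    rw [mean] at h1
    rw [evalPolicy]
    push_cast
    linarith

namespace Regular

theorem optimisticV_mem (hr : Regular M φ θs p Lφ L₀) (hp : ∀ k, 0 ≤ p.conf k)
    (past : History S A) :
    ∀ n s, 0 ≤ optimisticV M φ p past n s ∧ optimisticV M φ p past n s ≤ H
  | 0, _ => ⟨le_rfl, Nat.cast_nonneg H⟩
  | n + 1, s => by
    refine ⟨le_min (Real.iSup_nonneg fun a => ?_) (Nat.cast_nonneg H), min_le_right _ _⟩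
    rw [backup_eq]
    have h1 := (M.reward_mem s a).1
    have h2 := bonus_nonneg (M := M) (φ := φ) hp past (H - n) s a
    have h3 := mean_nonneg (R := M.reach s a) (f := φ s a) (estimate M φ p (H - n) past).1
      fun x _ => (hr.optimisticV_mem hp past n x).1
    linarith

/-- On the confidence event the optimistic values dominate the values of all policies. -/
theorem evalPolicy_le_optimisticV (hr : Regular M φ θs p Lφ L₀) (hp : ∀ k, 0 ≤ p.conf k)
    {alg : History S A → Policy S A} (halg : IsUCRLMNLPlus M φ p alg)
    {past : History S A} (hc : Confident M φ θs p past) (π : Policy S A) :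
    ∀ n ≤ H, ∀ s, evalPolicy M φ θs π (fun _ => M.reward) n (H + 1 - n) s ≤
      optimisticV M φ p past n s
  | 0, _, _ => le_rfl
  | n + 1, hn, s => by
    have hh : H - n ∈ Finset.Icc 1 H := Finset.mem_Icc.2 ⟨by omega, by omega⟩
    -- Truncation at `H` preserves optimism, because a sum of at most `H` rewards in [0, 1] never
    -- exceeds `H`.
    refine le_min ?_ ((evalPolicy_reward_le π hr.reach_nonempty _ _ _).trans
      (by exact_mod_cast hn))
    rw [show H + 1 - (n + 1) = H - n by omega, evalPolicy, show H - n + 1 = H + 1 - n by omega]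
    set a := π (H - n) s
    refine le_trans ?_ (le_ciSup (f := fun a => backup M φ p past (H - n)
      (optimisticV M φ p past n) s a) ⟨_, Set.forall_mem_range.2 fun a =>
        bddAbove_backup halg past (by omega) s a⟩ a)
    have h1 := mean_mono (R := M.reach s a) (f := φ s a) (θs (H - n))
      fun x _ => evalPolicy_le_optimisticV hr hp halg hc π n (by omega) x
    have h2 := (abs_le.1 (hr.abs_mean_sub_mean_le_bonus hp hc hh s a
      (hr.optimisticV_mem hp past n))).2
    simp only [backup_eq]
    rw [mean] at h1
    linarith

/-- Dropping the truncation and unrolling under the true transitions costs a second bonus per step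
for the change of model; this is the source of the factor 2. -/
theorem optimisticV_le_evalPolicy (hr : Regular M φ θs p Lφ L₀) (hp : ∀ k, 0 ≤ p.conf k)
    {alg : History S A → Policy S A} (halg : IsUCRLMNLPlus M φ p alg)
    {past : History S A} (hc : Confident M φ θs p past) :
    ∀ n ≤ H, ∀ s, optimisticV M φ p past n s ≤ evalPolicy M φ θs (alg past)
      (fun h s a => M.reward s a + 2 * bonus M φ p past h s a) n (H + 1 - n) s
  | 0, _, _ => le_rfl
  | n + 1, hn, s => by
    have hh : H - n ∈ Finset.Icc 1 H := Finset.mem_Icc.2 ⟨by omega, by omega⟩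
    rw [show H + 1 - (n + 1) = H - n by omega, evalPolicy, show H - n + 1 = H + 1 - n by omega]
    set a := alg past (H - n) s
    have : Nonempty A := ⟨a⟩
    refine (min_le_left _ _).trans ((ciSup_le fun a =>
      bddAbove_backup halg past (by omega) s a).trans ?_)
    have h1 := mean_mono (R := M.reach s a) (f := φ s a) (θs (H - n))
      fun x _ => optimisticV_le_evalPolicy hr hp halg hc n (by omega) x
    have h2 := (abs_le.1 (hr.abs_mean_sub_mean_le_bonus hp hc hh s a
      (hr.optimisticV_mem hp past n))).1
    rw [backup_eq]
    rw [mean, mean] at h1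
    rw [mean] at h2
    linarith

end Regular

/-! ### Expected and realized bonuses -/

/-- The expected total bonus of an episode, up to a factor. -/
def expectedBonus (M : EpisodicMDP S A H) (φ : S → A → S → Vec d) (θs : ℕ → Vec d) (p : Params)
    (π : Policy S A) (past : History S A) (s : S) : ℝ :=
  evalPolicy M φ θs π (fun h s a => 2 * bonus M φ p past h s a) H 1 s

/-- The realized total bonus of an episode, up to a factor. -/
def realizedBonus (M : EpisodicMDP S A H) (φ : S → A → S → Vec d) (p : Params)
    (past : History S A) (τ : List (S × A × S)) : ℝ :=
  trajSum (fun h s a => 2 * bonus M φ p past h s a) 1 τ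

/-- The bonus of step `h` at the transition that is recorded in the episode. -/
def bonusOf (M : EpisodicMDP S A H) (φ : S → A → S → Vec d) (p : Params) (h : ℕ)
    (past : History S A) (e : Episode S A) : ℝ :=
  optVal (fun x => bonus M φ p past h x.1 x.2.1) e.2[h - 1]?

theorem realizedBonus_eq_sum (past : History S A) {e : Episode S A} (he : ValidEpisode M e) :
    realizedBonus M φ p past e.2 = 2 * ∑ h ∈ Finset.Icc 1 H, bonusOf M φ p h past e := by
  rw [realizedBonus, trajSum_eq_sum, he.1, Finset.mul_sum]
  have : Finset.Icc 1 H = (Finset.range H).map ⟨fun i => 1 + i, add_right_injective 1⟩ := by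
    ext h
    simp only [Finset.mem_Icc, Finset.mem_map, Finset.mem_range, Function.Embedding.coeFn_mk]
    exact ⟨fun hh => ⟨h - 1, by omega, by omega⟩, fun ⟨i, hi, hih⟩ => by omega⟩
  rw [this, Finset.sum_map]
  refine Finset.sum_congr rfl fun i _ => ?_
  simp only [bonusOf, Function.Embedding.coeFn_mk, Nat.add_sub_cancel_left]
  rcases e.2[i]? with _ | x
  · simp [optVal]
  · rfl

namespace Regular

/-- The regret of an episode is at most the expected total bonus. -/
theorem optValue_sub_value_le (hr : Regular M φ θs p Lφ L₀) (hp : ∀ k, 0 ≤ p.conf k)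
    {alg : History S A → Policy S A} (halg : IsUCRLMNLPlus M φ p alg)
    {past : History S A} (hc : Confident M φ θs p past) (s : S) :
    M.optValue 1 s - M.value (alg past) 1 s ≤ expectedBonus M φ θs p (alg past) past s := by
  have h1 : M.optValue 1 s ≤ optimisticV M φ p past H s := by
    have : Nonempty (Policy S A) := ⟨alg past⟩
    refine ciSup_le fun π => ?_
    rw [value_eq_evalPolicy hr.mnl π le_rfl (by omega)]
    have := hr.evalPolicy_le_optimisticV hp halg hc π H le_rfl s
    rwa [show H + 1 - H = 1 by omega] at this
  have h2 := hr.optimisticV_le_evalPolicy hp halg hc H le_rfl s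
  rw [show H + 1 - H = 1 by omega, evalPolicy_add (alg past) (fun _ => M.reward)] at h2
  have h3 := value_eq_evalPolicy hr.mnl (alg past) le_rfl (by omega : 1 ≤ H + 1) s
  rw [show H + 1 - 1 = H by omega] at h3
  rw [expectedBonus]
  linarith

theorem regret_le (hr : Regular M φ θs p Lφ L₀) (hp : ∀ k, 0 ≤ p.conf k)
    {alg : History S A → Policy S A} (halg : IsUCRLMNLPlus M φ p alg) :
    ∀ hist : History S A, (∀ e past, e :: past <:+ hist → Confident M φ θs p past) →
      M.regret alg hist ≤
        histSum (fun past e => expectedBonus M φ θs p (alg past) past e.1) hist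
  | [], _ => le_rfl
  | e :: past, hc => add_le_add
      (regret_le hr hp halg past fun e' past' h => hc e' past' (h.trans (List.suffix_cons _ _)))
      (hr.optValue_sub_value_le hp halg (hc e past List.suffix_rfl) e.1)

/-- With the stated parameters the confidence radius squared is of order d and λ / Lφ² is of order
d, up to logarithms. The bonus is then of order H without any power of d. -/
theorem bonus_le (hr : Regular M φ θs p Lφ L₀) (past : History S A) (h : ℕ) (s : S) (a : A) :
    bonus M φ p past h s a ≤
      H * (1 + 4 * (p.conf (past.length + 1) ^ 2 * (Lφ ^ 2 / p.reg))) := by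
  rw [bonus_eq]
  have h1 := (hr.meanNorm_sq_le past h s a).trans (hr.fluct_gram_le h past s a _)
  have h2 := hr.maxSq_le past h s a fun s' hs' => (hr.quad_inv_gram_le h past _).trans
    (div_le_div_of_nonneg_right
      (pow_le_pow_left₀ (norm_nonneg _) (hr.norm_feature_le s a s' hs') 2) hr.reg_pos.le)
  generalize Lφ ^ 2 / p.reg = r at *
  generalize meanNorm M φ p past h s a = m at *
  generalize maxSq M φ p past h s a = X at *
  generalize p.conf (past.length + 1) = β at *
  have h3 : β * m ≤ 1 + β ^ 2 * r := by
    have := mul_le_mul_of_nonneg_left h1 (sq_nonneg β)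
    nlinarith [sq_nonneg (β * m - 1)]
  have h4 : β ^ 2 * X ≤ β ^ 2 * r := mul_le_mul_of_nonneg_left h2 (sq_nonneg β)
  have hH : (0 : ℝ) ≤ H := Nat.cast_nonneg H
  calc _ = H * (β * m + 3 * (β ^ 2 * X)) := by ring
    _ ≤ _ := mul_le_mul_of_nonneg_left (by linarith) hH

/-- The deviation of the realized from the expected bonuses has bounded exponential moments. -/
theorem pexp_exp_bonus_le (hr : Regular M φ θs p Lφ L₀) (hp : ∀ k, 0 ≤ p.conf k)
    (π : Policy S A) (past : History S A) (s₁ : S) {D : ℝ} (hD : 0 < D)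
    (hb : ∀ h s a, 2 * bonus M φ p past h s a * H ≤ D) :
    pexp (M.rollout π H 1 s₁) (fun τ => ENNReal.ofReal (Real.exp
      (expectedBonus M φ θs p π past s₁ / (4 * D) - realizedBonus M φ p past τ / (2 * D)))) ≤
      1 := by
  have hnn : ∀ h s a, 0 ≤ 2 * bonus M φ p past h s a := fun h s a =>
    mul_nonneg zero_le_two (bonus_nonneg hp past h s a)
  set J := expectedBonus M φ θs p π past s₁ with hJ
  have hJ0 : 0 ≤ J := evalPolicy_nonneg hnn _ _ _
  have hE : pexp (M.rollout π H 1 s₁) (fun τ => ENNReal.ofReal (realizedBonus M φ p past τ)) =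
      ENNReal.ofReal J := pexp_rollout_trajSum hr.mnl π hnn H 1 s₁ le_rfl (by omega)
  have hE' : pexp (M.rollout π H 1 s₁)
      (fun τ => ENNReal.ofReal (realizedBonus M φ p past τ / (4 * D))) =
      ENNReal.ofReal (J / (4 * D)) := by
    have h4 : (0 : ℝ) ≤ 1 / (4 * D) := by positivity
    rw [← one_div_mul_eq_div, ENNReal.ofReal_mul h4, ← hE, ← pexp_const_mul]
    congr 1
    funext τ
    rw [← ENNReal.ofReal_mul h4, one_div_mul_eq_div]
  -- For y in [0, 1/2] one has exp(-y) ≤ 1 - y / 2. In expectation this gives 1 - J / (4 D) ≤ exp(-J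
  -- / (4 D)); stating it as a sum avoids subtraction in `ℝ≥0∞`.
  have hsum : pexp (M.rollout π H 1 s₁)
      (fun τ => ENNReal.ofReal (Real.exp (-(realizedBonus M φ p past τ / (2 * D))))) +
      ENNReal.ofReal (J / (4 * D)) ≤ 1 := by
    rw [← hE', ← pexp_add]
    refine (pexp_mono_support fun τ hτ => ?_).trans (pexp_const _ 1).le
    have hY0 : 0 ≤ realizedBonus M φ p past τ := trajSum_nonneg hnn _ _
    have hYD : realizedBonus M φ p past τ ≤ D := by
      have hH : (0 : ℝ) < H ∨ H = 0 := by
        rcases Nat.eq_zero_or_pos H with h | h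
        · exact Or.inr h
        · exact Or.inl (by exact_mod_cast h)
      rcases hH with hH | hH
      · have := trajSum_le (c := D / H) (fun h s a => by
          rw [le_div_iff₀ hH]; exact hb h s a) 1 τ
        rw [(rollout_support M π H 1 s₁ τ hτ).1, mul_div_cancel₀ _ hH.ne'] at this
        exact this
      · have := (rollout_support M π H 1 s₁ τ hτ).1
        rw [hH, List.length_eq_zero_iff] at this
        rw [realizedBonus, this, trajSum]
        exact hD.le
    set y := realizedBonus M φ p past τ / (2 * D) with hy
    have hy0 : 0 ≤ y := by positivity
    have hy1 : y ≤ 1 / 2 := by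
      rw [hy, div_le_iff₀ (by positivity)]
      linarith
    have hy2 : realizedBonus M φ p past τ / (4 * D) = y / 2 := by
      rw [hy]
      field_simp
      norm_num
    rw [hy2, ← ENNReal.ofReal_add (Real.exp_pos _).le (by positivity), ← ENNReal.ofReal_one]
    refine ENNReal.ofReal_le_ofReal ?_
    have := exp_le_one_add_add_sq (x := -y) (by rw [abs_neg, abs_of_nonneg hy0]; linarith)
    nlinarith
  have hle : pexp (M.rollout π H 1 s₁)
      (fun τ => ENNReal.ofReal (Real.exp (-(realizedBonus M φ p past τ / (2 * D))))) ≤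
      ENNReal.ofReal (Real.exp (-(J / (4 * D)))) := by
    refine (ENNReal.le_sub_of_add_le_right ENNReal.ofReal_ne_top hsum).trans ?_
    rw [← ENNReal.ofReal_one, ← ENNReal.ofReal_sub _ (by positivity)]
    exact ENNReal.ofReal_le_ofReal (by linarith [Real.add_one_le_exp (-(J / (4 * D)))])
  simp only [sub_eq_add_neg, Real.exp_add, ENNReal.ofReal_mul (Real.exp_pos _).le,
    pexp_const_mul]
  calc _ ≤ ENNReal.ofReal (Real.exp (J / (4 * D))) *
        ENNReal.ofReal (Real.exp (-(J / (4 * D)))) := by gcongr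
    _ = 1 := by
      rw [← ENNReal.ofReal_mul (Real.exp_pos _).le, ← Real.exp_add, add_neg_cancel,
        Real.exp_zero, ENNReal.ofReal_one]

/-- Jensen's inequality bounds the mean norm by the square root of the fluctuation, without κ; only
the maximum over the outcomes needs the zero feature and κ. -/
theorem bonusOf_le (hr : Regular M φ θs p Lφ L₀) (hp : ∀ k, 0 ≤ p.conf k) {κ : ℝ} (hκ : 0 < κ)
    (hκ' : ∀ s a, ∀ s₁ ∈ M.reach s a, ∀ s₂ ∈ M.reach s a, s₁ ≠ s₂ → ∀ θ : Vec d,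
      ‖θ‖ ≤ p.radius → κ ≤ mnlProb (M.reach s a) (φ s a) θ s₁ * mnlProb (M.reach s a) (φ s a) θ s₂)
    (h : ℕ) (past : History S A) (e : Episode S A) {β : ℝ} (hβ : p.conf (past.length + 1) ≤ β) :
    bonusOf M φ p h past e ≤
      H * β * √(fluctOf M φ p h (fun past => (estimate M φ p h past).1) past e) +
        3 * H * β ^ 2 * κ⁻¹ * fluctOf M φ p h (fun past => (estimate M φ p h past).1) past e := by
  rw [bonusOf, fluctOf]
  rcases e.2[h - 1]? with _ | ⟨s, a, s'⟩
  · simp [optVal]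
  simp only [optVal]
  rw [bonus_eq]
  have h1 := Real.le_sqrt_of_sq_le (hr.meanNorm_sq_le past h s a)
  obtain ⟨x₀, hx₀, hzero⟩ := hr.exists_feature_eq_zero s a
  have h2 := hr.maxSq_le past h s a fun x hx => by
    have := mul_quad_le_fluct (hr.reach_nonempty s a) (hr.posDef_gram h past).posSemidef.inv
      (estimate M φ p h past).1 hx hx₀ hzero fun hne =>
        hκ' s a x hx x₀ hx₀ hne _ (hr.norm_estimate_le h past)
    exact (le_inv_mul_iff₀ hκ).2 this
  have h3 := hp (past.length + 1)
  have h4 := maxSq_nonneg (M := M) (φ := φ) (p := p) past h s a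
  have h5 := meanNorm_nonneg (M := M) (φ := φ) (p := p) past h s a
  have hβ0 := h3.trans hβ
  rw [mul_assoc (3 * (H : ℝ) * β ^ 2)]
  gcongr

end Regular

end Optimism

/-! ### High probability bounds -/

section HighProbability

open scoped ENNReal

variable {S A : Type*} {H d : ℕ} {M : EpisodicMDP S A H} {φ : S → A → S → Vec d}
  {θs : ℕ → Vec d} {p : Params} {Lφ L₀ : ℝ}

theorem sum_ofReal_inv_mul_succ_le_one (K : ℕ) :
    ∑ i ∈ Finset.range K, ENNReal.ofReal (1 / (((i : ℝ) + 1) * (i + 2))) ≤ 1 := by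
  rw [← ENNReal.ofReal_sum_of_nonneg fun i _ => by positivity, ← ENNReal.ofReal_one]
  refine ENNReal.ofReal_le_ofReal ?_
  have h : ∀ K : ℕ, ∑ i ∈ Finset.range K, 1 / (((i : ℝ) + 1) * (i + 2)) = 1 - 1 / (K + 1) := by
    intro K
    induction K with
    | zero => simp
    | succ K ih =>
      rw [Finset.sum_range_succ, ih]
      push_cast
      field_simp
      ring
  rw [h]
  have : (0 : ℝ) ≤ 1 / (K + 1) := by positivity
  linarith

theorem le_log_of_ofReal_mul_exp_lt_one {c x : ℝ} (hc : 0 < c)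
    (h : ENNReal.ofReal c * ENNReal.ofReal (Real.exp x) < 1) : x ≤ Real.log (1 / c) := by
  rw [← ENNReal.ofReal_mul hc.le, ← ENNReal.ofReal_one,
    ENNReal.ofReal_lt_ofReal_iff one_pos] at h
  rw [Real.le_log_iff_exp_le (by positivity), le_div_iff₀ hc]
  linarith

/-- With probability at least `1 - δ`, the noise of all the estimates and the deviation of the
realized bonuses are under control simultaneously. -/
theorem Regular.ofReal_one_sub_le_toOuterMeasure (hr : Regular M φ θs p Lφ L₀)
    (hp : ∀ k, 0 ≤ p.conf k) (hH : 1 ≤ H) (init : History S A → PMF S)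
    (alg : History S A → Policy S A) {K : ℕ} {δ D : ℝ} (hδ : 0 < δ) (hD : 0 < D)
    (hb : ∀ past : History S A, past.length < K → ∀ h s a,
      2 * bonus M φ p past h s a * H ≤ D)
    {E : Set (History S A)}
    (hE : ∀ hist : History S A, hist.length = K → (∀ e ∈ hist, ValidEpisode M e) →
      (∀ h ∈ Finset.Icc 1 H, ∀ e past, e :: past <:+ hist →
        noiseScale L₀ p.step / 2 * histSum (noiseOf M φ θs p L₀ h) (e :: past) ≤
          Real.log (2 * H * ((past.length + 1) * (past.length + 2)) / δ)) →
      histSum (fun past e => expectedBonus M φ θs p (alg past) past e.1) hist ≤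
        2 * histSum (fun past e => realizedBonus M φ p past e.2) hist +
          4 * D * Real.log (2 / δ) → hist ∈ E) :
    ENNReal.ofReal (1 - δ) ≤ (M.run init alg K).toOuterMeasure E := by
  have hH0 : (0 : ℝ) < H := by exact_mod_cast hH
  set c : ℕ → ℝ≥0∞ := fun i => ENNReal.ofReal (1 / (((i : ℝ) + 1) * (i + 2))) with hc
  set w : ℕ → History S A → Episode S A → ℝ := fun h past e =>
    noiseScale L₀ p.step / 2 * noiseOf M φ θs p L₀ h past e with hw
  -- Averaging over the steps `h` keeps the expectation at most one and loses a factor `H` inside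
  -- the logarithm.
  set f : History S A → ℝ≥0∞ := fun hist => ENNReal.ofReal (1 / H) *
    ∑ h ∈ Finset.Icc 1 H, ENNReal.ofReal (Real.exp (histSum (w h) hist)) with hf
  set g : History S A → Episode S A → ℝ := fun past e =>
    expectedBonus M φ θs p (alg past) past e.1 / (4 * D) -
      realizedBonus M φ p past e.2 / (2 * D) with hg
  -- A single functional of mean at most δ collects all failures: half of δ for the noise at all
  -- steps and prefixes, half for the bonuses. Each of its terms is below one wherever `F` is.
  set F : History S A → ℝ≥0∞ := fun hist => ENNReal.ofReal (δ / 2) *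
    (prefixSum c f hist + ENNReal.ofReal (Real.exp (histSum g hist))) with hF
  have h1 : ∀ k ≤ K, pexp (M.run init alg k) f ≤ 1 := by
    intro k hk
    simp only [hf]
    rw [pexp_const_mul, pexp_finset_sum]
    calc _ ≤ ENNReal.ofReal (1 / H) * ∑ _h ∈ Finset.Icc 1 H, (1 : ℝ≥0∞) := by
          gcongr with h hh
          exact pexp_run_exp_histSum_le M init alg (w h) K
            (fun past _ s₁ => hr.pexp_exp_noiseOf_le hh (alg past) past s₁) k hk
      _ = 1 := by
          rw [Finset.sum_const, Nat.card_Icc, Nat.add_sub_cancel, nsmul_one,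
            ← ENNReal.ofReal_natCast, ← ENNReal.ofReal_mul (by positivity),
            one_div_mul_cancel hH0.ne', ENNReal.ofReal_one]
  have h2 : pexp (M.run init alg K) (prefixSum c f) ≤ 1 :=
    (pexp_run_prefixSum_le M init alg c f K h1 K le_rfl).trans
      (sum_ofReal_inv_mul_succ_le_one K)
  have h3 : pexp (M.run init alg K)
      (fun hist => ENNReal.ofReal (Real.exp (histSum g hist))) ≤ 1 :=
    pexp_run_exp_histSum_le M init alg g K
      (fun past hpast s₁ => hr.pexp_exp_bonus_le hp (alg past) past s₁ hD (hb past hpast))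
      K le_rfl
  have h4 : pexp (M.run init alg K) F ≤ ENNReal.ofReal δ := by
    simp only [hF]
    rw [pexp_const_mul, pexp_add]
    calc _ ≤ ENNReal.ofReal (δ / 2) * (1 + 1) := by gcongr
      _ = ENNReal.ofReal δ := by
        rw [one_add_one_eq_two, ← ENNReal.ofReal_ofNat 2, ← ENNReal.ofReal_mul (by positivity)]
        congr 1
        ring
  refine ofReal_one_sub_le_of_pexp_le hδ.le h4 fun hist hhist hlt => ?_
  obtain ⟨hlen, hvalid⟩ := run_support M init alg K hist hhist
  refine hE hist hlen hvalid (fun h hh e past hsuf => ?_) ?_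
  · rw [← histSum_const_mul]
    have h5 : ENNReal.ofReal (δ / 2 * (1 / (((past.length : ℝ) + 1) * (past.length + 2)) *
        (1 / H))) * ENNReal.ofReal (Real.exp (histSum (w h) (e :: past))) ≤ F hist := by
      rw [ENNReal.ofReal_mul (by positivity), ENNReal.ofReal_mul (by positivity), mul_assoc,
        mul_assoc]
      simp only [hF]
      gcongr
      refine le_trans ?_ (le_self_add)
      refine le_trans ?_ (le_prefixSum_of_suffix c f hist e past hsuf)
      simp only [hf, hc]
      gcongr
      exact Finset.single_le_sum
        (f := fun h => ENNReal.ofReal (Real.exp (histSum (w h) (e :: past))))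
        (fun _ _ => zero_le) hh
    have h6 := le_log_of_ofReal_mul_exp_lt_one (by positivity) (h5.trans_lt hlt)
    refine h6.trans (le_of_eq ?_)
    congr 1
    field_simp
  · have h5 : ENNReal.ofReal (δ / 2) * ENNReal.ofReal (Real.exp (histSum g hist)) ≤ F hist := by
      simp only [hF]
      gcongr
      exact le_add_self
    have h6 := le_log_of_ofReal_mul_exp_lt_one (by positivity) (h5.trans_lt hlt)
    rw [one_div_div] at h6
    have h7 : histSum g hist =
        1 / (4 * D) * histSum (fun past e => expectedBonus M φ θs p (alg past) past e.1) hist +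
          -(1 / (2 * D)) * histSum (fun past e => realizedBonus M φ p past e.2) hist := by
      rw [← histSum_const_mul, ← histSum_const_mul, ← histSum_add]
      congr 1
      funext past e
      simp only [hg]
      ring
    rw [h7] at h6
    have h8 := mul_le_mul_of_nonneg_left h6 (by positivity : 0 ≤ 4 * D)
    have h9 : 4 * D * (1 / (4 * D) *
        histSum (fun past e => expectedBonus M φ θs p (alg past) past e.1) hist +
          -(1 / (2 * D)) * histSum (fun past e => realizedBonus M φ p past e.2) hist) =
        histSum (fun past e => expectedBonus M φ θs p (alg past) past e.1) hist -
          2 * histSum (fun past e => realizedBonus M φ p past e.2) hist := by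
      field_simp
      ring
    linarith

/-- A bound of the distance of the estimate to the true parameter under control of the noise. -/
theorem Regular.quad_estimate_le_log (hr : Regular M φ θs p Lφ L₀) (hH : 1 ≤ H) {δ : ℝ}
    (hδ : 0 < δ) (hδ1 : δ < 1) {hist : History S A} (hv : ∀ e ∈ hist, ValidEpisode M e) {h : ℕ}
    (hh : h ∈ Finset.Icc 1 H)
    (hnoise : ∀ e past, hist = e :: past →
      noiseScale L₀ p.step / 2 * histSum (noiseOf M φ θs p L₀ h) (e :: past) ≤
        Real.log (2 * H * ((past.length + 1) * (past.length + 2)) / δ)) :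
    quad (estimate M φ p h hist).2 (θs h - (estimate M φ p h hist).1) ≤
      p.reg * p.radius ^ 2 +
        48 * p.step * (Real.exp (4 * L₀) + L₀) * Real.log (1 + (hist.length + 1) * H / δ) +
        8 * p.step ^ 2 * Real.exp (4 * L₀) * d * Real.log (1 + (hist.length + 1) * H / δ) := by
  have hL := hr.L₀_pos
  have hη := hr.one_le_step
  have hH1 : (1 : ℝ) ≤ H := by exact_mod_cast hH
  have hΓ := Real.exp_pos (4 * L₀)
  have hn0 : (0 : ℝ) ≤ hist.length := Nat.cast_nonneg _
  set x : ℝ := (hist.length + 1) * H / δ with hx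
  have hkx : (hist.length : ℝ) + 1 ≤ x := by
    rw [hx, le_div_iff₀ hδ]
    nlinarith
  have hx0 : 0 < x := by linarith
  have hlog0 : 0 ≤ Real.log (1 + x) := Real.log_nonneg (by linarith)
  have h1 := hr.quad_estimate_le hh hist hv
  have h2 := hr.histSum_fluctOf_le hh (ϑ := fun _ => θs h) (fun _ => hr.norm_core_le h hh) hist hv
  have h3 : Real.log (1 + hist.length) ≤ Real.log (1 + x) :=
    Real.log_le_log (by linarith) (by linarith)
  have h4 : histSum (noiseOf M φ θs p L₀ h) hist ≤
      48 * p.step * (Real.exp (4 * L₀) + L₀) * Real.log (1 + x) := by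
    rcases hist with _ | ⟨e, past⟩
    · simp only [histSum]
      positivity
    · have h5 := hnoise e past rfl
      -- For a history of n ≥ 1 episodes and x = (n + 1) H / δ, the argument equals 2 x n, which is
      -- at most 2 x² ≤ (1 + x)³.
      have h6 : Real.log (2 * H * ((past.length + 1) * (past.length + 2)) / δ) ≤
          3 * Real.log (1 + x) := by
        rw [show (3 : ℝ) = (3 : ℕ) by norm_num, ← Real.log_pow]
        refine Real.log_le_log (by positivity) ?_
        simp only [List.length_cons, Nat.cast_add, Nat.cast_one] at hx hkx
        have h7 : 2 * H * ((past.length + 1) * (past.length + 2)) / δ ≤ 2 * x * x := by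
          have e1 : 2 * H * (((past.length : ℝ) + 1) * (past.length + 2)) / δ =
              2 * x * (past.length + 1) := by
            rw [hx]
            ring
          rw [e1]
          exact mul_le_mul_of_nonneg_left (by linarith) (by positivity)
        refine h7.trans ?_
        have : 0 ≤ x ^ 3 := by positivity
        nlinarith [sq_nonneg x]
      -- 16 η (Γ + L₀) is the inverse of half the noise scale; with the factor 3 from the logarithm
      -- it gives the constant 48.
      have h8 : noiseScale L₀ p.step / 2 * (16 * p.step * (Real.exp (4 * L₀) + L₀)) = 1 := by
        rw [noiseScale]
        field_simp
        norm_num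
      have h9 := mul_le_mul_of_nonneg_left (h5.trans h6)
        (by positivity : 0 ≤ 16 * p.step * (Real.exp (4 * L₀) + L₀))
      calc histSum (noiseOf M φ θs p L₀ h) (e :: past) =
            (noiseScale L₀ p.step / 2 * (16 * p.step * (Real.exp (4 * L₀) + L₀))) *
              histSum (noiseOf M φ θs p L₀ h) (e :: past) := by rw [h8, one_mul]
        _ = 16 * p.step * (Real.exp (4 * L₀) + L₀) * (noiseScale L₀ p.step / 2 *
              histSum (noiseOf M φ θs p L₀ h) (e :: past)) := by ring
        _ ≤ _ := h9
        _ = _ := by ring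
  have h5 : 4 * p.step ^ 2 * histSum (fluctOf M φ p h fun _ => θs h) hist ≤
      8 * p.step ^ 2 * Real.exp (4 * L₀) * d * Real.log (1 + x) := by
    calc _ ≤ 4 * p.step ^ 2 * (2 * Real.exp (4 * L₀) * (d * Real.log (1 + hist.length))) :=
          mul_le_mul_of_nonneg_left h2 (by positivity)
      _ ≤ 4 * p.step ^ 2 * (2 * Real.exp (4 * L₀) * (d * Real.log (1 + x))) := by gcongr
      _ = _ := by ring
  linarith

theorem histSum_sqrt_le {w : History S A → Episode S A → ℝ} (hw : ∀ past e, 0 ≤ w past e)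
    (hist : History S A) :
    histSum (fun past e => √(w past e)) hist ≤ √(hist.length * histSum w hist) := by
  refine Real.le_sqrt_of_sq_le ((histSum_sq_le _ hist).trans (le_of_eq ?_))
  simp only [Real.sq_sqrt (hw _ _)]

/-- A bound of the sum of the realized bonuses. -/
theorem Regular.histSum_realizedBonus_le (hr : Regular M φ θs p Lφ L₀) (hp : ∀ k, 0 ≤ p.conf k)
    {κ : ℝ} (hκ : 0 < κ)
    (hκ' : ∀ s a, ∀ s₁ ∈ M.reach s a, ∀ s₂ ∈ M.reach s a, s₁ ≠ s₂ → ∀ θ : Vec d,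
      ‖θ‖ ≤ p.radius → κ ≤ mnlProb (M.reach s a) (φ s a) θ s₁ * mnlProb (M.reach s a) (φ s a) θ s₂)
    {hist : History S A} (hv : ∀ e ∈ hist, ValidEpisode M e) {β : ℝ}
    (hβ : ∀ n < hist.length, p.conf (n + 1) ≤ β) (hβ0 : 0 ≤ β) {P : ℝ}
    (hP : 2 * Real.exp (4 * L₀) * (d * Real.log (1 + hist.length)) ≤ P) :
    histSum (fun past e => realizedBonus M φ p past e.2) hist ≤
      2 * (H * (H * β * √(hist.length * P) + 3 * H * β ^ 2 * κ⁻¹ * P)) := by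
  set Q : History S A → Prop := fun l => (∀ e ∈ l, ValidEpisode M e) ∧
    ∀ n < l.length, p.conf (n + 1) ≤ β with hQ
  have hQ1 : ∀ e past, Q (e :: past) → Q past := fun e past h =>
    ⟨fun e' he' => h.1 e' (List.mem_cons_of_mem _ he'), fun n hn => h.2 n (by
      rw [List.length_cons]; omega)⟩
  have h1 : histSum (fun past e => realizedBonus M φ p past e.2) hist ≤
      2 * ∑ h ∈ Finset.Icc 1 H, histSum (bonusOf M φ p h) hist := by
    rw [← histSum_finset_sum, ← histSum_const_mul]
    exact histSum_mono hQ1 (fun past e h =>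
      (realizedBonus_eq_sum past (h.1 e List.mem_cons_self)).le) hist ⟨hv, hβ⟩
  refine h1.trans (mul_le_mul_of_nonneg_left ?_ zero_le_two)
  have h2 : ∀ h ∈ Finset.Icc 1 H, histSum (bonusOf M φ p h) hist ≤
      H * β * √(hist.length * P) + 3 * H * β ^ 2 * κ⁻¹ * P := by
    intro h hh
    set w := fluctOf M φ p h (fun past => (estimate M φ p h past).1)
    have h3 : histSum w hist ≤ P :=
      (hr.histSum_fluctOf_le hh (hr.norm_estimate_le h) hist hv).trans hP
    have h4 := histSum_sqrt_le (w := w) (hr.fluctOf_nonneg h _) hist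
    calc histSum (bonusOf M φ p h) hist ≤
          histSum (fun past e => H * β * √(w past e) + 3 * H * β ^ 2 * κ⁻¹ * w past e) hist :=
          histSum_mono hQ1 (fun past e hq => hr.bonusOf_le hp hκ hκ' h past e
            (hq.2 past.length (by simp))) hist ⟨hv, hβ⟩
      _ = H * β * histSum (fun past e => √(w past e)) hist +
            3 * H * β ^ 2 * κ⁻¹ * histSum w hist := by
          rw [histSum_add, histSum_const_mul, histSum_const_mul]
      _ ≤ _ := by
          refine add_le_add (mul_le_mul_of_nonneg_left (h4.trans ?_) (by positivity))
            (mul_le_mul_of_nonneg_left h3 (by positivity))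
          exact Real.sqrt_le_sqrt (mul_le_mul_of_nonneg_left h3 (Nat.cast_nonneg _))
  refine (Finset.sum_le_sum h2).trans (le_of_eq ?_)
  rw [Finset.sum_const, Nat.card_Icc, Nat.add_sub_cancel, nsmul_eq_mul]

end HighProbability

/-! ### The choice of the constants -/

section Constants

variable {S A : Type*} {H d : ℕ} {M : EpisodicMDP S A H} {φ : S → A → S → Vec d}
  {θs : ℕ → Vec d}

/-- The constant of the step size. -/
def stepConst (L₀ : ℝ) : ℝ := 2 * Real.exp (4 * L₀)

/-- The constant of the regularization parameter. -/
def regConst (L₀ : ℝ) : ℝ := (8 * L₀ + 2) * stepConst L₀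

/-- The constant of the confidence radii. -/
def confConst (L₀ : ℝ) : ℝ :=
  1 + (8 * regConst L₀ * L₀ ^ 2 + 192 * stepConst L₀ * (Real.exp (4 * L₀) + L₀) +
    16 * stepConst L₀ ^ 2 * Real.exp (4 * L₀))

/-- The constant of the regret bound. -/
def regretConst (L₀ : ℝ) : ℝ :=
  4 * confConst L₀ * (1 + 2 * Real.exp (4 * L₀)) + 24 * Real.exp (4 * L₀) * confConst L₀ ^ 2 +
    8 * (1 + 4 * confConst L₀ ^ 2)

/-- The input parameters of the algorithm. -/
def params (L₀ Lφ Lθ δ : ℝ) (d U H : ℕ) : Params where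
  reg := regConst L₀ * (Lφ ^ 2 * d * Real.log U)
  step := stepConst L₀ * Real.log U
  conf := fun k => confConst L₀ * (√d * Real.log U * Real.log (1 + k * H / δ))
  radius := Lθ

theorem stepConst_pos (L₀ : ℝ) : 0 < stepConst L₀ := by
  unfold stepConst
  positivity

theorem regConst_pos {L₀ : ℝ} (h : 0 < L₀) : 0 < regConst L₀ := by
  have := stepConst_pos L₀
  unfold regConst
  positivity

theorem one_le_confConst {L₀ : ℝ} (h : 0 < L₀) : 1 ≤ confConst L₀ := by
  have := stepConst_pos L₀
  have := regConst_pos h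
  unfold confConst
  rw [le_add_iff_nonneg_right]
  positivity

theorem regretConst_pos {L₀ : ℝ} (h : 0 < L₀) : 0 < regretConst L₀ := by
  have := one_le_confConst h
  unfold regretConst
  positivity

theorem half_le_log {x : ℝ} (hx : 2 ≤ x) : 1 / 2 ≤ Real.log x := by
  have h1 := Real.log_le_log two_pos hx
  have h2 := Real.log_two_gt_d9
  linarith

/-- The factor 2 in `stepConst` compensates log U ≥ 1/2, so that η ≥ Γ; the factor d in λ is at
least one and is needed only for the size of the bonuses. -/
theorem regular_params {L₀ Lφ Lθ δ : ℝ} {U : ℕ} (hd : 1 ≤ d) (hLφ : 0 < Lφ)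
    (hLθ : 0 < Lθ) (hL : Lφ * Lθ ≤ L₀) (hM : M.IsMNL φ θs) (hU : 2 ≤ U)
    (hφ : ∀ s a, ∀ s' ∈ M.reach s a, ‖φ s a s'‖ ≤ Lφ)
    (hθ : ∀ h ∈ Finset.Icc 1 H, ‖θs h‖ ≤ Lθ)
    (h0 : ∀ s a, ∃ s' ∈ M.reach s a, φ s a s' = 0) :
    Regular M φ θs (params L₀ Lφ Lθ δ d U H) Lφ L₀ where
  mnl := hM
  Lφ_pos := hLφ
  radius_pos := hLθ
  mul_radius_le := hL
  norm_feature_le := hφ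
  norm_core_le := hθ
  exists_feature_eq_zero := h0
  le_step := by
    have h1 := half_le_log (by exact_mod_cast hU : (2 : ℝ) ≤ U)
    have := Real.exp_pos (4 * L₀)
    simp only [params, stepConst]
    nlinarith
  le_reg := by
    have h1 := half_le_log (by exact_mod_cast hU : (2 : ℝ) ≤ U)
    have hd1 : (1 : ℝ) ≤ d := by exact_mod_cast hd
    have hL₀ : 0 < L₀ := (mul_pos hLφ hLθ).trans_le hL
    have := regConst_pos hL₀
    simp only [params]
    calc (8 * L₀ + 2) * (stepConst L₀ * Real.log U) * Lφ ^ 2 =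
          regConst L₀ * (Lφ ^ 2 * 1 * Real.log U) := by
          rw [regConst]
          ring
      _ ≤ _ := by gcongr

/-- The confidence radii dominate the bound of the estimation error. -/
theorem le_conf_sq {L₀ Lφ Lθ l x : ℝ} (hd : 1 ≤ d) (hLφ : 0 < Lφ) (hLθ : 0 < Lθ)
    (hL : Lφ * Lθ ≤ L₀) (hl : 1 / 2 ≤ l) (hx : 1 / 2 ≤ x) :
    regConst L₀ * (Lφ ^ 2 * d * l) * Lθ ^ 2 +
      48 * (stepConst L₀ * l) * (Real.exp (4 * L₀) + L₀) * x +
      8 * (stepConst L₀ * l) ^ 2 * Real.exp (4 * L₀) * d * x ≤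
      (confConst L₀ * (√d * l * x)) ^ 2 := by
  have hd1 : (1 : ℝ) ≤ d := by exact_mod_cast hd
  have hL₀ : 0 < L₀ := (mul_pos hLφ hLθ).trans_le hL
  have hr := regConst_pos hL₀
  have hs := stepConst_pos L₀
  have hΓ := Real.exp_pos (4 * L₀)
  have hl0 : 0 < l := by linarith
  have hx0 : 0 < x := by linarith
  have hd0 : (0 : ℝ) < d := by linarith
  have hlx : 1 / 4 ≤ l * x := by nlinarith
  have t1 : regConst L₀ * (Lφ ^ 2 * d * l) * Lθ ^ 2 ≤
      8 * regConst L₀ * L₀ ^ 2 * (d * l ^ 2 * x ^ 2) := by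
    have h1 : (Lφ * Lθ) ^ 2 ≤ L₀ ^ 2 := pow_le_pow_left₀ (by positivity) hL 2
    have h2 : 1 ≤ 8 * (l * x * x) := by nlinarith
    calc _ = regConst L₀ * (Lφ * Lθ) ^ 2 * (d * l) * 1 := by ring
      _ ≤ regConst L₀ * L₀ ^ 2 * (d * l) * (8 * (l * x * x)) := by gcongr
      _ = _ := by ring
  have t2 : 48 * (stepConst L₀ * l) * (Real.exp (4 * L₀) + L₀) * x ≤
      192 * stepConst L₀ * (Real.exp (4 * L₀) + L₀) * (d * l ^ 2 * x ^ 2) := by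
    have h2 : 1 ≤ d * (4 * (l * x)) := by nlinarith
    calc _ = 48 * (stepConst L₀ * l) * (Real.exp (4 * L₀) + L₀) * x * 1 := by ring
      _ ≤ 48 * (stepConst L₀ * l) * (Real.exp (4 * L₀) + L₀) * x * (d * (4 * (l * x))) := by gcongr
      _ = _ := by ring
  have t3 : 8 * (stepConst L₀ * l) ^ 2 * Real.exp (4 * L₀) * d * x ≤
      16 * stepConst L₀ ^ 2 * Real.exp (4 * L₀) * (d * l ^ 2 * x ^ 2) := by
    calc _ = 8 * (stepConst L₀ * l) ^ 2 * Real.exp (4 * L₀) * d * x * 1 := by ring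
      _ ≤ 8 * (stepConst L₀ * l) ^ 2 * Real.exp (4 * L₀) * d * x * (2 * x) := by
          gcongr
          linarith
      _ = _ := by ring
  have hc := one_le_confConst hL₀
  have e1 : (confConst L₀ * (√d * l * x)) ^ 2 = confConst L₀ ^ 2 * (d * l ^ 2 * x ^ 2) := by
    have := Real.sq_sqrt hd0.le
    calc _ = confConst L₀ ^ 2 * (√d ^ 2 * l ^ 2 * x ^ 2) := by ring
      _ = _ := by rw [this]
  -- The radius enters squared, while the three error constants add up to `confConst L₀ - 1`; the
  -- added 1 ensures c - 1 ≤ c².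
  have t4 : (confConst L₀ - 1) * (d * l ^ 2 * x ^ 2) ≤ confConst L₀ ^ 2 * (d * l ^ 2 * x ^ 2) := by
    refine mul_le_mul_of_nonneg_right ?_ (by positivity)
    nlinarith
  rw [e1]
  refine le_trans ?_ t4
  simp only [confConst]
  linarith

theorem rpow_mul_sqrt_eq (K H : ℕ) :
    (H : ℝ) ^ (3 / 2 : ℝ) * √(K * H) = (H : ℝ) ^ 2 * √K := by
  rw [Real.sqrt_mul (Nat.cast_nonneg K), Real.sqrt_eq_rpow (H : ℝ), mul_left_comm,
    ← Real.rpow_add_of_nonneg (Nat.cast_nonneg H) (by norm_num) (by norm_num), mul_comm]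
  norm_num

/-- The arithmetic of the final regret bound. -/
theorem total_bound_le {L₀ κ Λ : ℝ} {K : ℕ} (hL₀ : 0 < L₀) (hκ : 0 < κ) (hd : 1 ≤ d) (hK : 1 ≤ K)
    (hΛ : 1 ≤ Λ) :
    2 * (2 * (H * (H * (confConst L₀ * √d * Λ ^ 2) *
      √(K * (2 * Real.exp (4 * L₀) * (d * Λ))) +
        3 * H * (confConst L₀ * √d * Λ ^ 2) ^ 2 * κ⁻¹ * (2 * Real.exp (4 * L₀) * (d * Λ))))) +
      4 * (2 * (1 + 4 * confConst L₀ ^ 2) * Λ ^ 4 * (H : ℝ) ^ 2) * Λ ≤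
    regretConst L₀ * Λ ^ 5 * (d * ((H : ℝ) ^ 2 * √K) + κ⁻¹ * (d : ℝ) ^ 2 * (H : ℝ) ^ 2) := by
  have hc := one_le_confConst hL₀
  have hd1 : (1 : ℝ) ≤ d := by exact_mod_cast hd
  have hK1 : (1 : ℝ) ≤ √K := Real.one_le_sqrt.2 (by exact_mod_cast hK)
  have hΓ := Real.exp_pos (4 * L₀)
  have hκi : 0 < κ⁻¹ := inv_pos.2 hκ
  have hH : (0 : ℝ) ≤ H := Nat.cast_nonneg H
  have hsd : √(d : ℝ) ^ 2 = d := Real.sq_sqrt (Nat.cast_nonneg d)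
  rw [regretConst]
  set c := confConst L₀
  set Γ := Real.exp (4 * L₀)
  have s1 : √(K * (2 * Γ * (d * Λ))) ≤ √K * ((1 + 2 * Γ) * (√d * Λ)) := by
    rw [Real.sqrt_mul (Nat.cast_nonneg K)]
    refine mul_le_mul_of_nonneg_left (Real.sqrt_le_iff.2 ⟨by positivity, ?_⟩) (Real.sqrt_nonneg _)
    calc 2 * Γ * (d * Λ) ≤ (1 + 2 * Γ) ^ 2 * (d * Λ ^ 2) := by
          have h1 : 2 * Γ ≤ (1 + 2 * Γ) ^ 2 := by nlinarith
          have h2 : Λ ≤ Λ ^ 2 := by nlinarith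
          gcongr
      _ = (1 + 2 * Γ) ^ 2 * (√d ^ 2 * Λ ^ 2) := by rw [hsd]
      _ = _ := by ring
  have a1 : H * (c * √d * Λ ^ 2) * √(K * (2 * Γ * (d * Λ))) ≤
      c * (1 + 2 * Γ) * (Λ ^ 5 * (d * (H * √K))) := by
    calc _ ≤ H * (c * √d * Λ ^ 2) * (√K * ((1 + 2 * Γ) * (√d * Λ))) := by gcongr
      _ = c * (1 + 2 * Γ) * (Λ ^ 3 * (√d ^ 2 * (H * √K))) := by ring
      _ = c * (1 + 2 * Γ) * (Λ ^ 3 * (d * (H * √K))) := by rw [hsd]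
      _ ≤ _ := by
        gcongr
        norm_num
  have a2 : 3 * H * (c * √d * Λ ^ 2) ^ 2 * κ⁻¹ * (2 * Γ * (d * Λ)) =
      6 * Γ * c ^ 2 * (Λ ^ 5 * (κ⁻¹ * (d : ℝ) ^ 2 * H)) := by
    calc _ = 6 * Γ * c ^ 2 * (Λ ^ 5 * (κ⁻¹ * (√d ^ 2 * d) * H)) := by ring
      _ = _ := by rw [hsd]; ring
  -- The deviation term is of order H², without √K. It is absorbed in the leading term because d √K
  -- ≥ 1.
  have a3 : 4 * (2 * (1 + 4 * c ^ 2) * Λ ^ 4 * (H : ℝ) ^ 2) * Λ ≤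
      8 * (1 + 4 * c ^ 2) * (Λ ^ 5 * (d * ((H : ℝ) ^ 2 * √K))) := by
    have h1 : (1 : ℝ) ≤ d * √K := by nlinarith
    calc _ = 8 * (1 + 4 * c ^ 2) * (Λ ^ 5 * ((H : ℝ) ^ 2 * 1)) := by ring
      _ ≤ 8 * (1 + 4 * c ^ 2) * (Λ ^ 5 * ((H : ℝ) ^ 2 * (d * √K))) := by gcongr
      _ = _ := by ring
  have X0 : 0 ≤ Λ ^ 5 * (d * ((H : ℝ) ^ 2 * √K)) := by positivity
  have Y0 : 0 ≤ Λ ^ 5 * (κ⁻¹ * (d : ℝ) ^ 2 * (H : ℝ) ^ 2) := by positivity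
  rw [a2]
  have a1' := mul_le_mul_of_nonneg_left a1 (by positivity : 0 ≤ 4 * (H : ℝ))
  have p1 : 0 ≤ (4 * c * (1 + 2 * Γ) + 8 * (1 + 4 * c ^ 2)) *
      (Λ ^ 5 * (κ⁻¹ * (d : ℝ) ^ 2 * (H : ℝ) ^ 2)) := by positivity
  have p2 : 0 ≤ 24 * Γ * c ^ 2 * (Λ ^ 5 * (d * ((H : ℝ) ^ 2 * √K))) := by positivity
  linarith

end Constants

end MNL

end

/-! ### Assembly of the regret bound -/

theorem corollary1 :
    -- the exponent of the logarithmic factor is absolute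
    ∃ q : ℕ,
    -- the constants depend only on an upper bound `L₀` of `Lφ * Lθ`
    ∀ L₀ : ℝ, 0 < L₀ →
    ∃ cReg cConf cStep C : ℝ, 0 < cReg ∧ 0 < cConf ∧ 0 < cStep ∧ 0 < C ∧
    ∀ (S : Type u) (A : Type v) (d H K U : ℕ) (Lφ Lθ κ δ : ℝ)
      (M : MNL.EpisodicMDP S A H) (φ : S → A → S → MNL.Vec d) (θs : ℕ → MNL.Vec d)
      (init : MNL.History S A → PMF S) (alg : MNL.History S A → MNL.Policy S A),
      1 ≤ d → 1 ≤ H → 1 ≤ K → 0 < Lφ → 0 < Lθ → Lφ * Lθ ≤ L₀ →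
      -- multinomial logistic transitions with at most `U` reachable states
      M.IsMNL φ θs → 2 ≤ U → (∀ s a, (M.reach s a).card ≤ U) →
      -- boundedness of the features and of the transition cores
      (∀ s a, ∀ s' ∈ M.reach s a, ‖φ s a s'‖ ≤ Lφ) →
      (∀ h ∈ Finset.Icc 1 H, ‖θs h‖ ≤ Lθ) →
      -- normalization: one of the reachable states has zero feature
      (∀ s a, ∃ s' ∈ M.reach s a, φ s a s' = 0) →
      -- the problem-dependent constant
      0 < κ →
      (∀ s a, ∀ s₁ ∈ M.reach s a, ∀ s₂ ∈ M.reach s a, s₁ ≠ s₂ → ∀ θ : MNL.Vec d, ‖θ‖ ≤ Lθ →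
        κ ≤ MNL.mnlProb (M.reach s a) (φ s a) θ s₁ * MNL.mnlProb (M.reach s a) (φ s a) θ s₂) →
      0 < δ → δ < 1 →
      -- the learner runs the algorithm with the stated parameters
      MNL.IsUCRLMNLPlus M φ
        { reg := cReg * (Lφ ^ 2 * d * Real.log U)
          step := cStep * Real.log U
          conf := fun k => cConf * (√d * Real.log U * Real.log (1 + k * H / δ))
          radius := Lθ } alg →
      -- with probability at least `1 - δ` the regret of `K` episodes is bounded (`T = K * H`)
      ENNReal.ofReal (1 - δ) ≤ (M.run init alg K).toOuterMeasure
        {hist | M.regret alg hist ≤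
          C * Real.log (1 + U * (K * H) / δ) ^ q *
            (d * (H : ℝ) ^ (3 / 2 : ℝ) * √(K * H) + κ⁻¹ * (d : ℝ) ^ 2 * (H : ℝ) ^ 2)} := by
  -- The exponent is 5 because the radius carries Λ² and the potential Λ, so their product in the
  -- second order bonus is Λ⁴ · Λ. The deviation term has the same order, D of order Λ⁴ times a
  -- logarithm.
  refine ⟨5, fun L₀ hL₀ => ⟨MNL.regConst L₀, MNL.confConst L₀, MNL.stepConst L₀,
    MNL.regretConst L₀, MNL.regConst_pos hL₀, zero_lt_one.trans_le (MNL.one_le_confConst hL₀),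
    MNL.stepConst_pos L₀, MNL.regretConst_pos hL₀, ?_⟩⟩
  intro S A d H K U Lφ Lθ κ δ M φ θs init alg hd hH hK hLφ hLθ hL hM hU _ hφ hθ h0 hκ hκ' hδ hδ1
    halg
  have hr : MNL.Regular M φ θs (MNL.params L₀ Lφ Lθ δ d U H) Lφ L₀ :=
    MNL.regular_params hd hLφ hLθ hL hM hU hφ hθ h0
  replace halg : MNL.IsUCRLMNLPlus M φ (MNL.params L₀ Lφ Lθ δ d U H) alg := halg
  have hc := MNL.one_le_confConst hL₀
  have hU2 : (2 : ℝ) ≤ U := by exact_mod_cast hU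
  have hd1 : (1 : ℝ) ≤ d := by exact_mod_cast hd
  have hH1 : (1 : ℝ) ≤ H := by exact_mod_cast hH
  have hK1 : (1 : ℝ) ≤ K := by exact_mod_cast hK
  have hlogU := MNL.half_le_log hU2
  set Λ := Real.log (1 + U * (K * H) / δ) with hΛ
  have hKH : (1 : ℝ) ≤ K * H := one_le_mul_of_one_le_of_one_le hK1 hH1
  have hUT : (U : ℝ) / δ ≤ U * (K * H) / δ := by
    gcongr
    exact le_mul_of_one_le_right (by positivity) hKH
  have hUδ : (U : ℝ) ≤ U / δ := by
    rw [le_div_iff₀ hδ]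
    nlinarith
  have h2δ : 2 / δ ≤ U / δ := by gcongr
  have hΛ1 : 1 ≤ Λ := by
    rw [hΛ, Real.le_log_iff_exp_le (by positivity)]
    have := Real.exp_one_lt_d9
    linarith
  have hΛU : Real.log U ≤ Λ := Real.log_le_log (by linarith) (by linarith)
  have hΛδ : Real.log (2 / δ) ≤ Λ := Real.log_le_log (by positivity) (by linarith)
  have hlog : ∀ k : ℕ, k ≤ K → Real.log (1 + k * H / δ) ≤ Λ := fun k hk => by
    refine Real.log_le_log (by positivity) ?_
    have hk' : (k : ℝ) ≤ K := by exact_mod_cast hk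
    have : (k : ℝ) * H ≤ U * (K * H) := by nlinarith
    gcongr
  have hΛK : Real.log (1 + K) ≤ Λ := by
    refine le_trans (Real.log_le_log (by linarith) ?_) (hlog K le_rfl)
    have : (K : ℝ) ≤ K * H / δ := by
      rw [le_div_iff₀ hδ]
      nlinarith
    linarith
  have hlog0 : ∀ k : ℕ, 0 ≤ Real.log (1 + k * H / δ) := fun k =>
    Real.log_nonneg (le_add_of_nonneg_right (by positivity))
  have hp : ∀ k, 0 ≤ (MNL.params L₀ Lφ Lθ δ d U H).conf k := fun k => by
    have := hlog0 k
    simp only [MNL.params]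
    positivity
  set β := MNL.confConst L₀ * √d * Λ ^ 2 with hβ
  have hβ0 : 0 ≤ β := by positivity
  have hconf : ∀ n < K, (MNL.params L₀ Lφ Lθ δ d U H).conf (n + 1) ≤ β := fun n hn => by
    have h1 := hlog (n + 1) hn
    have h2 := hlog0 (n + 1)
    simp only [MNL.params]
    calc _ ≤ MNL.confConst L₀ * (√d * Λ * Λ) := by gcongr
      _ = β := by rw [hβ]; ring
  -- The factor d in λ cancels the d in β², which keeps the bound `D` of an episode's bonuses free
  -- of the dimension.
  have hreg : β ^ 2 * (Lφ ^ 2 / (MNL.params L₀ Lφ Lθ δ d U H).reg) ≤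
      MNL.confConst L₀ ^ 2 * Λ ^ 4 := by
    rw [← mul_div_assoc, div_le_iff₀ hr.reg_pos]
    have hrc : 2 ≤ MNL.regConst L₀ := by
      have := Real.one_le_exp (by linarith : 0 ≤ 4 * L₀)
      rw [MNL.regConst, MNL.stepConst]
      nlinarith
    have h1 : 1 ≤ MNL.regConst L₀ * Real.log U := by nlinarith
    have e1 : β ^ 2 * Lφ ^ 2 = MNL.confConst L₀ ^ 2 * Λ ^ 4 * (Lφ ^ 2 * d) * 1 := by
      calc _ = MNL.confConst L₀ ^ 2 * Λ ^ 4 * (Lφ ^ 2 * √d ^ 2) * 1 := by rw [hβ]; ring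
        _ = _ := by rw [Real.sq_sqrt (Nat.cast_nonneg d)]
    rw [e1]
    calc _ ≤ MNL.confConst L₀ ^ 2 * Λ ^ 4 * (Lφ ^ 2 * d) * (MNL.regConst L₀ * Real.log U) := by
          gcongr
      _ = _ := by simp only [MNL.params]; ring
  set D := 2 * (1 + 4 * MNL.confConst L₀ ^ 2) * Λ ^ 4 * (H : ℝ) ^ 2 with hD
  have hD0 : 0 < D := by positivity
  have hbonus : ∀ past : MNL.History S A, past.length < K → ∀ h s a,
      2 * MNL.bonus M φ (MNL.params L₀ Lφ Lθ δ d U H) past h s a * H ≤ D := by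
    intro past hpast h s a
    have h1 := hr.bonus_le past h s a
    have h2 : (MNL.params L₀ Lφ Lθ δ d U H).conf (past.length + 1) ^ 2 *
        (Lφ ^ 2 / (MNL.params L₀ Lφ Lθ δ d U H).reg) ≤ MNL.confConst L₀ ^ 2 * Λ ^ 4 := by
      refine le_trans (mul_le_mul_of_nonneg_right
        (pow_le_pow_left₀ (hp _) (hconf _ hpast) 2) ?_) hreg
      exact div_nonneg (sq_nonneg _) hr.reg_pos.le
    have h3 : (1 : ℝ) ≤ Λ ^ 4 := one_le_pow₀ hΛ1
    calc _ ≤ 2 * (H * (1 + 4 * (MNL.confConst L₀ ^ 2 * Λ ^ 4))) * H := by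
          gcongr
          exact h1.trans (by gcongr)
      _ ≤ 2 * (H * (Λ ^ 4 + 4 * (MNL.confConst L₀ ^ 2 * Λ ^ 4))) * H := by gcongr
      _ = D := by rw [hD]; ring
  refine hr.ofReal_one_sub_le_toOuterMeasure hp hH init alg hδ hD0 hbonus ?_
  intro hist hlen hvalid hnoise hdev
  have hconfident : ∀ e past, e :: past <:+ hist →
      MNL.Confident M φ θs (MNL.params L₀ Lφ Lθ δ d U H) past := by
    intro e past hsuf h hh
    have hsuf' : past <:+ hist := (List.suffix_cons e past).trans hsuf
    have h1 := hr.quad_estimate_le_log hH hδ hδ1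
      (fun e' he' => hvalid e' (hsuf'.subset he')) hh
      -- Confidence is needed for the past before each episode, which is itself a prefix of the
      -- history. An empty past carries no noise, so control at nonempty prefixes suffices.
      (fun e' past' heq => hnoise h hh e' past' (heq ▸ hsuf'))
    refine h1.trans ?_
    have hx : 1 / 2 ≤ Real.log (1 + ((past.length : ℝ) + 1) * H / δ) := by
      refine MNL.half_le_log ?_
      have : 1 ≤ ((past.length : ℝ) + 1) * H / δ := by
        rw [le_div_iff₀ hδ]
        have : (0 : ℝ) ≤ past.length := Nat.cast_nonneg _
        nlinarith
      linarith
    have h2 := MNL.le_conf_sq (L₀ := L₀) hd hLφ hLθ hL hlogU hx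
    simp only [MNL.params]
    push_cast
    exact h2
  have hregret := hr.regret_le hp halg hist hconfident
  have hsum := hr.histSum_realizedBonus_le hp hκ hκ' hvalid (β := β)
    (fun n hn => hconf n (hlen ▸ hn)) hβ0
    (P := 2 * Real.exp (4 * L₀) * (d * Λ)) (by rw [hlen]; gcongr)
  rw [hlen] at hsum
  have hfinal := MNL.total_bound_le (H := H) hL₀ hκ hd hK hΛ1
  have hDlog : 4 * D * Real.log (2 / δ) ≤ 4 * D * Λ := by gcongr
  rw [Set.mem_ofPred_eq, mul_assoc (d : ℝ), MNL.rpow_mul_sqrt_eq]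
  linarith
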